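/- **Conventions.** A *prederivator* is a strict 2-functor $\mathbb D\colon \mathbf{Cat}^{op}\to\mathbf{CAT}$ on small categories (functors are reversed, natural transformations are not). It sends $u\colon J\to K$ to $u^*\colon\mathbb D(K)\to\mathbb D(J)$. It is a *derivator* if (Der1) it sends coproducts to products, (Der2) isomorphisms are detected on objects $k\colon e\to K$, (Der3) each $u^*$ has a left adjoint $u_!$ and a right adjoint $u_*$, and (Der4) the canonical maps $\pi_!\mathrm{pr}^*\to k^*u_!$ (over $J_{/k}$) and $k^*u_*\to\pi_*\mathrm{pr}^*$ (over $J_{k/}$) are isomorphisms. Morphisms are pseudonatural transformations, natural transformations between them are modifications, an *isomodification* is a levelwise invertible modification, and an *equivalence of derivators* is a morphism that is levelwise an equivalence of categories. Adjunctions of morphisms have modifications as unit and counit. Write $\mathbb D^A(K)=\mathbb D(K\times A)$; for $v\colon A\to B$ there are morphisms $v^*\colon\mathbb D^B\to\mathbb D^A$ and, if $\mathbb D$ is a derivator, $v_!,v_*\colon\mathbb D^A\to\mathbb D^B$. Let $\square=\{0,1\}^2$, let $i_0\colon\square\setminus\{(1,1)\}\to\square$ and $i_1\colon\square\setminus\{(0,0)\}\to\square$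 be the inclusions, and put $\Sigma=(1,1)^*\,i_1^*\,(i_0)_!\,(0,0)_*$ and $\Omega=(0,0)^*\,i_0^*\,(i_1)_*\,(1,1)_!$. A derivator $\mathbb D$ is *stable* if $\mathbb D(e)$ has a zero object and $(\Sigma,\Omega)$ is an adjoint equivalence of $\mathbb D$. Let $V=\{(i,j)\in\mathbb Z^2:|i-j|\le 1\}$, $\partial V=\{(i,j)\in V: i\ne j\}$, $V^{\le 0}=\{(i,j)\in V: i,j\le 0\}$, $V^{\ge 0}=\{(i,j)\in V: i,j\ge 0\}$ and $V'=V^{\le 0}\cup\partial V$ (posets with the product order). * $\mathrm{Sp}\,\mathbb D\subset\mathbb D^V$ consists of the objects whose restriction to $\partial V$ is zero. * Let $w\colon\square\times V\to V$ have the values $w(0,0,i,j)=(i,j)$, $w(1,0,i,j)=(j+1,j)$, $w(0,1,i,j)=(i,i+1)$, $w(1,1,i,j)=(j+1,i+1)$. Let $A$ be $\square$ with a new initial object $\varnothing$ added, and let $s\colon\square\to A$ send $(0,0)$ to $\varnothing$ and be the identity elsewhere. For $X\in\mathrm{Sp}\,\mathbb D$ let $\phi_X\colon X\to\Omega\sigma^*X$,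 where $\sigma(i,j)=(j+1,i+1)$, be the restriction of $(s\times 1_V)_*w^*X$ to the arrow $\varnothing\to(0,0)$ of $A$. Then $X$ is an *$\Omega$-spectrum* if $\phi_X$ is an isomorphism, and $\mathrm{St}\,\mathbb D\subset\mathrm{Sp}\,\mathbb D$ is the full subprederivator of $\Omega$-spectra, with inclusion $i$. * $L\colon\mathbb D\to\mathbb D^V$ is the composite of $(0,0)_!\colon\mathbb D\to\mathbb D^{V^{\le 0}}$, of $\iota_{\le0,*}\colon\mathbb D^{V^{\le 0}}\to\mathbb D^{V'}$ and of $\iota_!\colon\mathbb D^{V'}\to\mathbb D^V$, for the inclusions $\iota_{\le 0},\iota$. * Let $\omega\colon V^{\ge0}\times V\to V$ be $\omega((a,b),(i,j))=(a+i',\,b+j')$, where $i'=i$ if $a$ is even and $i'=j$ if $a$ is odd, while $j'=j$ if $b$ is even and $j'=i$ if $b$ is odd. Let $Z\subset V^{\ge0}\times\mathbb N$ be the subposet of those $((i,j),k)$ with $k\le i$ whenever $i=j$, let $f\colon Z\to V^{\ge 0}\times\mathbb N$ be the inclusion, $\zeta\colon Z\to V^{\ge 0}$ the projection, and $\pi\colon\mathbb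 N\to e$. Then $\mathrm{loc}\,X=\pi_!\,(\{(0,0)\}\times\mathbb N)^*\,f_*\,\zeta^*\,\omega^*X$, a coherent form of $\operatorname{colim}(X\to\Omega\sigma^*X\to\Omega^2(\sigma^*)^2X\to\cdots)$. **Proposition.** Let $\mathbb S$ be a stable derivator. Then $\mathrm{loc}\,L$ takes values in $\mathrm{St}\,\mathbb S$, and the resulting stabilization morphism $\mathrm{stab}=\mathrm{loc}\,L\colon\mathbb S\to\mathrm{St}\,\mathbb S$ is an equivalence of derivators. Moreover $\mathrm{stab}$ is left adjoint to $(0,0)^*i\colon\mathrm{St}\,\mathbb S\to\mathbb S$, and the unit and the counit of any such adjunction $(\mathrm{stab},(0,0)^*i)$ are isomodifications. -/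

import Mathlib

open CategoryTheory

universe w v u v₁ u₁ v₂ u₂ v₃ u₃

/-- A prederivator: a strict 2-functor `Catᵒᵖ ⥤ CAT`, reversing functors and preserving the
direction of natural transformations. -/
structure Prederivator where
  obj : (K : Type w) → [SmallCategory K] → Type u
  [cat : ∀ (K : Type w) [SmallCategory K], Category.{v} (obj K)]
  map : ∀ {J K : Type w} [SmallCategory J] [SmallCategory K], (J ⥤ K) → (obj K ⥤ obj J)
  map₂ : ∀ {J K : Type w} [SmallCategory J] [SmallCategory K] {f g : J ⥤ K},
    (f ⟶ g) → (map f ⟶ map g)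
  map_id : ∀ (K : Type w) [SmallCategory K], map (𝟭 K) = 𝟭 (obj K)
  map_comp : ∀ {I J K : Type w} [SmallCategory I] [SmallCategory J] [SmallCategory K]
    (f : I ⥤ J) (g : J ⥤ K), map (f ⋙ g) = map g ⋙ map f
  map₂_id : ∀ {J K : Type w} [SmallCategory J] [SmallCategory K] (f : J ⥤ K),
    map₂ (𝟙 f) = 𝟙 (map f)
  map₂_comp : ∀ {J K : Type w} [SmallCategory J] [SmallCategory K] {f g h : J ⥤ K}
    (α : f ⟶ g) (β : g ⟶ h), map₂ (α ≫ β) = map₂ α ≫ map₂ β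
  map₂_whiskerLeft : ∀ {I J K : Type w} [SmallCategory I] [SmallCategory J] [SmallCategory K]
    (f : I ⥤ J) {g h : J ⥤ K} (α : g ⟶ h),
    map₂ (Functor.whiskerLeft f α) =
      eqToHom (map_comp f g) ≫ Functor.whiskerRight (map₂ α) (map f) ≫
        eqToHom (map_comp f h).symm
  map₂_whiskerRight : ∀ {I J K : Type w} [SmallCategory I] [SmallCategory J] [SmallCategory K]
    {f g : I ⥤ J} (α : f ⟶ g) (h : J ⥤ K),
    map₂ (Functor.whiskerRight α h) =
      eqToHom (map_comp f h) ≫ Functor.whiskerLeft (map h) (map₂ α) ≫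
        eqToHom (map_comp g h).symm

namespace Prederivator

attribute [instance] Prederivator.cat

/-- The terminal category. -/
abbrev Pt : Type w := Discrete PUnit.{w + 1}

/-- The functor from the terminal category that classifies an object. -/
abbrev pt {K : Type w} [SmallCategory K] (k : K) : Pt.{w} ⥤ K := Functor.fromPUnit k

/-- The functor to the terminal category. -/
abbrev bang (K : Type w) [SmallCategory K] : K ⥤ Pt.{w} := Functor.star K

section Basic

variable (D : Prederivator.{w, v, u})
variable {I J K L : Type w} [SmallCategory I] [SmallCategory J] [SmallCategory K] [SmallCategory L]

/-- The equality `(f ⋙ g)^* = f^* g^*`, as an isomorphism. -/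
def mc (f : I ⥤ J) (g : J ⥤ K) : D.map (f ⋙ g) ≅ D.map g ⋙ D.map f :=
  eqToIso (D.map_comp f g)

/-- The equality `id^* = id`, as an isomorphism. -/
def mi (K : Type w) [SmallCategory K] : D.map (𝟭 K) ≅ 𝟭 (D.obj K) := eqToIso (D.map_id K)

theorem mc_assoc (f : I ⥤ J) (g : J ⥤ K) (h : K ⥤ L) (X : D.obj L) :
    (D.mc (f ⋙ g) h).hom.app X ≫ (D.mc f g).hom.app ((D.map h).obj X) =
      (D.mc f (g ⋙ h)).hom.app X ≫ (D.map f).map ((D.mc g h).hom.app X) := by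
  simp [mc, eqToHom_app, eqToHom_map]

theorem mc_id_left (f : I ⥤ J) (X : D.obj J) :
    (D.mc (𝟭 I) f).hom.app X = (D.mi I).inv.app ((D.map f).obj X) := by
  simp [mc, mi, eqToHom_app]

theorem mc_id_right (f : I ⥤ J) (X : D.obj J) :
    (D.mc f (𝟭 J)).hom.app X = (D.map f).map ((D.mi J).inv.app X) := by
  simp [mc, mi, eqToHom_app, eqToHom_map]

theorem map₂_whiskerLeft_app (f : I ⥤ J) {g h : J ⥤ K} (α : g ⟶ h) (X : D.obj K) :
    (D.map₂ (Functor.whiskerLeft f α)).app X ≫ (D.mc f h).hom.app X =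
      (D.mc f g).hom.app X ≫ (D.map f).map ((D.map₂ α).app X) := by
  simp [mc, D.map₂_whiskerLeft]

theorem map₂_whiskerRight_app {f g : I ⥤ J} (α : f ⟶ g) (h : J ⥤ K) (X : D.obj K) :
    (D.map₂ (Functor.whiskerRight α h)).app X ≫ (D.mc g h).hom.app X =
      (D.mc f h).hom.app X ≫ (D.map₂ α).app ((D.map h).obj X) := by
  simp [mc, D.map₂_whiskerRight]

theorem isIso_map₂ {f g : J ⥤ K} (α : f ⟶ g) [IsIso α] : IsIso (D.map₂ α) :=
  ⟨D.map₂ (inv α), by rw [← D.map₂_comp, IsIso.hom_inv_id, D.map₂_id],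
    by rw [← D.map₂_comp, IsIso.inv_hom_id, D.map₂_id]⟩

theorem isIso_map_comp {f : I ⥤ J} {g : J ⥤ K} {X Y : D.obj K} (m : X ⟶ Y)
    (h : IsIso ((D.map g).map m)) : IsIso ((D.map (f ⋙ g)).map m) :=
  (NatIso.isIso_map_iff (D.mc f g) m).2 (Functor.map_isIso (D.map f) ((D.map g).map m))

/-- The 2-cell `u^* f^* ⟶ k^* g^*` (in diagrammatic order) that a prederivator assigns to a square
in `Cat` that is filled by a natural transformation. -/
def sq {f : I ⥤ J} {u : J ⥤ L} {g : I ⥤ K} {k : K ⥤ L} (α : f ⋙ u ⟶ g ⋙ k) :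
    D.map u ⋙ D.map f ⟶ D.map k ⋙ D.map g :=
  (D.mc f u).inv ≫ D.map₂ α ≫ (D.mc g k).hom

variable {A B : Type w} [SmallCategory A] [SmallCategory B]

theorem sq_whisker_k {f : I ⥤ J} {u : J ⥤ L} {g : I ⥤ K} {k m : K ⥤ L} (α : f ⋙ u ⟶ g ⋙ k)
    (θ : k ⟶ m) (Y : D.obj L) :
    (D.sq (α ≫ Functor.whiskerLeft g θ)).app Y =
      (D.sq α).app Y ≫ (D.map g).map ((D.map₂ θ).app Y) := by
  simp [sq, D.map₂_comp, D.map₂_whiskerLeft_app]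

theorem sq_whisker_f {f m : I ⥤ J} {u : J ⥤ L} {g : I ⥤ K} {k : K ⥤ L} (α : f ⋙ u ⟶ g ⋙ k)
    (θ : m ⟶ f) (Y : D.obj L) :
    (D.sq (Functor.whiskerRight θ u ≫ α)).app Y =
      (D.map₂ θ).app ((D.map u).obj Y) ≫ (D.sq α).app Y := by
  rw [← cancel_epi ((D.mc m u).hom.app Y), ← reassoc_of% (D.map₂_whiskerRight_app θ u Y)]
  simp [sq, D.map₂_comp]

/-- Horizontal pasting of squares, for `sq`. -/
theorem sq_paste {f : I ⥤ J} {u : J ⥤ L} {g : I ⥤ K} {k : K ⥤ L} (α : f ⋙ u ⟶ g ⋙ k)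
    {p : A ⥤ I} {h : A ⥤ B} {q : B ⥤ K} (β : p ⋙ g ⟶ h ⋙ q) (Y : D.obj L) :
    (D.sq (f := p ⋙ f) (u := u) (g := h) (k := q ⋙ k)
      (Functor.whiskerLeft p α ≫ Functor.whiskerRight β k)).app Y =
      (D.mc p f).hom.app _ ≫ (D.map p).map ((D.sq α).app Y) ≫ (D.sq β).app _ ≫
        (D.map h).map ((D.mc q k).inv.app Y) := by
  have e1 := D.map₂_whiskerLeft_app p α Y
  have e2 := D.map₂_whiskerRight_app β k Y
  have e3 := D.mc_assoc p f u Y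
  have e4 := D.mc_assoc p g k Y
  have e5 := D.mc_assoc h q k Y
  have e0 : (D.map₂ (f := (p ⋙ f) ⋙ u) (g := h ⋙ q ⋙ k)
      (Functor.whiskerLeft p α ≫ Functor.whiskerRight β k)).app Y =
      (D.map₂ (Functor.whiskerLeft p α)).app Y ≫ (D.map₂ (Functor.whiskerRight β k)).app Y :=
    congrArg (fun t => t.app Y)
      (D.map₂_comp (Functor.whiskerLeft p α) (Functor.whiskerRight β k))
  rw [← Iso.app_hom, ← Iso.app_hom, ← Iso.eq_comp_inv] at e1 e2
  simp only [Iso.app_hom, Iso.app_inv, Category.assoc] at e1 e2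
  have e3b : (D.mc p (f ⋙ u)).hom.app Y = (D.mc (p ⋙ f) u).hom.app Y ≫
      (D.mc p f).hom.app ((D.map u).obj Y) ≫ (D.map p).map ((D.mc f u).inv.app Y) := by
    rw [reassoc_of% e3, ← Functor.map_comp, Iso.hom_inv_id_app, CategoryTheory.Functor.map_id,
      Category.comp_id]
  have e4b : (D.mc p (g ⋙ k)).inv.app Y ≫ (D.mc (p ⋙ g) k).hom.app Y =
      (D.map p).map ((D.mc g k).hom.app Y) ≫ (D.mc p g).inv.app ((D.map k).obj Y) := by
    rw [← cancel_mono ((D.mc p g).hom.app ((D.map k).obj Y)), Category.assoc, e4]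
    simp
  have e5b : (D.mc (h ⋙ q) k).inv.app Y ≫ (D.mc h (q ⋙ k)).hom.app Y =
      (D.mc h q).hom.app ((D.map k).obj Y) ≫ (D.map h).map ((D.mc q k).inv.app Y) := by
    rw [← cancel_epi ((D.mc (h ⋙ q) k).hom.app Y), reassoc_of% e5]
    simp [← Functor.map_comp]
  have lhs : (D.sq (f := p ⋙ f) (u := u) (g := h) (k := q ⋙ k)
      (Functor.whiskerLeft p α ≫ Functor.whiskerRight β k)).app Y =
      (D.mc (p ⋙ f) u).inv.app Y ≫ ((D.map₂ (Functor.whiskerLeft p α)).app Y ≫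
        (D.map₂ (Functor.whiskerRight β k)).app Y) ≫ (D.mc h (q ⋙ k)).hom.app Y := by
    rw [← e0]; rfl
  rw [lhs, e1, e2, e3b]
  simp only [Category.assoc]
  rw [e5b, reassoc_of% e4b]
  simp [sq]

/-- The other horizontal pasting of squares, for `sq`. -/
theorem sq_paste2 {f : I ⥤ J} {u : J ⥤ L} {g : I ⥤ K} {k : K ⥤ L} (α : g ⋙ k ⟶ f ⋙ u)
    {p : A ⥤ I} {h : A ⥤ B} {q : B ⥤ K} (β : h ⋙ q ⟶ p ⋙ g) (Y : D.obj L) :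
    (D.sq (f := h) (u := q ⋙ k) (g := p ⋙ f) (k := u)
      (Functor.whiskerRight β k ≫ Functor.whiskerLeft p α)).app Y =
      (D.map h).map ((D.mc q k).hom.app Y) ≫ (D.sq β).app _ ≫ (D.map p).map ((D.sq α).app Y) ≫
        (D.mc p f).inv.app _ := by
  have e1 := D.map₂_whiskerLeft_app p α Y
  have e2 := D.map₂_whiskerRight_app β k Y
  have e3 := D.mc_assoc h q k Y
  have e4 := D.mc_assoc p g k Y
  have e5 := D.mc_assoc p f u Y
  have e0 : (D.map₂ (f := h ⋙ q ⋙ k) (g := (p ⋙ f) ⋙ u)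
      (Functor.whiskerRight β k ≫ Functor.whiskerLeft p α)).app Y =
      (D.map₂ (Functor.whiskerRight β k)).app Y ≫ (D.map₂ (Functor.whiskerLeft p α)).app Y :=
    congrArg (fun t => t.app Y)
      (D.map₂_comp (Functor.whiskerRight β k) (Functor.whiskerLeft p α))
  rw [← Iso.app_hom, ← Iso.app_hom, ← Iso.eq_comp_inv] at e1 e2
  simp only [Iso.app_hom, Iso.app_inv, Category.assoc] at e1 e2
  have e3b : (D.mc h (q ⋙ k)).inv.app Y ≫ (D.mc (h ⋙ q) k).hom.app Y =
      (D.map h).map ((D.mc q k).hom.app Y) ≫ (D.mc h q).inv.app ((D.map k).obj Y) := by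
    rw [← cancel_mono ((D.mc h q).hom.app ((D.map k).obj Y)), Category.assoc, e3]
    simp
  have e4b : (D.mc (p ⋙ g) k).inv.app Y ≫ (D.mc p (g ⋙ k)).hom.app Y =
      (D.mc p g).hom.app ((D.map k).obj Y) ≫ (D.map p).map ((D.mc g k).inv.app Y) := by
    rw [← cancel_epi ((D.mc (p ⋙ g) k).hom.app Y), reassoc_of% e4]
    simp [← Functor.map_comp]
  have e5b : (D.mc p (f ⋙ u)).inv.app Y ≫ (D.mc (p ⋙ f) u).hom.app Y =
      (D.map p).map ((D.mc f u).hom.app Y) ≫ (D.mc p f).inv.app ((D.map u).obj Y) := by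
    rw [← cancel_mono ((D.mc p f).hom.app ((D.map u).obj Y)), Category.assoc, e5]
    simp
  have lhs : (D.sq (f := h) (u := q ⋙ k) (g := p ⋙ f) (k := u)
      (Functor.whiskerRight β k ≫ Functor.whiskerLeft p α)).app Y =
      (D.mc h (q ⋙ k)).inv.app Y ≫ ((D.map₂ (Functor.whiskerRight β k)).app Y ≫
        (D.map₂ (Functor.whiskerLeft p α)).app Y) ≫ (D.mc (p ⋙ f) u).hom.app Y := by
    rw [← e0]; rfl
  rw [lhs, e1, e2]
  simp only [Category.assoc]
  rw [e5b, reassoc_of% e3b, reassoc_of% e4b]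
  simp [sq]

end Basic

/-- A prederivator sends an adjunction `l ⊣ r` to an adjunction `r^* ⊣ l^*`. -/
def mapAdj (D : Prederivator.{w, v, u}) {P Q : Type w} [SmallCategory P] [SmallCategory Q]
    {l : Q ⥤ P} {r : P ⥤ Q} (adj : l ⊣ r) : D.map r ⊣ D.map l :=
  Adjunction.mkOfUnitCounit
    { unit := (D.mi Q).inv ≫ D.map₂ adj.unit ≫ (D.mc l r).hom
      counit := (D.mc r l).inv ≫ D.map₂ adj.counit ≫ (D.mi P).hom
      left_triangle := by
        ext X
        have e1 := D.map₂_whiskerLeft_app r adj.unit X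
        have e2 := D.map₂_whiskerRight_app adj.counit r X
        have e3 := D.mc_assoc r l r X
        have e4 := D.mc_id_left r X
        have e5 := D.mc_id_right r X
        have e0 : (D.map₂ (Functor.whiskerLeft r adj.unit)).app X ≫
            (D.map₂ (Functor.whiskerRight adj.counit r)).app X = 𝟙 _ := by
          have t : Functor.whiskerLeft r adj.unit ≫ Functor.whiskerRight adj.counit r = 𝟙 r := by
            ext x; simp
          exact (congrArg (fun t => t.app X) (D.map₂_comp (Functor.whiskerLeft r adj.unit)
            (Functor.whiskerRight adj.counit r))).symm.trans
            ((congrArg (fun t : r ⟶ r => (D.map₂ t).app X) t).trans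
              (congrArg (fun t => t.app X) (D.map₂_id r)))
        simp only [Functor.id_obj, Functor.comp_obj, Functor.associator_hom_app, NatTrans.comp_app,
          Functor.whiskerRight_app, Functor.whiskerLeft_app, Functor.map_comp,
          Category.id_comp, Category.assoc]
        rw [← e5, ← reassoc_of% e1, ← reassoc_of% e3, Iso.hom_inv_id_app_assoc, ← reassoc_of% e2,
          e4, reassoc_of% e0, Iso.inv_hom_id_app]
        rfl
      right_triangle := by
        ext X
        have e1 := D.map₂_whiskerLeft_app l adj.counit X
        have e2 := D.map₂_whiskerRight_app adj.unit l X
        have e3 := D.mc_assoc l r l X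
        have e4 := D.mc_id_left l X
        have e5 := D.mc_id_right l X
        have e0 : (D.map₂ (Functor.whiskerRight adj.unit l)).app X ≫
            (D.map₂ (Functor.whiskerLeft l adj.counit)).app X = 𝟙 _ := by
          have t : Functor.whiskerRight adj.unit l ≫ Functor.whiskerLeft l adj.counit = 𝟙 l := by
            ext x; simp
          exact (congrArg (fun t => t.app X) (D.map₂_comp (Functor.whiskerRight adj.unit l)
            (Functor.whiskerLeft l adj.counit))).symm.trans
            ((congrArg (fun t : l ⟶ l => (D.map₂ t).app X) t).trans
              (congrArg (fun t => t.app X) (D.map₂_id l)))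
        have e3b : (D.mc l r).hom.app ((D.map l).obj X) ≫
            (D.map l).map ((D.mc r l).inv.app X) =
            (D.mc (l ⋙ r) l).inv.app X ≫ (D.mc l (r ⋙ l)).hom.app X := by
          rw [← cancel_epi ((D.mc (l ⋙ r) l).hom.app X), reassoc_of% e3]
          simp [← Functor.map_comp]
        simp only [Functor.id_obj, Functor.comp_obj, Functor.associator_inv_app, NatTrans.comp_app,
          Functor.whiskerRight_app, Functor.whiskerLeft_app, Functor.map_comp,
          Category.id_comp, Category.assoc]
        rw [reassoc_of% e3b, ← e4, ← reassoc_of% e2, Iso.hom_inv_id_app_assoc, ← reassoc_of% e1,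
          reassoc_of% e0, e5, ← Functor.map_comp, Iso.inv_hom_id_app]
        simp }

/-- Existence of left and right Kan extensions (Der3). -/
class HasKan (D : Prederivator.{w, v, u}) : Prop where
  left : ∀ {J K : Type w} [SmallCategory J] [SmallCategory K] (f : J ⥤ K),
    (D.map f).IsRightAdjoint
  right : ∀ {J K : Type w} [SmallCategory J] [SmallCategory K] (f : J ⥤ K),
    (D.map f).IsLeftAdjoint

section Kan

variable (D : Prederivator.{w, v, u}) [D.HasKan]
variable {I J K L : Type w} [SmallCategory I] [SmallCategory J] [SmallCategory K] [SmallCategory L]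
variable {A B : Type w} [SmallCategory A] [SmallCategory B]

/-- The left Kan extension `f_!`. -/
noncomputable def lan (f : J ⥤ K) : D.obj J ⥤ D.obj K :=
  haveI := HasKan.left (D := D) f
  (D.map f).leftAdjoint

/-- The right Kan extension `f_*`. -/
noncomputable def ran (f : J ⥤ K) : D.obj J ⥤ D.obj K :=
  haveI := HasKan.right (D := D) f
  (D.map f).rightAdjoint

/-- The adjunction `f_! ⊣ f^*`. -/
noncomputable def lanAdj (f : J ⥤ K) : D.lan f ⊣ D.map f :=
  haveI := HasKan.left (D := D) f
  Adjunction.ofIsRightAdjoint (D.map f)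

/-- The adjunction `f^* ⊣ f_*`. -/
noncomputable def ranAdj (f : J ⥤ K) : D.map f ⊣ D.ran f :=
  haveI := HasKan.right (D := D) f
  Adjunction.ofIsLeftAdjoint (D.map f)

/-- The left mate `g_! f^* ⟶ k^* u_!` of a square `α : u f ⟶ k g`. -/
noncomputable def mateL {f : I ⥤ J} {u : J ⥤ L} {g : I ⥤ K} {k : K ⥤ L} (α : f ⋙ u ⟶ g ⋙ k) :
    D.map f ⋙ D.lan g ⟶ D.lan u ⋙ D.map k :=
  ((mateEquiv (D.lanAdj u) (D.lanAdj g)).symm (TwoSquare.mk _ _ _ _ (D.sq α))).natTrans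

/-- The right mate `k^* u_* ⟶ g_* f^*` of a square `α : k g ⟶ u f`. -/
noncomputable def mateR {f : I ⥤ J} {u : J ⥤ L} {g : I ⥤ K} {k : K ⥤ L} (α : g ⋙ k ⟶ f ⋙ u) :
    D.ran u ⋙ D.map k ⟶ D.map f ⋙ D.ran g :=
  (mateEquiv (D.ranAdj u) (D.ranAdj g) (TwoSquare.mk _ _ _ _ (D.sq α))).natTrans

theorem unit_mateL {f : I ⥤ J} {u : J ⥤ L} {g : I ⥤ K} {k : K ⥤ L} (α : f ⋙ u ⟶ g ⋙ k)
    (X : D.obj J) :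
    (D.lanAdj g).unit.app ((D.map f).obj X) ≫ (D.map g).map ((D.mateL α).app X) =
      (D.map f).map ((D.lanAdj u).unit.app X) ≫ (D.sq α).app ((D.lan u).obj X) :=
  (unit_mateEquiv_symm (D.lanAdj u) (D.lanAdj g) (TwoSquare.mk _ _ _ _ (D.sq α)) X).symm

theorem mateR_counit {f : I ⥤ J} {u : J ⥤ L} {g : I ⥤ K} {k : K ⥤ L} (α : g ⋙ k ⟶ f ⋙ u)
    (X : D.obj J) :
    (D.map g).map ((D.mateR α).app X) ≫ (D.ranAdj g).counit.app ((D.map f).obj X) =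
      (D.sq α).app ((D.ran u).obj X) ≫ (D.map f).map ((D.ranAdj u).counit.app X) :=
  mateEquiv_counit (D.ranAdj u) (D.ranAdj g) (TwoSquare.mk _ _ _ _ (D.sq α)) X

theorem isIso_mateR {f : I ⥤ J} {u : J ⥤ L} {g : I ⥤ K} {k : K ⥤ L} (α : g ⋙ k ⟶ f ⋙ u)
    (h : IsIso (D.mateL α)) : IsIso (D.mateR α) := by
  have e := iterated_mateEquiv_conjugateEquiv (D.lanAdj k) (D.lanAdj f) (D.ranAdj g) (D.ranAdj u)
    (TwoSquare.mk _ _ _ _ (D.mateL α))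
  have e2 : mateEquiv (D.lanAdj k) (D.lanAdj f) (TwoSquare.mk _ _ _ _ (D.mateL α)) =
      TwoSquare.mk _ _ _ _ (D.sq α) :=
    (mateEquiv (D.lanAdj k) (D.lanAdj f)).apply_symm_apply _
  rw [e2] at e
  have e3 : D.mateR α = _ := e
  rw [e3]
  have : IsIso (TwoSquare.mk (D.map g) (D.lan k) (D.lan f) (D.map u) (D.mateL α)) := h
  infer_instance

theorem mateL_unique {f : I ⥤ J} {u : J ⥤ L} {g : I ⥤ K} {k : K ⥤ L} (α : f ⋙ u ⟶ g ⋙ k)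
    (X : D.obj J) (m : (D.lan g).obj ((D.map f).obj X) ⟶ (D.map k).obj ((D.lan u).obj X))
    (h : (D.lanAdj g).unit.app ((D.map f).obj X) ≫ (D.map g).map m =
      (D.map f).map ((D.lanAdj u).unit.app X) ≫ (D.sq α).app ((D.lan u).obj X)) :
    (D.mateL α).app X = m := by
  apply ((D.lanAdj g).homEquiv _ _).injective
  rw [Adjunction.homEquiv_unit, Adjunction.homEquiv_unit, h]
  exact D.unit_mateL α X

theorem mateR_unique {f : I ⥤ J} {u : J ⥤ L} {g : I ⥤ K} {k : K ⥤ L} (α : g ⋙ k ⟶ f ⋙ u)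
    (X : D.obj J) (m : (D.map k).obj ((D.ran u).obj X) ⟶ (D.ran g).obj ((D.map f).obj X))
    (h : (D.map g).map m ≫ (D.ranAdj g).counit.app ((D.map f).obj X) =
      (D.sq α).app ((D.ran u).obj X) ≫ (D.map f).map ((D.ranAdj u).counit.app X)) :
    (D.mateR α).app X = m := by
  apply ((D.ranAdj g).homEquiv _ _).symm.injective
  rw [Adjunction.homEquiv_counit, Adjunction.homEquiv_counit, h]
  exact D.mateR_counit α X

theorem mateL_whisker_k {f : I ⥤ J} {u : J ⥤ L} {g : I ⥤ K} {k m : K ⥤ L}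
    (α : f ⋙ u ⟶ g ⋙ k) (θ : k ⟶ m) (X : D.obj J) :
    (D.mateL (α ≫ Functor.whiskerLeft g θ)).app X =
      (D.mateL α).app X ≫ (D.map₂ θ).app _ := by
  apply mateL_unique
  have e := D.unit_mateL α X
  simp only [Functor.comp_obj] at e
  rw [sq_whisker_k, Functor.map_comp, reassoc_of% e]

theorem mateL_whisker_f {f m : I ⥤ J} {u : J ⥤ L} {g : I ⥤ K} {k : K ⥤ L}
    (α : f ⋙ u ⟶ g ⋙ k) (θ : m ⟶ f) (X : D.obj J) :
    (D.mateL (Functor.whiskerRight θ u ≫ α)).app X =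
      (D.lan g).map ((D.map₂ θ).app X) ≫ (D.mateL α).app X := by
  apply mateL_unique
  have e := D.unit_mateL α X
  have n := (D.lanAdj g).unit.naturality ((D.map₂ θ).app X)
  have n2 := (D.map₂ θ).naturality ((D.lanAdj u).unit.app X)
  simp only [Functor.comp_obj, Functor.id_obj, Functor.id_map, Functor.comp_map] at e n n2
  rw [sq_whisker_f, Functor.map_comp, ← reassoc_of% n, e, reassoc_of% n2]

theorem mateR_whisker_k {f : I ⥤ J} {u : J ⥤ L} {g : I ⥤ K} {k m : K ⥤ L}
    (α : g ⋙ k ⟶ f ⋙ u) (θ : m ⟶ k) (X : D.obj J) :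
    (D.mateR (Functor.whiskerLeft g θ ≫ α)).app X =
      (D.map₂ θ).app _ ≫ (D.mateR α).app X := by
  apply mateR_unique
  have e := D.mateR_counit α X
  have e2 := D.map₂_whiskerLeft_app g θ ((D.ran u).obj X)
  simp only [Functor.comp_obj] at e
  rw [Functor.map_comp, Category.assoc, e, ← cancel_epi ((D.mc g m).hom.app ((D.ran u).obj X)),
    ← reassoc_of% e2]
  simp [sq, D.map₂_comp]

theorem mateR_whisker_f {f m : I ⥤ J} {u : J ⥤ L} {g : I ⥤ K} {k : K ⥤ L}
    (α : g ⋙ k ⟶ f ⋙ u) (θ : f ⟶ m) (X : D.obj J) :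
    (D.mateR (α ≫ Functor.whiskerRight θ u)).app X =
      (D.mateR α).app X ≫ (D.ran g).map ((D.map₂ θ).app X) := by
  apply mateR_unique
  have e := D.mateR_counit α X
  have e2 := D.map₂_whiskerRight_app θ u ((D.ran u).obj X)
  have n := (D.ranAdj g).counit.naturality ((D.map₂ θ).app X)
  have n2 := (D.map₂ θ).naturality ((D.ranAdj u).counit.app X)
  simp only [Functor.comp_obj, Functor.id_obj, Functor.id_map, Functor.comp_map] at e n n2
  rw [Functor.map_comp, Category.assoc, n, reassoc_of% e, n2]
  simp [sq, D.map₂_comp, e2]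

theorem mateL_id (g : I ⥤ K) (X : D.obj I) :
    (D.mateL (f := 𝟭 I) (u := g) (g := g) (k := 𝟭 K) (𝟙 g)).app X =
      (D.lan g).map ((D.mi I).hom.app X) ≫ (D.mi K).inv.app _ := by
  apply mateL_unique
  have e1 := D.mc_id_left g ((D.lan g).obj X)
  have e2 := D.mc_id_right g ((D.lan g).obj X)
  have e3 : (D.sq (f := 𝟭 I) (u := g) (g := g) (k := 𝟭 K) (𝟙 g)).app ((D.lan g).obj X) =
      (D.mc (𝟭 I) g).inv.app _ ≫ (D.mc g (𝟭 K)).hom.app _ := by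
    have : (D.map₂ (𝟙 g)).app ((D.lan g).obj X) = 𝟙 _ := by rw [D.map₂_id]; rfl
    refine Eq.trans ?_ (congrArg (fun t => (D.mc (𝟭 I) g).inv.app _ ≫ t ≫
      (D.mc g (𝟭 K)).hom.app _) this |>.trans
        (congrArg (fun t => (D.mc (𝟭 I) g).inv.app _ ≫ t) (Category.id_comp _)))
    rfl
  have n := (D.lanAdj g).unit.naturality ((D.mi I).hom.app X)
  have n2 := (D.mi I).hom.naturality ((D.lanAdj g).unit.app X)
  have e1b : (D.mc (𝟭 I) g).inv.app ((D.lan g).obj X) = (D.mi I).hom.app _ := by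
    rw [← cancel_epi ((D.mc (𝟭 I) g).hom.app ((D.lan g).obj X)), Iso.hom_inv_id_app, e1,
      Iso.inv_hom_id_app]
    rfl
  simp only [Functor.comp_obj, Functor.id_obj, Functor.id_map, Functor.comp_map] at n n2 e1b
  rw [e3, Functor.map_comp, ← reassoc_of% n, e2, e1b, reassoc_of% n2]
  rfl

theorem mateR_id (g : I ⥤ K) (X : D.obj I) :
    (D.mateR (f := 𝟭 I) (u := g) (g := g) (k := 𝟭 K) (𝟙 g)).app X =
      (D.mi K).hom.app _ ≫ (D.ran g).map ((D.mi I).inv.app X) := by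
  apply mateR_unique
  have e1 := D.mc_id_left g ((D.ran g).obj X)
  have e2 := D.mc_id_right g ((D.ran g).obj X)
  have e3 : (D.sq (f := g) (u := 𝟭 K) (g := 𝟭 I) (k := g) (𝟙 g)).app ((D.ran g).obj X) =
      (D.mc g (𝟭 K)).inv.app _ ≫ (D.mc (𝟭 I) g).hom.app _ := by
    have : (D.map₂ (𝟙 g)).app ((D.ran g).obj X) = 𝟙 _ := by rw [D.map₂_id]; rfl
    refine Eq.trans ?_ (congrArg (fun t => (D.mc g (𝟭 K)).inv.app _ ≫ t ≫
      (D.mc (𝟭 I) g).hom.app _) this |>.trans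
        (congrArg (fun t => (D.mc g (𝟭 K)).inv.app _ ≫ t) (Category.id_comp _)))
    rfl
  have n := (D.ranAdj g).counit.naturality ((D.mi I).inv.app X)
  have n2 := (D.mi I).inv.naturality ((D.ranAdj g).counit.app X)
  have e2b : (D.mc g (𝟭 K)).inv.app ((D.ran g).obj X) =
      (D.map g).map ((D.mi K).hom.app _) := by
    rw [← cancel_epi ((D.mc g (𝟭 K)).hom.app ((D.ran g).obj X)), Iso.hom_inv_id_app, e2,
      ← Functor.map_comp, Iso.inv_hom_id_app]
    exact (CategoryTheory.Functor.map_id (D.map g) _).symm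
  simp only [Functor.comp_obj, Functor.id_obj, Functor.id_map, Functor.comp_map] at n n2 e2b
  rw [e3, Functor.map_comp, Category.assoc, n, Category.assoc, e1, e2b, n2]
  rfl

/-- The left mate of a horizontal pasting. -/
theorem mateL_paste {f : I ⥤ J} {u : J ⥤ L} {g : I ⥤ K} {k : K ⥤ L} (α : f ⋙ u ⟶ g ⋙ k)
    {p : A ⥤ I} {h : A ⥤ B} {q : B ⥤ K} (β : p ⋙ g ⟶ h ⋙ q) (X : D.obj J) :
    (D.mateL (f := p ⋙ f) (u := u) (g := h) (k := q ⋙ k)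
      (Functor.whiskerLeft p α ≫ Functor.whiskerRight β k)).app X =
      (D.lan h).map ((D.mc p f).hom.app X) ≫ (D.mateL β).app _ ≫
        (D.map q).map ((D.mateL α).app X) ≫ (D.mc q k).inv.app _ := by
  apply mateL_unique
  rw [sq_paste]
  have e1 := D.unit_mateL α X
  have e2 := D.unit_mateL β ((D.map f).obj X)
  have n1 := (D.lanAdj h).unit.naturality ((D.mc p f).hom.app X)
  have n2 := (D.sq β).naturality ((D.mateL α).app X)
  have n3 := (D.mc p f).hom.naturality ((D.lanAdj u).unit.app X)
  simp only [Functor.id_map, Functor.comp_map, Functor.id_obj, Functor.comp_obj] at n1 n2 n3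
  simp only [Functor.map_comp, Functor.comp_obj]
  rw [← reassoc_of% n1, reassoc_of% e2, ← reassoc_of% n2, ← Functor.map_comp_assoc, e1,
    reassoc_of% n3, Functor.map_comp_assoc]

/-- The right mate of a horizontal pasting. -/
theorem mateR_paste {f : I ⥤ J} {u : J ⥤ L} {g : I ⥤ K} {k : K ⥤ L} (α : g ⋙ k ⟶ f ⋙ u)
    {p : A ⥤ I} {h : A ⥤ B} {q : B ⥤ K} (β : h ⋙ q ⟶ p ⋙ g) (X : D.obj J) :
    (D.mateR (f := p ⋙ f) (u := u) (g := h) (k := q ⋙ k)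
      (Functor.whiskerRight β k ≫ Functor.whiskerLeft p α)).app X =
      (D.mc q k).hom.app _ ≫ (D.map q).map ((D.mateR α).app X) ≫ (D.mateR β).app _ ≫
        (D.ran h).map ((D.mc p f).inv.app X) := by
  apply mateR_unique
  rw [sq_paste2]
  have e1 := D.mateR_counit α X
  have e2 := D.mateR_counit β ((D.map f).obj X)
  have n1 := (D.ranAdj h).counit.naturality ((D.mc p f).inv.app X)
  have n2 := (D.sq β).naturality ((D.mateR α).app X)
  have n3 := (D.mc p f).inv.naturality ((D.ranAdj u).counit.app X)
  simp only [Functor.id_map, Functor.comp_map, Functor.id_obj, Functor.comp_obj] at n1 n2 n3 e1 e2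
  simp only [Functor.map_comp, Functor.comp_obj, Category.assoc]
  rw [n1, reassoc_of% e2, reassoc_of% n2, ← n3, ← Functor.map_comp_assoc, e1,
    Functor.map_comp_assoc]

end Kan

/-- The canonical transformation from `J_{/k} ⟶ J ⟶ K` to the constant functor at `k`. -/
def commaL {J K : Type w} [SmallCategory J] [SmallCategory K] (f : J ⥤ K) (k : K) :
    CostructuredArrow.proj f k ⋙ f ⟶ bang (CostructuredArrow f k) ⋙ pt k where
  app X := X.hom
  naturality _ _ g := (CostructuredArrow.w g).trans (Category.comp_id _).symm

/-- The canonical transformation from the constant functor at `k` to `J_{k/} ⟶ J ⟶ K`. -/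
def commaR {J K : Type w} [SmallCategory J] [SmallCategory K] (f : J ⥤ K) (k : K) :
    bang (StructuredArrow k f) ⋙ pt k ⟶ StructuredArrow.proj k f ⋙ f where
  app X := X.hom
  naturality _ _ g := (Category.id_comp _).trans (StructuredArrow.w g).symm

/-- A derivator, with all small categories as diagram shapes. -/
class IsDerivator (D : Prederivator.{w, v, u}) : Prop extends D.HasKan where
  /-- Coproducts are sent to products. -/
  der1 : ∀ (I : Type w) (K : I → Type w) [∀ i, SmallCategory (K i)],
    (Functor.pi' fun i => D.map (Sigma.incl i : K i ⥤ Σ i, K i)).IsEquivalence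
  /-- Isomorphisms are detected pointwise. -/
  der2 : ∀ (K : Type w) [SmallCategory K] {X Y : D.obj K} (f : X ⟶ Y),
    (∀ k : K, IsIso ((D.map (pt k)).map f)) → IsIso f
  /-- Left Kan extensions are computed pointwise: `bang_! proj^* ⟶ k^* f_!` is invertible. -/
  der4L : ∀ {J K : Type w} [SmallCategory J] [SmallCategory K] (f : J ⥤ K) (k : K),
    IsIso (D.mateL (commaL f k))
  /-- Right Kan extensions are computed pointwise: `k^* f_* ⟶ bang_* proj^*` is invertible. -/
  der4R : ∀ {J K : Type w} [SmallCategory J] [SmallCategory K] (f : J ⥤ K) (k : K),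
    IsIso (D.mateR (commaR f k))

theorem isIso_of_bang {P : Type w} [SmallCategory P] {F G : P ⥤ Pt.{w}} (α : F ⟶ G) :
    IsIso α := by
  rw [NatTrans.isIso_iff_isIso_app]
  intro X
  infer_instance

section Der

variable (D : Prederivator.{w, v, u}) [D.HasKan]

theorem isIso_final {P Q : Type w} [SmallCategory P] [SmallCategory Q] {l : Q ⥤ P} {r : P ⥤ Q}
    (adj : l ⊣ r) (β : r ⋙ bang Q ⟶ bang P ⋙ 𝟭 _) : IsIso (D.mateL β) := by
  have e := iterated_mateEquiv_conjugateEquiv (D.lanAdj (bang Q)) (D.lanAdj (bang P))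
    (D.mapAdj adj) (D.mapAdj Adjunction.id)
    (TwoSquare.mk _ _ _ _ (D.mateL β))
  have e2 : mateEquiv (D.lanAdj (bang Q)) (D.lanAdj (bang P))
      (TwoSquare.mk _ _ _ _ (D.mateL β)) = TwoSquare.mk _ _ _ _ (D.sq β) :=
    (mateEquiv (D.lanAdj (bang Q)) (D.lanAdj (bang P))).apply_symm_apply _
  rw [e2] at e
  have e3 : IsIso (mateEquiv (D.mapAdj Adjunction.id) (D.mapAdj adj)
    (TwoSquare.mk _ _ _ _ (D.sq β))).natTrans := by
    rw [NatTrans.isIso_iff_isIso_app]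
    intro Y
    have h1 : ∀ Y, IsIso ((D.sq β).app Y) := by
      intro Y
      have := isIso_of_bang β
      have : IsIso (D.map₂ β) := D.isIso_map₂ β
      have : IsIso (D.sq β) := by unfold sq; infer_instance
      infer_instance
    have h2 : ∀ Z, IsIso ((D.mapAdj adj).unit.app ((D.map (bang Q)).obj Z)) := by
      intro Z
      have e := D.map₂_whiskerRight_app adj.unit (bang Q) Z
      have := isIso_of_bang (Functor.whiskerRight adj.unit (bang Q))
      have : IsIso (D.map₂ (Functor.whiskerRight adj.unit (bang Q))) := D.isIso_map₂ _
      have : IsIso ((D.map₂ adj.unit).app ((D.map (bang Q)).obj Z)) := by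
        have h := IsIso.comp_isIso
          (f := (D.map₂ (Functor.whiskerRight adj.unit (bang Q))).app Z)
          (h := (D.mc (l ⋙ r) (bang Q)).hom.app Z)
        rw [e] at h
        exact IsIso.of_isIso_comp_left ((D.mc (𝟭 Q) (bang Q)).hom.app Z) _
      have e2 : (D.mapAdj adj).unit.app ((D.map (bang Q)).obj Z) = (D.mi Q).inv.app _ ≫
        (D.map₂ adj.unit).app _ ≫ (D.mc l r).hom.app _ := rfl
      rw [e2]
      infer_instance
    have h3 : IsIso ((D.mapAdj (Adjunction.id (C := Pt.{w}))).counit.app Y) := by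
      have : IsIso (D.map₂ (Adjunction.id (C := Pt.{w})).counit) := D.isIso_map₂ _
      have e2 : (D.mapAdj (Adjunction.id (C := Pt.{w}))).counit.app Y = (D.mc _ _).inv.app _ ≫
        (D.map₂ (Adjunction.id (C := Pt.{w})).counit).app _ ≫ (D.mi _).hom.app _ := rfl
      rw [e2]
      infer_instance
    have e4 : (mateEquiv (D.mapAdj Adjunction.id) (D.mapAdj adj)
        (TwoSquare.mk _ _ _ _ (D.sq β))).natTrans.app Y = (D.mapAdj adj).unit.app _ ≫
        (D.map l).map ((D.sq β).app _ ≫ (D.map (bang P)).map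
          ((D.mapAdj (Adjunction.id (C := Pt.{w}))).counit.app Y)) := by
      simp [mateEquiv]
    rw [e4]
    have := h1 ((D.map (𝟭 _)).obj Y)
    have := h2 ((D.map (𝟭 _)).obj Y)
    exact IsIso.comp_isIso
  rw [e] at e3
  exact conjugateEquiv_of_iso ((D.lanAdj (bang Q)).comp (D.mapAdj Adjunction.id))
    ((D.mapAdj adj).comp (D.lanAdj (bang P))) (TwoSquare.mk _ _ _ _ (D.mateL β))

end Der

section Exact

variable {I J K L : Type w} [SmallCategory I] [SmallCategory J] [SmallCategory K] [SmallCategory L]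

/-- The functor between slice categories that is induced by a square. -/
def cmp {f : I ⥤ J} {u : J ⥤ L} {g : I ⥤ K} {k : K ⥤ L} (α : f ⋙ u ⟶ g ⋙ k) (q : K) :
    CostructuredArrow g q ⥤ CostructuredArrow u (k.obj q) where
  obj X := CostructuredArrow.mk (Y := f.obj X.left) (α.app X.left ≫ k.map X.hom)
  map {X Y} φ := CostructuredArrow.homMk (f.map φ.left) (by
    have := α.naturality φ.left
    simp only [Functor.comp_map] at this
    have h2 := CostructuredArrow.w φ
    simp only [CostructuredArrow.mk_hom_eq_self]
    rw [reassoc_of% this, ← k.map_comp, h2])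

variable (D : Prederivator.{w, v, u}) [D.IsDerivator]

theorem isIso_mateL {f : I ⥤ J} {u : J ⥤ L} {g : I ⥤ K} {k : K ⥤ L} (α : f ⋙ u ⟶ g ⋙ k)
    (h : ∀ q, (cmp α q).IsRightAdjoint) : IsIso (D.mateL α) := by
  rw [NatTrans.isIso_iff_isIso_app]
  intro X
  apply IsDerivator.der2
  intro q
  have hq := h q
  let r := cmp α q
  let β : r ⋙ bang (CostructuredArrow u (k.obj q)) ⟶ bang (CostructuredArrow g q) ⋙ 𝟭 _ := 𝟙 _
  let θ : 𝟭 _ ⋙ pt (k.obj q) ⟶ pt q ⋙ k :=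
    { app := fun _ => 𝟙 (k.obj q)
      naturality := fun _ _ _ => by simp }
  have hθ : IsIso θ := by
    have : ∀ x, IsIso (θ.app x) := fun x => inferInstanceAs (IsIso (𝟙 (k.obj q)))
    exact NatIso.isIso_of_isIso_app _
  have e1 := D.mateL_paste α (commaL g q) X
  have e2 := D.mateL_paste (commaL u (k.obj q)) β X
  have e3 := D.mateL_whisker_k (f := r ⋙ CostructuredArrow.proj u (k.obj q)) (u := u)
    (g := bang (CostructuredArrow g q))
    (Functor.whiskerLeft r (commaL u (k.obj q)) ≫ Functor.whiskerRight β (pt (k.obj q))) θ X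
  have e4 : (Functor.whiskerLeft r (commaL u (k.obj q)) ≫ Functor.whiskerRight β (pt (k.obj q))) ≫
      Functor.whiskerLeft (bang (CostructuredArrow g q)) θ =
      Functor.whiskerLeft (CostructuredArrow.proj g q) α ≫ Functor.whiskerRight (commaL g q) k := by
    ext x
    exact (congrArg (fun t => t ≫ 𝟙 (k.obj q)) (Category.comp_id _)).trans (Category.comp_id _)
  have i1 : IsIso (D.mateL (commaL g q)) := IsDerivator.der4L g q
  have i2 : IsIso (D.mateL (commaL u (k.obj q))) := IsDerivator.der4L u (k.obj q)
  have i3 : IsIso (D.mateL β) := D.isIso_final (Adjunction.ofIsRightAdjoint r) β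
  have i4 : IsIso (D.map₂ θ) := D.isIso_map₂ θ
  have h1 : IsIso ((D.mateL (f := CostructuredArrow.proj g q ⋙ f) (u := u)
      (g := bang (CostructuredArrow g q)) (k := pt q ⋙ k)
      (Functor.whiskerLeft (CostructuredArrow.proj g q) α ≫
        Functor.whiskerRight (commaL g q) k)).app X) := by
    have e5 := e3.symm.trans (congrArg (fun t => (D.mateL (f := CostructuredArrow.proj g q ⋙ f)
      (u := u) (g := bang (CostructuredArrow g q)) (k := pt q ⋙ k) t).app X) e4)
    have : IsIso ((D.mateL (f := r ⋙ CostructuredArrow.proj u (k.obj q)) (u := u)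
      (g := bang (CostructuredArrow g q)) (k := 𝟭 _ ⋙ pt (k.obj q))
      (Functor.whiskerLeft r (commaL u (k.obj q)) ≫
        Functor.whiskerRight β (pt (k.obj q)))).app X) := by
      rw [e2]
      infer_instance
    have h6 := IsIso.comp_isIso (f := (D.mateL (f := r ⋙ CostructuredArrow.proj u (k.obj q)) (u := u)
      (g := bang (CostructuredArrow g q)) (k := 𝟭 _ ⋙ pt (k.obj q))
      (Functor.whiskerLeft r (commaL u (k.obj q)) ≫
        Functor.whiskerRight β (pt (k.obj q)))).app X) (h := (D.map₂ θ).app ((D.lan u).obj X))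
    exact Eq.mp (congrArg (fun t => IsIso t) e5) h6
  rw [e1] at h1
  exact (isIso_comp_right_iff _ _).1 ((isIso_comp_left_iff _ _).1 ((isIso_comp_left_iff _ _).1 h1))

/-- The functor `f × 1` on a product. -/
abbrev prodFst {J K : Type w} [SmallCategory J] [SmallCategory K] (f : J ⥤ K) (A : Type w)
    [SmallCategory A] : J × A ⥤ K × A := f.prod (𝟭 A)

/-- The functor `1 × v` on a product. -/
abbrev prodSnd (J : Type w) [SmallCategory J] {A B : Type w} [SmallCategory A]
    [SmallCategory B] (v : A ⥤ B) : J × A ⥤ J × B := (𝟭 J).prod v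

variable {A B : Type w} [SmallCategory A] [SmallCategory B]

theorem pt_map_aux (k : Pt.{w} ⥤ K) {c : K} {p q : Pt.{w}} (ψ : c ⟶ k.obj p) (x : p ⟶ q)
    (y : q ⟶ p) : (ψ ≫ k.map x) ≫ k.map y = ψ := by
  rw [Category.assoc, ← k.map_comp, Subsingleton.elim (x ≫ y) (𝟙 p), k.map_id, Category.comp_id]

theorem cmp_fst (k : Pt.{w} ⥤ K) (v : A ⥤ B) (q : Pt.{w} × B) :
    (cmp (f := prodFst k A) (u := prodSnd K v) (g := prodSnd Pt v) (k := prodFst k B)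
      (𝟙 (k.prod v)) q).IsRightAdjoint := by
  let r := cmp (f := prodFst k A) (u := prodSnd K v) (g := prodSnd Pt v) (k := prodFst k B)
      (𝟙 (k.prod v)) q
  let F (Y : CostructuredArrow (prodSnd K v) ((prodFst k B).obj q)) : CostructuredArrow (prodSnd Pt v) q :=
    CostructuredArrow.mk (Y := ((q.1, Y.left.2) : Pt.{w} × A)) (S := prodSnd Pt v) (T := q)
      (Prod.mkHom (𝟙 q.1) Y.hom.2)
  have hr (X : CostructuredArrow (prodSnd Pt v) q) : (r.obj X).hom = Prod.mkHom (k.map X.hom.1) X.hom.2 :=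
    Category.id_comp _
  let e1 (Y : CostructuredArrow (prodSnd K v) ((prodFst k B).obj q)) (X : CostructuredArrow (prodSnd Pt v) q)
      (φ : F Y ⟶ X) : Y ⟶ r.obj X :=
    CostructuredArrow.homMk (Prod.mkHom (Y.hom.1 ≫ k.map φ.left.1) φ.left.2) (by
      have h := CostructuredArrow.w φ
      rw [hr]
      refine Prod.ext ?_ ?_
      · exact pt_map_aux k Y.hom.1 _ _
      · have h4 := congrArg Prod.snd h
        exact h4)
  let e2 (Y : CostructuredArrow (prodSnd K v) ((prodFst k B).obj q)) (X : CostructuredArrow (prodSnd Pt v) q)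
      (ψ : Y ⟶ r.obj X) : F Y ⟶ X :=
    CostructuredArrow.homMk (Prod.mkHom (Discrete.eqToHom (Subsingleton.elim _ _)) ψ.left.2) (by
      have h := CostructuredArrow.w ψ
      rw [hr] at h
      refine Prod.ext (Subsingleton.elim _ _) ?_
      have h4 := congrArg Prod.snd h
      exact h4)
  refine (Adjunction.adjunctionOfEquivLeft (F_obj := F) (G := r)
    (fun Y X =>
      { toFun := e1 Y X
        invFun := e2 Y X
        left_inv := fun φ => ?_
        right_inv := fun ψ => ?_ }) ?_).isRightAdjoint
  · apply CostructuredArrow.hom_ext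
    exact Prod.ext (Subsingleton.elim _ _) rfl
  · apply CostructuredArrow.hom_ext
    refine Prod.ext ?_ rfl
    have h := CostructuredArrow.w ψ
    rw [hr] at h
    have h4 : ψ.left.1 ≫ k.map X.hom.1 = Y.hom.1 := congrArg Prod.fst h
    have h5 : Y.hom.1 ≫ k.map (Discrete.eqToHom (Subsingleton.elim _ _) : q.1 ⟶ X.left.1) =
        ψ.left.1 := by
      rw [← h4]
      exact pt_map_aux k ψ.left.1 _ _
    exact h5
  · intro Y X X₂ ψ φ
    apply CostructuredArrow.hom_ext
    refine Prod.ext ?_ rfl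
    have h5 : Y.hom.1 ≫ k.map (φ.left.1 ≫ ψ.left.1) =
        (Y.hom.1 ≫ k.map φ.left.1) ≫ k.map ψ.left.1 := by
      rw [Category.assoc, ← k.map_comp]
    exact h5

theorem cmp_snd (f : J ⥤ K) (b : Pt.{w} ⥤ B) (q : K × Pt.{w}) :
    (cmp (f := prodSnd J b) (u := prodFst f B) (g := prodFst f Pt) (k := prodSnd K b)
      (𝟙 (f.prod b)) q).IsRightAdjoint := by
  let r := cmp (f := prodSnd J b) (u := prodFst f B) (g := prodFst f Pt) (k := prodSnd K b)
      (𝟙 (f.prod b)) q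
  let F (Y : CostructuredArrow (prodFst f B) ((prodSnd K b).obj q)) : CostructuredArrow (prodFst f Pt) q :=
    CostructuredArrow.mk (Y := ((Y.left.1, q.2) : J × Pt.{w})) (S := prodFst f Pt) (T := q)
      (Prod.mkHom Y.hom.1 (𝟙 q.2))
  have hr (X : CostructuredArrow (prodFst f Pt) q) :
      (r.obj X).hom = Prod.mkHom X.hom.1 (b.map X.hom.2) :=
    Category.id_comp _
  let e1 (Y : CostructuredArrow (prodFst f B) ((prodSnd K b).obj q)) (X : CostructuredArrow (prodFst f Pt) q)
      (φ : F Y ⟶ X) : Y ⟶ r.obj X :=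
    CostructuredArrow.homMk (Prod.mkHom φ.left.1 (Y.hom.2 ≫ b.map φ.left.2)) (by
      have h := CostructuredArrow.w φ
      rw [hr]
      refine Prod.ext ?_ ?_
      · have h4 := congrArg Prod.fst h
        exact h4
      · exact pt_map_aux b Y.hom.2 _ _)
  let e2 (Y : CostructuredArrow (prodFst f B) ((prodSnd K b).obj q)) (X : CostructuredArrow (prodFst f Pt) q)
      (ψ : Y ⟶ r.obj X) : F Y ⟶ X :=
    CostructuredArrow.homMk (Prod.mkHom ψ.left.1 (Discrete.eqToHom (Subsingleton.elim _ _))) (by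
      have h := CostructuredArrow.w ψ
      rw [hr] at h
      refine Prod.ext ?_ (Subsingleton.elim _ _)
      have h4 := congrArg Prod.fst h
      exact h4)
  refine (Adjunction.adjunctionOfEquivLeft (F_obj := F) (G := r)
    (fun Y X =>
      { toFun := e1 Y X
        invFun := e2 Y X
        left_inv := fun φ => ?_
        right_inv := fun ψ => ?_ }) ?_).isRightAdjoint
  · apply CostructuredArrow.hom_ext
    exact Prod.ext rfl (Subsingleton.elim _ _)
  · apply CostructuredArrow.hom_ext
    refine Prod.ext rfl ?_
    have h := CostructuredArrow.w ψ
    rw [hr] at h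
    have h4 : ψ.left.2 ≫ b.map X.hom.2 = Y.hom.2 := congrArg Prod.snd h
    have h5 : Y.hom.2 ≫ b.map (Discrete.eqToHom (Subsingleton.elim _ _) : q.2 ⟶ X.left.2) =
        ψ.left.2 := by
      rw [← h4]
      exact pt_map_aux b ψ.left.2 _ _
    exact h5
  · intro Y X X₂ ψ φ
    apply CostructuredArrow.hom_ext
    refine Prod.ext rfl ?_
    have h5 : Y.hom.2 ≫ b.map (φ.left.2 ≫ ψ.left.2) =
        (Y.hom.2 ≫ b.map φ.left.2) ≫ b.map ψ.left.2 := by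
      rw [Category.assoc, ← b.map_comp]
    exact h5

theorem isIso_mateL_fst (f : J ⥤ K) (v : A ⥤ B) :
    IsIso (D.mateL (f := prodFst f A) (u := prodSnd K v) (g := prodSnd J v) (k := prodFst f B)
      (𝟙 (f.prod v))) := by
  rw [NatTrans.isIso_iff_isIso_app]
  intro X
  apply IsDerivator.der2
  rintro ⟨j, b⟩
  have h1 := (NatTrans.isIso_iff_isIso_app _).1 (D.isIso_mateL _ (cmp_fst (pt j ⋙ f) v)) X
  have h2 : IsIso (D.mateL (f := prodFst (pt j) A) (u := prodSnd J v) (g := prodSnd Pt v)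
      (k := prodFst (pt j) B) (𝟙 ((pt j).prod v))) := D.isIso_mateL _ (cmp_fst (pt j) v)
  have e := D.mateL_paste (f := prodFst f A) (u := prodSnd K v) (g := prodSnd J v) (k := prodFst f B)
    (𝟙 (f.prod v)) (p := prodFst (pt j) A) (h := prodSnd Pt v) (q := prodFst (pt j) B)
    (𝟙 ((pt j).prod v)) X
  have e2 : Functor.whiskerLeft (prodFst (pt j) A) (𝟙 (f.prod v)) ≫
      Functor.whiskerRight (𝟙 ((pt j).prod v)) (prodFst f B) = 𝟙 ((pt j ⋙ f).prod v) := by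
    ext x
    · exact (Category.id_comp _).trans (f.map_id j)
    · exact (Category.id_comp _)
  have h3e :=
    ((congrArg (fun t => (D.mateL (f := prodFst (pt j) A ⋙ prodFst f A) (u := prodSnd K v) (g := prodSnd Pt v)
      (k := prodFst (pt j) B ⋙ prodFst f B) t).app X) e2).symm.trans e)
  rw [h3e] at h1
  have h4 := (isIso_comp_right_iff _ _).1
    ((isIso_comp_left_iff _ _).1 ((isIso_comp_left_iff _ _).1 h1))
  exact D.isIso_map_comp (f := pt ((⟨PUnit.unit⟩, b) : Pt.{w} × B)) (g := prodFst (pt j) B) _ h4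

theorem isIso_mateL_snd (f : J ⥤ K) (v : A ⥤ B) :
    IsIso (D.mateL (f := prodSnd J v) (u := prodFst f B) (g := prodFst f A) (k := prodSnd K v)
      (𝟙 (f.prod v))) := by
  rw [NatTrans.isIso_iff_isIso_app]
  intro X
  apply IsDerivator.der2
  rintro ⟨k, a⟩
  have h1 := (NatTrans.isIso_iff_isIso_app _).1 (D.isIso_mateL _ (cmp_snd f (pt a ⋙ v))) X
  have h2 : IsIso (D.mateL (f := prodSnd J (pt a)) (u := prodFst f A) (g := prodFst f Pt)
      (k := prodSnd K (pt a)) (𝟙 (f.prod (pt a)))) := D.isIso_mateL _ (cmp_snd f (pt a))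
  have e := D.mateL_paste (f := prodSnd J v) (u := prodFst f B) (g := prodFst f A) (k := prodSnd K v)
    (𝟙 (f.prod v)) (p := prodSnd J (pt a)) (h := prodFst f Pt) (q := prodSnd K (pt a))
    (𝟙 (f.prod (pt a))) X
  have e2 : Functor.whiskerLeft (prodSnd J (pt a)) (𝟙 (f.prod v)) ≫
      Functor.whiskerRight (𝟙 (f.prod (pt a))) (prodSnd K v) = 𝟙 (f.prod (pt a ⋙ v)) := by
    ext x
    · exact (Category.id_comp _)
    · exact (Category.id_comp _).trans (v.map_id a)
  have h3e :=
    ((congrArg (fun t => (D.mateL (f := prodSnd J (pt a) ⋙ prodSnd J v) (u := prodFst f B)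
      (g := prodFst f Pt) (k := prodSnd K (pt a) ⋙ prodSnd K v) t).app X) e2).symm.trans e)
  rw [h3e] at h1
  have h4 := (isIso_comp_right_iff _ _).1
    ((isIso_comp_left_iff _ _).1 ((isIso_comp_left_iff _ _).1 h1))
  exact D.isIso_map_comp (f := pt ((k, ⟨PUnit.unit⟩) : K × Pt.{w})) (g := prodSnd K (pt a)) _ h4

theorem isIso_mateR_fst (f : J ⥤ K) (v : A ⥤ B) :
    IsIso (D.mateR (f := prodFst f A) (u := prodSnd K v) (g := prodSnd J v) (k := prodFst f B)
      (𝟙 (f.prod v))) :=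
  D.isIso_mateR _ (D.isIso_mateL_snd f v)

end Exact

/-- A (pseudonatural) morphism of prederivators. -/
structure Morphism (D : Prederivator.{w, v₁, u₁}) (E : Prederivator.{w, v₂, u₂}) where
  app : ∀ (K : Type w) [SmallCategory K], D.obj K ⥤ E.obj K
  γ : ∀ {J K : Type w} [SmallCategory J] [SmallCategory K] (u : J ⥤ K),
    app K ⋙ E.map u ≅ D.map u ⋙ app J
  γ_id : ∀ (K : Type w) [SmallCategory K] (X : D.obj K),
    (γ (𝟭 K)).hom.app X = (E.mi K).hom.app ((app K).obj X) ≫ (app K).map ((D.mi K).inv.app X)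
  γ_comp : ∀ {I J K : Type w} [SmallCategory I] [SmallCategory J] [SmallCategory K]
    (u : I ⥤ J) (v : J ⥤ K) (X : D.obj K),
    (γ (u ⋙ v)).hom.app X = (E.mc u v).hom.app ((app K).obj X) ≫
      (E.map u).map ((γ v).hom.app X) ≫ (γ u).hom.app ((D.map v).obj X) ≫
        (app I).map ((D.mc u v).inv.app X)
  γ_map₂ : ∀ {J K : Type w} [SmallCategory J] [SmallCategory K] {u u' : J ⥤ K} (α : u ⟶ u')
    (X : D.obj K),
    (E.map₂ α).app ((app K).obj X) ≫ (γ u').hom.app X =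
      (γ u).hom.app X ≫ (app J).map ((D.map₂ α).app X)

section Morphism

variable {C : Prederivator.{w, v₃, u₃}} {D : Prederivator.{w, v₁, u₁}}
  {E : Prederivator.{w, v₂, u₂}}

/-- A morphism of prederivators that commutes strictly with restriction. -/
def Morphism.strict (app : ∀ (K : Type w) [SmallCategory K], D.obj K ⥤ E.obj K)
    (h : ∀ {J K : Type w} [SmallCategory J] [SmallCategory K] (u : J ⥤ K),
      app K ⋙ E.map u = D.map u ⋙ app J)
    (h₂ : ∀ {J K : Type w} [SmallCategory J] [SmallCategory K] {u u' : J ⥤ K} (α : u ⟶ u')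
      (X : D.obj K), (E.map₂ α).app ((app K).obj X) ≫ (eqToHom (h u')).app X =
        (eqToHom (h u)).app X ≫ (app J).map ((D.map₂ α).app X)) : Morphism D E where
  app := app
  γ u := eqToIso (h u)
  γ_id K _ X := by simp [mi, eqToHom_app, eqToHom_map]
  γ_comp u v X := by simp [mc, eqToHom_app, eqToHom_map]
  γ_map₂ := h₂

/-- The identity morphism. -/
def Morphism.id (D : Prederivator.{w, v₁, u₁}) : Morphism D D where
  app K _ := 𝟭 (D.obj K)
  γ u := Functor.leftUnitor _ ≪≫ (Functor.rightUnitor _).symm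
  γ_id K _ X := by simp
  γ_comp u v X := by simp
  γ_map₂ α X := by simp

/-- Composition of morphisms, in diagrammatic order. -/
def Morphism.comp (Φ : Morphism C D) (Ψ : Morphism D E) : Morphism C E where
  app K _ := Φ.app K ⋙ Ψ.app K
  γ {J K} _ _ u := Functor.associator _ _ _ ≪≫ Functor.isoWhiskerLeft (Φ.app K) (Ψ.γ u) ≪≫
    (Functor.associator _ _ _).symm ≪≫ Functor.isoWhiskerRight (Φ.γ u) (Ψ.app J) ≪≫
    Functor.associator _ _ _
  γ_id K _ X := by
    simp [Φ.γ_id, Ψ.γ_id, ← Functor.map_comp_assoc]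
  γ_comp u v X := by
    have n := (Ψ.γ u).hom.naturality ((Φ.γ v).hom.app X)
    simp only [Functor.comp_map, Functor.comp_obj] at n
    simp only [Iso.trans_hom, NatTrans.comp_app, Functor.associator_hom_app, Functor.isoWhiskerLeft_hom,
      Functor.whiskerLeft_app, Iso.symm_hom, Functor.associator_inv_app, Functor.isoWhiskerRight_hom,
      Functor.whiskerRight_app, Category.id_comp, Category.comp_id, Functor.comp_obj,
      Φ.γ_comp, Ψ.γ_comp, Functor.map_comp, Category.assoc, Functor.comp_map]
    rw [reassoc_of% n, ← Functor.map_comp_assoc (Ψ.app _), Iso.inv_hom_id_app]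
    simp
  γ_map₂ α X := by
    have n := Ψ.γ_map₂ α ((Φ.app _).obj X)
    simp [← Functor.map_comp, ← Φ.γ_map₂, reassoc_of% n]

/-- An equivalence of prederivators: a morphism whose components are equivalences. -/
def Morphism.IsEquivalence (Φ : Morphism D E) : Prop :=
  ∀ (K : Type w) [SmallCategory K], (Φ.app K).IsEquivalence

/-- A modification between morphisms of prederivators. -/
structure Modification (Φ Ψ : Morphism D E) where
  app : ∀ (K : Type w) [SmallCategory K], Φ.app K ⟶ Ψ.app K
  comm : ∀ {J K : Type w} [SmallCategory J] [SmallCategory K] (u : J ⥤ K) (X : D.obj K),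
    (Φ.γ u).hom.app X ≫ (app J).app ((D.map u).obj X) =
      (E.map u).map ((app K).app X) ≫ (Ψ.γ u).hom.app X

/-- An isomodification: all its components are isomorphisms. -/
def Modification.IsIso {Φ Ψ : Morphism D E} (η : Modification Φ Ψ) : Prop :=
  ∀ (K : Type w) [SmallCategory K], CategoryTheory.IsIso (η.app K)

/-- An adjunction `Φ ⊣ Ψ` of morphisms of prederivators. -/
structure Adj (Φ : Morphism D E) (Ψ : Morphism E D) where
  unit : Modification (Morphism.id D) (Φ.comp Ψ)
  counit : Modification (Ψ.comp Φ) (Morphism.id E)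
  left_triangle : ∀ (K : Type w) [SmallCategory K] (X : D.obj K),
    (Φ.app K).map ((unit.app K).app X) ≫ (counit.app K).app ((Φ.app K).obj X) =
      𝟙 ((Φ.app K).obj X)
  right_triangle : ∀ (K : Type w) [SmallCategory K] (Y : E.obj K),
    (unit.app K).app ((Ψ.app K).obj Y) ≫ (Ψ.app K).map ((counit.app K).app Y) =
      𝟙 ((Ψ.app K).obj Y)

end Morphism

section Shift

variable {A B : Type w} [SmallCategory A] [SmallCategory B]

/-- The shifted prederivator `K ↦ D (K × A)`. -/
def shift (D : Prederivator.{w, v, u}) (A : Type w) [SmallCategory A] : Prederivator.{w, v, u} where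
  obj K _ := D.obj (K × A)
  map u := D.map (prodFst u A)
  map₂ α := D.map₂ (NatTrans.prod α (𝟙 (𝟭 A)))
  map_id K _ := D.map_id (K × A)
  map_comp f g := D.map_comp (prodFst f A) (prodFst g A)
  map₂_id f := D.map₂_id (prodFst f A)
  map₂_comp α β := by
    rw [← D.map₂_comp]
    congr 1
    ext x <;> simp
  map₂_whiskerLeft := by
    intro I J K _ _ _ f g h α
    exact D.map₂_whiskerLeft (prodFst f A) (NatTrans.prod α (𝟙 (𝟭 A)))
  map₂_whiskerRight := by
    intro I J K _ _ _ f g α h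
    exact D.map₂_whiskerRight (NatTrans.prod α (𝟙 (𝟭 A))) (prodFst h A)

theorem strict_aux (D : Prederivator.{w, v, u}) {I J K L : Type w} [SmallCategory I]
    [SmallCategory J] [SmallCategory K] [SmallCategory L] {f f' : I ⥤ J} {t : J ⥤ L} {s : I ⥤ K}
    {g g' : K ⥤ L} (α : f ⟶ f') (β : g ⟶ g') (h : f ⋙ t = s ⋙ g) (h' : f' ⋙ t = s ⋙ g')
    (e : Functor.whiskerRight α t ≫ eqToHom h' = eqToHom h ≫ Functor.whiskerLeft s β)
    (k : D.map t ⋙ D.map f = D.map g ⋙ D.map s) (k' : D.map t ⋙ D.map f' = D.map g' ⋙ D.map s)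
    (X : D.obj L) :
    (D.map₂ α).app ((D.map t).obj X) ≫ (eqToHom k').app X =
      (eqToHom k).app X ≫ (D.map s).map ((D.map₂ β).app X) := by
  have e2 := congrArg D.map₂ e
  have hm : ∀ {p q : I ⥤ L} (h : p = q), D.map₂ (eqToHom h) = eqToHom (congrArg D.map h) := by
    intro p q h; subst h; exact D.map₂_id _
  rw [D.map₂_comp, D.map₂_comp, D.map₂_whiskerLeft, D.map₂_whiskerRight, hm, hm] at e2
  have e3 := congrArg (fun t => t.app X) e2
  simp only [NatTrans.comp_app, Functor.whiskerRight_app, Functor.whiskerLeft_app, eqToHom_app,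
    Category.assoc, eqToHom_trans, eqToHom_trans_assoc] at e3
  rw [← cancel_epi (eqToHom (congrArg (fun F => F.obj X) (D.map_comp f t)))]
  rw [← cancel_mono (eqToHom (congrArg (fun F => F.obj X) (D.map_comp s g').symm))]
  simpa [eqToHom_app] using e3

variable (D : Prederivator.{w, v, u})

/-- Restriction `(1 × v)^*` between shifted prederivators. -/
def restr (v : A ⥤ B) : Morphism (D.shift B) (D.shift A) :=
  Morphism.strict (fun K _ => D.map (prodSnd K v))
    (fun {J K} _ _ u => (D.map_comp (prodFst u A) (prodSnd K v)).symm.trans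
      (D.map_comp (prodSnd J v) (prodFst u B)))
    (fun {J K} _ _ _ _ α X => D.strict_aux (NatTrans.prod α (𝟙 (𝟭 A)))
      (NatTrans.prod α (𝟙 (𝟭 B))) (t := prodSnd K v) (s := prodSnd J v) rfl rfl (by
        rw [eqToHom_refl, eqToHom_refl, Category.comp_id, Category.id_comp]
        ext x
        · rfl
        · exact v.map_id _) _ _ X)

/-- The components `X ↦ X_a`, as a morphism of prederivators. -/
def ev (a : A) : Morphism (D.shift A) D :=
  Morphism.strict (fun K _ => D.map (CategoryTheory.Prod.sectL K a))
    (fun {J K} _ _ u => (D.map_comp u (CategoryTheory.Prod.sectL K a)).symm.trans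
      (D.map_comp (CategoryTheory.Prod.sectL J a) (prodFst u A)))
    (fun {J K} _ _ _ _ α X => D.strict_aux α
      (NatTrans.prod α (𝟙 (𝟭 A))) (t := CategoryTheory.Prod.sectL K a) (s := CategoryTheory.Prod.sectL J a)
      rfl rfl ((Category.comp_id _).trans (Category.id_comp _).symm) _ _ X)

/-- The constant diagrams, as a morphism of prederivators. -/
def const (A : Type w) [SmallCategory A] : Morphism D (D.shift A) :=
  Morphism.strict (fun K _ => D.map (CategoryTheory.Prod.fst K A))
    (fun {J K} _ _ u => (D.map_comp (prodFst u A) (CategoryTheory.Prod.fst K A)).symm.trans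
      (D.map_comp (CategoryTheory.Prod.fst J A) u))
    (fun {J K} _ _ _ _ α X => D.strict_aux (NatTrans.prod α (𝟙 (𝟭 A))) α
      (t := CategoryTheory.Prod.fst K A) (s := CategoryTheory.Prod.fst J A) rfl rfl (by
        rw [eqToHom_refl, eqToHom_refl, Category.comp_id, Category.id_comp]
        rfl) _ _ X)

variable [D.IsDerivator]

/-- The Beck-Chevalley isomorphism for the product of two functors, for left Kan extensions. -/
noncomputable def lanIso {J K : Type w} [SmallCategory J] [SmallCategory K] (u : J ⥤ K)
    (v : A ⥤ B) : D.map (prodFst u A) ⋙ D.lan (prodSnd J v) ≅ D.lan (prodSnd K v) ⋙ D.map (prodFst u B) :=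
  @asIso _ _ _ _ (D.mateL (f := prodFst u A) (u := prodSnd K v) (g := prodSnd J v) (k := prodFst u B)
    (𝟙 (u.prod v))) (D.isIso_mateL_fst u v)

/-- The Beck-Chevalley isomorphism for the product of two functors, for right Kan extensions. -/
noncomputable def ranIso {J K : Type w} [SmallCategory J] [SmallCategory K] (u : J ⥤ K)
    (v : A ⥤ B) : D.ran (prodSnd K v) ⋙ D.map (prodFst u B) ≅ D.map (prodFst u A) ⋙ D.ran (prodSnd J v) :=
  @asIso _ _ _ _ (D.mateR (f := prodFst u A) (u := prodSnd K v) (g := prodSnd J v) (k := prodFst u B)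
    (𝟙 (u.prod v))) (D.isIso_mateR_fst u v)

/-- The left Kan extension `(1 × v)_!`, as a morphism between shifted derivators. -/
noncomputable def lanMor (v : A ⥤ B) : Morphism (D.shift A) (D.shift B) where
  app K _ := D.lan (prodSnd K v)
  γ u := (D.lanIso u v).symm
  γ_id K _ X := by
    have e : (D.lanIso (𝟭 K) v).hom.app X = (D.lan (prodSnd K v)).map ((D.mi (K × A)).hom.app X) ≫
      (D.mi (K × B)).inv.app _ := D.mateL_id (prodSnd K v) X
    have h : (D.lanIso (𝟭 K) v).app X = (D.lan (prodSnd K v)).mapIso ((D.mi (K × A)).app X) ≪≫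
      ((D.mi (K × B)).app _).symm := Iso.ext e
    exact congrArg Iso.inv h
  γ_comp {I J K} _ _ _ f g X := by
    have e : (D.lanIso (f ⋙ g) v).hom.app X =
        (D.lan (prodSnd I v)).map ((D.mc (prodFst f A) (prodFst g A)).hom.app X) ≫
        (D.lanIso f v).hom.app _ ≫ (D.map (prodFst f B)).map ((D.lanIso g v).hom.app X) ≫
        (D.mc (prodFst f B) (prodFst g B)).inv.app _ := by
      have e := D.mateL_paste (f := prodFst g A) (u := prodSnd K v) (g := prodSnd J v) (k := prodFst g B)
        (𝟙 (g.prod v)) (p := prodFst f A) (h := prodSnd I v) (q := prodFst f B)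
        (𝟙 (f.prod v)) X
      refine Eq.trans ?_ e
      refine congrArg (fun t => (D.mateL (f := prodFst f A ⋙ prodFst g A) (u := prodSnd K v)
        (g := prodSnd I v) (k := prodFst f B ⋙ prodFst g B) t).app X) ?_
      ext x
      · exact (Category.id_comp _).symm.trans (congrArg (fun t => 𝟙 _ ≫ t) (g.map_id _).symm)
      · exact (Category.id_comp _).symm
    have h : (D.lanIso (f ⋙ g) v).app X =
        (D.lan (prodSnd I v)).mapIso ((D.mc (prodFst f A) (prodFst g A)).app X) ≪≫
        (D.lanIso f v).app _ ≪≫ (D.map (prodFst f B)).mapIso ((D.lanIso g v).app X) ≪≫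
        ((D.mc (prodFst f B) (prodFst g B)).app _).symm := Iso.ext e
    refine (congrArg Iso.inv h).trans ?_
    simp only [Iso.trans_inv, Category.assoc]
    rfl
  γ_map₂ {J K} _ _ f g α X := by
    have e1 := D.mateL_whisker_k (f := prodFst f A) (u := prodSnd K v) (g := prodSnd J v) (k := prodFst f B)
      (m := prodFst g B) (𝟙 (f.prod v)) (NatTrans.prod α (𝟙 (𝟭 B))) X
    have e2 := D.mateL_whisker_f (f := prodFst g A) (u := prodSnd K v) (g := prodSnd J v) (k := prodFst g B)
      (m := prodFst f A) (𝟙 (g.prod v)) (NatTrans.prod α (𝟙 (𝟭 A))) X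
    have e3 : (D.lanIso f v).hom.app X ≫ (D.map₂ (NatTrans.prod α (𝟙 (𝟭 B)))).app _ =
        (D.lan (prodSnd J v)).map ((D.map₂ (NatTrans.prod α (𝟙 (𝟭 A)))).app X) ≫
          (D.lanIso g v).hom.app X := by
      refine e1.symm.trans (Eq.trans ?_ e2)
      refine congrArg (fun t => (D.mateL (f := prodFst f A) (u := prodSnd K v) (g := prodSnd J v)
        (k := prodFst g B) t).app X) ?_
      ext x
      · exact (Category.id_comp _).trans (Category.comp_id _).symm
      · exact (Category.id_comp _).trans ((v.map_id _).symm.trans (Category.comp_id _).symm)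
    have e4 := (Iso.eq_comp_inv ((D.lanIso g v).app X)).2 (e3.symm)
    have e5 := (Iso.inv_comp_eq ((D.lanIso f v).app X)).2
      (e4.trans (Category.assoc _ _ _))
    exact e5.symm

/-- The right Kan extension `(1 × v)_*`, as a morphism between shifted derivators. -/
noncomputable def ranMor (v : A ⥤ B) : Morphism (D.shift A) (D.shift B) where
  app K _ := D.ran (prodSnd K v)
  γ u := D.ranIso u v
  γ_id K _ X := D.mateR_id (prodSnd K v) X
  γ_comp {I J K} _ _ _ f g X := by
    have e := D.mateR_paste (f := prodFst g A) (u := prodSnd K v) (g := prodSnd J v) (k := prodFst g B)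
      (𝟙 (g.prod v)) (p := prodFst f A) (h := prodSnd I v) (q := prodFst f B)
      (𝟙 (f.prod v)) X
    refine Eq.trans ?_ e
    refine congrArg (fun t => (D.mateR (f := prodFst f A ⋙ prodFst g A) (u := prodSnd K v) (g := prodSnd I v)
      (k := prodFst f B ⋙ prodFst g B) t).app X) ?_
    ext x
    · exact (Category.id_comp _).symm.trans (congrArg (fun t => t ≫ 𝟙 _) (g.map_id _).symm)
    · exact (Category.id_comp _).symm
  γ_map₂ {J K} _ _ f g α X := by
    have e1 := D.mateR_whisker_k (f := prodFst g A) (u := prodSnd K v) (g := prodSnd J v) (k := prodFst g B)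
      (m := prodFst f B) (𝟙 (g.prod v)) (NatTrans.prod α (𝟙 (𝟭 B))) X
    have e2 := D.mateR_whisker_f (f := prodFst f A) (u := prodSnd K v) (g := prodSnd J v) (k := prodFst f B)
      (m := prodFst g A) (𝟙 (f.prod v)) (NatTrans.prod α (𝟙 (𝟭 A))) X
    refine e1.symm.trans (Eq.trans ?_ e2)
    refine congrArg (fun t => (D.mateR (f := prodFst g A) (u := prodSnd K v) (g := prodSnd J v)
      (k := prodFst f B) t).app X) ?_
    ext x
    · exact (Category.comp_id _).trans (Category.id_comp _).symm
    · exact (Category.id_comp _).trans ((Category.id_comp _).trans (v.map_id _)).symm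

end Shift

section FullSub

theorem eqToHom_hom {E : Type u₂} [Category.{v₂} E] {P : ObjectProperty E}
    {X Y : P.FullSubcategory} (e : X = Y) : (eqToHom e).hom =
      eqToHom (congrArg ObjectProperty.FullSubcategory.obj e) := by
  subst e; rfl

theorem functor_ext_ι {C : Type u₁} [Category.{v₁} C] {E : Type u₂} [Category.{v₂} E]
    {P : ObjectProperty E} {F G : C ⥤ P.FullSubcategory} (h : F ⋙ P.ι = G ⋙ P.ι) : F = G := by
  have h1 : ∀ X, F.obj X = G.obj X := fun X =>
    ObjectProperty.FullSubcategory.ext (congrArg (fun T => T.obj X) h)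
  refine CategoryTheory.Functor.ext h1 fun X Y f => ?_
  apply ObjectProperty.hom_ext
  have h2 := Functor.congr_hom h f
  simpa [eqToHom_hom] using h2

/-- A class of objects in a prederivator that is stable under restriction. -/
structure Sub (D : Prederivator.{w, v, u}) where
  prop : ∀ (K : Type w) [SmallCategory K], ObjectProperty (D.obj K)
  map_mem : ∀ {J K : Type w} [SmallCategory J] [SmallCategory K] (u : J ⥤ K) (X : D.obj K),
    prop K X → prop J ((D.map u).obj X)

variable {D : Prederivator.{w, v, u}}

/-- The full sub-prederivator on a class of objects that is stable under restriction. -/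
def Sub.toPre (S : Sub D) : Prederivator.{w, v, u} where
  obj K _ := (S.prop K).FullSubcategory
  map {J K} _ _ u := (S.prop J).lift ((S.prop K).ι ⋙ D.map u) fun X => S.map_mem u X.1 X.2
  map₂ {J K} _ _ {f g} α :=
    { app := fun X => ObjectProperty.homMk ((D.map₂ α).app X.1)
      naturality := fun X Y m => by
        apply ObjectProperty.hom_ext
        exact (D.map₂ α).naturality m.hom }
  map_id K _ := functor_ext_ι (by
    change (S.prop K).ι ⋙ D.map (𝟭 K) = (S.prop K).ι
    rw [D.map_id]; rfl)
  map_comp {I J K} _ _ _ f g := functor_ext_ι (by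
    change (S.prop K).ι ⋙ D.map (f ⋙ g) = (S.prop K).ι ⋙ D.map g ⋙ D.map f
    rw [D.map_comp])
  map₂_id f := by
    ext X
    exact congrArg (fun t => t.app X.1) (D.map₂_id f)
  map₂_comp α β := by
    ext X
    exact congrArg (fun t => t.app X.1) (D.map₂_comp α β)
  map₂_whiskerLeft := by
    intro I J K _ _ _ f g h α
    ext X
    have e := congrArg (fun t => t.app X.1) (D.map₂_whiskerLeft f α)
    simp only [NatTrans.comp_app, eqToHom_app, Functor.whiskerRight_app] at e
    simp only [NatTrans.comp_app, eqToHom_app, Functor.whiskerRight_app,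
      ObjectProperty.FullSubcategory.comp_hom, eqToHom_hom]
    exact e
  map₂_whiskerRight := by
    intro I J K _ _ _ f g α h
    ext X
    have e := congrArg (fun t => t.app X.1) (D.map₂_whiskerRight α h)
    simp only [NatTrans.comp_app, eqToHom_app, Functor.whiskerLeft_app] at e
    simp only [NatTrans.comp_app, eqToHom_app, Functor.whiskerLeft_app,
      ObjectProperty.FullSubcategory.comp_hom, eqToHom_hom]
    exact e

theorem Sub.mc_hom (S : Sub D) {I J K : Type w} [SmallCategory I] [SmallCategory J]
    [SmallCategory K] (f : I ⥤ J) (g : J ⥤ K) (X : S.toPre.obj K) :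
    ((S.toPre.mc f g).hom.app X).hom = (D.mc f g).hom.app X.1 := by
  simp only [mc, eqToIso.hom, eqToHom_app]
  exact eqToHom_hom _

theorem Sub.mi_hom (S : Sub D) {K : Type w} [SmallCategory K] (X : S.toPre.obj K) :
    ((S.toPre.mi K).hom.app X).hom = (D.mi K).hom.app X.1 := by
  simp only [mi, eqToIso.hom, eqToHom_app]
  exact eqToHom_hom _

/-- The inclusion of a full sub-prederivator. -/
def Sub.incl (S : Sub D) : Morphism S.toPre D :=
  Morphism.strict (fun K _ => (S.prop K).ι) (fun _ => rfl)
    (fun _ _ => (Category.comp_id _).trans (Category.id_comp _).symm)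

/-- A morphism that takes values in a full sub-prederivator factors through it. -/
def Sub.lift {C : Prederivator.{w, v₁, u₁}} (S : Sub D) (Φ : Morphism C D)
    (h : ∀ (K : Type w) [SmallCategory K] (X : C.obj K), S.prop K ((Φ.app K).obj X)) :
    Morphism C S.toPre where
  app K _ := (S.prop K).lift (Φ.app K) (h K)
  γ {J K} _ _ u := NatIso.ofComponents
    (fun X => (S.prop J).isoMk ((Φ.γ u).app X))
    (fun {X Y} m => by
      apply ObjectProperty.hom_ext
      exact (Φ.γ u).hom.naturality m)
  γ_id K _ X := by
    apply ObjectProperty.hom_ext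
    exact (Φ.γ_id K X).trans (congrArg (fun t => t ≫ (Φ.app K).map ((C.mi K).inv.app X))
      (S.mi_hom ⟨(Φ.app K).obj X, h K X⟩).symm)
  γ_comp {I J K} _ _ _ u v X := by
    apply ObjectProperty.hom_ext
    exact (Φ.γ_comp u v X).trans (congrArg (fun t => t ≫ (D.map u).map ((Φ.γ v).hom.app X) ≫
      (Φ.γ u).hom.app ((C.map v).obj X) ≫ (Φ.app I).map ((C.mc u v).inv.app X))
      (S.mc_hom u v ⟨(Φ.app K).obj X, h K X⟩).symm)
  γ_map₂ α X := by
    apply ObjectProperty.hom_ext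
    exact Φ.γ_map₂ α X

end FullSub

section Shapes

/-- The functor between posets (moved to the universe `w`) that a monotone map induces. -/
def ofMono {P Q : Type} [PartialOrder P] [PartialOrder Q] (f : P → Q) (hf : Monotone f) :
    ULift.{w} P ⥤ ULift.{w} Q :=
  Monotone.functor (f := fun x => ULift.up (f x.down)) fun _ _ h => hf h

/-- The transformation between functors of posets that an inequality of monotone maps induces. -/
def ofLE {P Q : Type} [PartialOrder P] [PartialOrder Q] {f g : P → Q} (hf : Monotone f)
    (hg : Monotone g) (h : ∀ x, f x ≤ g x) : ofMono.{w} f hf ⟶ ofMono.{w} g hg where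
  app x := homOfLE (h x.down)

/-- The square `□`, with initial object `(0, 0)` and terminal object `(1, 1)`. -/
abbrev Sq : Type := Fin 2 × Fin 2

/-- The square without its terminal object. -/
abbrev SqLL : Type := {p : Sq // p ≠ (1, 1)}

/-- The square without its initial object. -/
abbrev SqUR : Type := {p : Sq // p ≠ (0, 0)}

/-- The poset `V` of those `(i, j)` in `ℤ × ℤ` with `|i - j| ≤ 1`. -/
abbrev PV : Type := {p : ℤ × ℤ // |p.1 - p.2| ≤ 1}

/-- The subposet `∂V` of `V`, consisting of the `(i, j)` with `i ≠ j`. -/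
abbrev PdV : Type := {p : PV // p.1.1 ≠ p.1.2}

/-- The subposet of `V` of those `(i, j)` with `i, j ≤ 0`. -/
abbrev PVle : Type := {p : PV // p.1.1 ≤ 0 ∧ p.1.2 ≤ 0}

/-- The subposet `W` of `V`: everything except the `(i, i)` with `i > 0`. -/
abbrev PW : Type := {p : PV // p.1.1 = p.1.2 → p.1.1 ≤ 0}

/-- The subposet of `V` of those `(i, j)` with `i, j ≥ 0`. -/
abbrev PVge : Type := {p : PV // 0 ≤ p.1.1 ∧ 0 ≤ p.1.2}

/-- The subposet `Z` of those `((i, j), k)` such that `k ≤ i` if `i = j`. -/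
abbrev PZ : Type := {q : PVge × ℕ // q.1.1.1.1 = q.1.1.1.2 → (q.2 : ℤ) ≤ q.1.1.1.1}

/-- The cone on the square: a new initial object `⊥` is added. -/
abbrev Cone : Type := WithBot Sq

/-- The map `□ → A` into the cone that sends `(0, 0)` to the cone point and every other element
to itself. -/
def sSq (p : Sq) : Cone := if p = (0, 0) then ⊥ else (p : WithBot Sq)

theorem sSq_mono : Monotone sSq := by
  intro p q h
  unfold sSq
  split_ifs with h1 h2 h2
  · exact le_rfl
  · exact bot_le
  · exfalso
    subst h2
    exact h1 (le_antisymm h ⟨Fin.zero_le _, Fin.zero_le _⟩)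
  · exact WithBot.coe_le_coe.2 h

/-- The arrow from the cone point to `(0, 0)`. -/
def coneArrow (t : Fin 2) : Cone := if t = 0 then ⊥ else ((0, 0) : Sq)

theorem coneArrow_mono : Monotone coneArrow := by
  intro p q h
  unfold coneArrow
  split_ifs with h1 h2 h2
  · exact le_rfl
  · exact bot_le
  · exfalso
    subst h2
    exact h1 (le_antisymm h (Fin.zero_le _))
  · exact le_rfl

theorem omega_mem (p : PVge × PV) :
    |(p.1.1.1.1 + if Even p.1.1.1.1 then p.2.1.1 else p.2.1.2) -
      (p.1.1.1.2 + if Even p.1.1.1.2 then p.2.1.2 else p.2.1.1)| ≤ 1 := by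
  obtain ⟨⟨⟨⟨a, b⟩, hab⟩, hge⟩, ⟨⟨i, j⟩, hij⟩⟩ := p
  simp only at *
  rw [abs_le] at *
  split_ifs with h1 h2 h2 <;> simp only [Int.even_iff] at h1 h2 <;> omega

/-- The map `ω : V^{≥ 0} × V → V`. On `((a, b), (i, j))` it takes the values
`(i + n, j + n)` at `(n, n)`, `(j + n + 1, j + n)` at `(n + 1, n)` and `(i + n, i + n + 1)` at
`(n, n + 1)`, with `i` and `j` interchanged for odd `n`. -/
def omegaFun (p : PVge × PV) : PV :=
  ⟨(p.1.1.1.1 + if Even p.1.1.1.1 then p.2.1.1 else p.2.1.2,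
    p.1.1.1.2 + if Even p.1.1.1.2 then p.2.1.2 else p.2.1.1), omega_mem p⟩

theorem omegaFun_mono : Monotone omegaFun := by
  rintro ⟨⟨⟨⟨a, b⟩, hab⟩, hge⟩, ⟨⟨i, j⟩, hij⟩⟩ ⟨⟨⟨⟨a', b'⟩, hab'⟩, hge'⟩, ⟨⟨i', j'⟩, hij'⟩⟩ ⟨h, h'⟩
  have h1 : a ≤ a' ∧ b ≤ b' := h
  have h2 : i ≤ i' ∧ j ≤ j' := h'
  simp only at *
  rw [abs_le] at *
  change (_ ≤ _) ∧ (_ ≤ _)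
  simp only [omegaFun]
  constructor
  · split_ifs with h3 h4 h4 <;> simp only [Int.even_iff] at h3 h4 <;> omega
  · split_ifs with h3 h4 h4 <;> simp only [Int.even_iff] at h3 h4 <;> omega

theorem w_mem (p : Sq × PV) :
    |(if p.1.1 = 0 then p.2.1.1 else p.2.1.2 + 1) -
      (if p.1.2 = 0 then p.2.1.2 else p.2.1.1 + 1)| ≤ 1 := by
  obtain ⟨⟨a, b⟩, ⟨⟨i, j⟩, hij⟩⟩ := p
  simp only at *
  rw [abs_le] at *
  split_ifs with h1 h2 h2 <;> omega

/-- The map `w : □ × V → V`: it sends `((a, b), (i, j))` to `(i, j)`, `(j + 1, j)`, `(i, i + 1)`,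
`(j + 1, i + 1)` for `(a, b) = (0, 0)`, `(1, 0)`, `(0, 1)`, `(1, 1)`. -/
def wFun (p : Sq × PV) : PV :=
  ⟨(if p.1.1 = 0 then p.2.1.1 else p.2.1.2 + 1, if p.1.2 = 0 then p.2.1.2 else p.2.1.1 + 1),
    w_mem p⟩

theorem wFun_mono : Monotone wFun := by
  rintro ⟨⟨a, b⟩, ⟨⟨i, j⟩, hij⟩⟩ ⟨⟨a', b'⟩, ⟨⟨i', j'⟩, hij'⟩⟩ ⟨h, h'⟩
  have h1 : a ≤ a' ∧ b ≤ b' := h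
  have h2 : i ≤ i' ∧ j ≤ j' := h'
  simp only at *
  rw [abs_le] at *
  change (_ ≤ _) ∧ (_ ≤ _)
  simp only [wFun]
  constructor
  · split_ifs with h3 h4 h4 <;> omega
  · split_ifs with h3 h4 h4 <;> omega

/-- The origin of `V`. -/
abbrev PV.zero : PV := ⟨(0, 0), by simp⟩

/-- The origin of `V^{≤ 0}`. -/
abbrev PVle.zero : PVle := ⟨PV.zero, le_rfl, le_rfl⟩

/-- The origin of `V^{≥ 0}`. -/
abbrev PVge.zero : PVge := ⟨PV.zero, le_rfl, le_rfl⟩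

/-- The inclusion of the square without its terminal object. -/
def incLL : ULift.{w} SqLL ⥤ ULift.{w} Sq := ofMono Subtype.val fun _ _ h => h

/-- The inclusion of the square without its initial object. -/
def incUR : ULift.{w} SqUR ⥤ ULift.{w} Sq := ofMono Subtype.val fun _ _ h => h

/-- The inclusion of `∂V` into `V`. -/
noncomputable def incdV : ULift.{w} PdV ⥤ ULift.{w} PV := ofMono Subtype.val fun _ _ h => h

/-- The inclusion of `V^{≤ 0}` into `W`. -/
noncomputable def incVle : ULift.{w} PVle ⥤ ULift.{w} PW :=
  ofMono (fun p => ⟨p.1, fun _ => p.2.1⟩) fun _ _ h => h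

/-- The inclusion of `W` into `V`. -/
noncomputable def incW : ULift.{w} PW ⥤ ULift.{w} PV := ofMono Subtype.val fun _ _ h => h

/-- The functor `w : □ × V ⥤ V`. -/
noncomputable def wFunctor : ULift.{w} (Sq × PV) ⥤ ULift.{w} PV := ofMono wFun wFun_mono

/-- The functor `s_□ × 1 : □ × V ⥤ A × V`. -/
noncomputable def sSqV : ULift.{w} (Sq × PV) ⥤ ULift.{w} (Cone × PV) :=
  ofMono (Prod.map sSq id) (sSq_mono.prodMap monotone_id)

/-- The functor `[1] × V ⥤ A × V` that selects the arrow from the cone point to `(0, 0)`. -/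
noncomputable def coneArrowV : ULift.{w} (Fin 2 × PV) ⥤ ULift.{w} (Cone × PV) :=
  ofMono (Prod.map coneArrow id) (coneArrow_mono.prodMap monotone_id)

theorem pair_mono {P Q : Type} [PartialOrder P] [PartialOrder Q] (a : P) :
    Monotone (fun x : Q => (a, x)) := fun _ _ h => ⟨le_rfl, h⟩

/-- The endpoint `V ⥤ [1] × V` that corresponds to `t` in `[1]`. -/
noncomputable def endpt (t : Fin 2) : ULift.{w} PV ⥤ ULift.{w} (Fin 2 × PV) :=
  ofMono (fun x => (t, x)) (pair_mono t)

/-- The transformation from the source to the target of `[1] × V`. -/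
noncomputable def endptHom : endpt.{w} 0 ⟶ endpt.{w} 1 :=
  ofLE (pair_mono 0) (pair_mono 1) fun _ => ⟨Fin.zero_le _, le_rfl⟩

/-- The functor `ω : V^{≥ 0} × V ⥤ V`. -/
noncomputable def omegaFunctor : ULift.{w} (PVge × PV) ⥤ ULift.{w} PV := ofMono omegaFun omegaFun_mono

/-- The functor `ζ × 1 : Z × V ⥤ V^{≥ 0} × V`, where `ζ` forgets the natural number. -/
noncomputable def zetaV : ULift.{w} (PZ × PV) ⥤ ULift.{w} (PVge × PV) :=
  ofMono (fun x => (x.1.1.1, x.2)) fun _ _ h => ⟨h.1.1, h.2⟩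

/-- The functor `f × 1 : Z × V ⥤ (V^{≥ 0} × ℕ) × V`, where `f` is the inclusion. -/
noncomputable def incZV : ULift.{w} (PZ × PV) ⥤ ULift.{w} ((PVge × ℕ) × PV) :=
  ofMono (fun x => (x.1.1, x.2)) fun _ _ h => ⟨h.1, h.2⟩

/-- The functor `ℕ × V ⥤ (V^{≥ 0} × ℕ) × V` that is given by `k ↦ ((0, 0), k)`. -/
noncomputable def columnV : ULift.{w} (ℕ × PV) ⥤ ULift.{w} ((PVge × ℕ) × PV) :=
  ofMono (fun x => ((PVge.zero, x.1), x.2)) fun _ _ h => ⟨⟨le_rfl, h.1⟩, h.2⟩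

/-- The projection `π × 1 : ℕ × V ⥤ V`. -/
noncomputable def projV : ULift.{w} (ℕ × PV) ⥤ ULift.{w} PV := ofMono Prod.snd fun _ _ h => h.2

end Shapes

section Stabilization

variable (D : Prederivator.{w, v, u})

/-- The underlying transformation of an object of `D^{[1] × V}`, in level `K`. -/
noncomputable def underlying (K : Type w) [SmallCategory K] :
    D.map (prodSnd K (endpt.{w} 0)) ⟶ D.map (prodSnd K (endpt.{w} 1)) :=
  D.map₂ (NatTrans.prod (𝟙 (𝟭 K)) endptHom)

theorem isIso_underlying_map {J K : Type w} [SmallCategory J] [SmallCategory K] (f : J ⥤ K)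
    (X : D.obj (K × ULift.{w} (Fin 2 × PV))) (h : IsIso ((D.underlying K).app X)) :
    IsIso ((D.underlying J).app ((D.map (prodFst f _)).obj X)) := by
  have e := D.strict_aux (NatTrans.prod (𝟙 (𝟭 J)) endptHom) (NatTrans.prod (𝟙 (𝟭 K)) endptHom)
    (t := prodFst f (ULift.{w} (Fin 2 × PV))) (s := prodFst f (ULift.{w} PV)) rfl rfl (by
      rw [eqToHom_refl, eqToHom_refl, Category.comp_id, Category.id_comp]
      ext x
      · exact f.map_id _
      · rfl)
    ((D.map_comp _ _).symm.trans (D.map_comp (prodFst f (ULift.{w} PV)) (prodSnd K (endpt.{w} 0))))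
    ((D.map_comp _ _).symm.trans (D.map_comp (prodFst f (ULift.{w} PV)) (prodSnd K (endpt.{w} 1)))) X
  have h2 : IsIso ((D.map (prodFst f (ULift.{w} PV))).map ((D.underlying K).app X)) :=
    Functor.map_isIso _ _
  have h3 := IsIso.comp_isIso' (inferInstance : IsIso ((eqToHom
    ((D.map_comp (prodSnd J (endpt.{w} 0)) (prodFst f (ULift.{w} (Fin 2 × PV)))).symm.trans
      (D.map_comp (prodFst f (ULift.{w} PV)) (prodSnd K (endpt.{w} 0))))).app X)) h2
  have h4 := e ▸ h3
  exact (isIso_comp_right_iff _ _).1 h4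

variable [D.IsDerivator]

/-- The suspension. -/
noncomputable def suspension : Morphism D D :=
  (D.const Pt).comp <| (D.ranMor (pt (ULift.up (⟨(0, 0), by decide⟩ : SqLL)))).comp <|
    (D.lanMor incLL).comp <| (D.restr incUR).comp <|
      D.ev (ULift.up (⟨(1, 1), by decide⟩ : SqUR))

/-- The loop endomorphism. -/
noncomputable def loops : Morphism D D :=
  (D.const Pt).comp <| (D.lanMor (pt (ULift.up (⟨(1, 1), by decide⟩ : SqUR)))).comp <|
    (D.ranMor incUR).comp <| (D.restr incLL).comp <|
      D.ev (ULift.up (⟨(0, 0), by decide⟩ : SqLL))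

/-- A stable derivator: it is pointed, and suspension and loops form an adjoint equivalence. -/
def IsStable : Prop :=
  Limits.HasZeroObject (D.obj Pt) ∧
    ∃ adj : Adj D.suspension D.loops, adj.unit.IsIso ∧ adj.counit.IsIso

theorem isZero_map {J K : Type w} [SmallCategory J] [SmallCategory K] (u : J ⥤ K) {X : D.obj K}
    (h : Limits.IsZero X) : Limits.IsZero ((D.map u).obj X) := by
  have := HasKan.left (D := D) u
  have := HasKan.right (D := D) u
  have h1 := (Limits.IsInitial.isInitialObj (D.map u) X h.isInitial)
  have h2 := (Limits.IsTerminal.isTerminalObj (D.map u) X h.isTerminal)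
  exact ⟨fun Y => ⟨⟨⟨h1.to Y⟩, fun _ => h1.hom_ext _ _⟩⟩,
    fun Y => ⟨⟨⟨h2.from Y⟩, fun _ => h2.hom_ext _ _⟩⟩⟩

/-- The objects of `D^V` that vanish on `∂V`. -/
noncomputable def vanishing : Sub (D.shift (ULift.{w} PV)) where
  prop K _ := fun X => Limits.IsZero ((D.map (prodSnd K incdV)).obj X)
  map_mem {J K} _ _ f X h := by
    have h1 := D.isZero_map (prodFst f (ULift.{w} PdV)) h
    refine h1.of_iso ?_
    exact ((D.mc (prodSnd J incdV) (prodFst f (ULift.{w} PV))).symm.app X) ≪≫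
      (D.mc (prodFst f (ULift.{w} PdV)) (prodSnd K incdV)).app X

/-- The prederivator `Sp D` of prespectrum objects. -/
noncomputable abbrev Sp : Prederivator.{w, v, u} := D.vanishing.toPre

/-- The coherent structure map `φ_X : X ⟶ Ω σ^* X`, as a morphism from `D^V` to `D^{[1] × V}`. -/
noncomputable def structureMap :
    Morphism (D.shift (ULift.{w} PV)) (D.shift (ULift.{w} (Fin 2 × PV))) :=
  (D.restr wFunctor).comp <| (D.ranMor sSqV).comp <| D.restr coneArrowV

/-- The Ω-spectra: the prespectra `X` for which the coherent structure map `φ_X`, regarded as a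
morphism in `D (K × V)`, is an isomorphism. -/
def omegaSpectra : Sub D.Sp where
  prop K _ := fun X => IsIso ((D.underlying K).app ((D.structureMap.app K).obj X.1))
  map_mem {J K} _ _ f X h := by
    have h1 := D.isIso_underlying_map f ((D.structureMap.app K).obj X.1) h
    exact (NatTrans.isIso_app_iff_of_iso (D.underlying J) ((D.structureMap.γ f).app X.1)).1 h1

/-- The prederivator `St D` of Ω-spectra. -/
noncomputable abbrev St : Prederivator.{w, v, u} := D.omegaSpectra.toPre

/-- The connective suspension prespectrum, as a morphism with values in `D^V`. -/
noncomputable def connective : Morphism D (D.shift (ULift.{w} PV)) :=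
  (D.const Pt).comp <| (D.lanMor (pt (ULift.up PVle.zero))).comp <|
    (D.ranMor incVle).comp <| D.lanMor incW

/-- The construction `X ↦ colim (X ⟶ Ω σ^* X ⟶ Ω^2 (σ^*)^2 X ⟶ ⋯)`. -/
noncomputable def loc : Morphism (D.shift (ULift.{w} PV)) (D.shift (ULift.{w} PV)) :=
  (D.restr omegaFunctor).comp <| (D.restr zetaV).comp <| (D.ranMor incZV).comp <|
    (D.restr columnV).comp <| D.lanMor projV

/-- The stabilization morphism `loc L`, given that it takes values in `St D`. -/
noncomputable def stab
    (h₁ : ∀ (K : Type w) [SmallCategory K] (X : D.obj K),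
      D.vanishing.prop K (((D.connective.comp D.loc).app K).obj X))
    (h₂ : ∀ (K : Type w) [SmallCategory K] (X : D.obj K),
      D.omegaSpectra.prop K (((D.vanishing.lift (D.connective.comp D.loc) h₁).app K).obj X)) :
    Morphism D D.St :=
  D.omegaSpectra.lift (D.vanishing.lift (D.connective.comp D.loc) h₁) h₂

/-- The evaluation of a spectrum object in degree zero. -/
noncomputable def evalZero : Morphism D.St D :=
  D.omegaSpectra.incl.comp <| D.vanishing.incl.comp <| D.ev (ULift.up PV.zero)

end Stabilization

end Prederivator

/-! A diagram on V that vanishes off the diagonal is a sequence of objects X_n = X_(n,n) in which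
X_n and X_(n+1) are opposite corners of a square whose other two corners are zero. It is an
Ω-spectrum if and only if all these squares are cartesian (`isIso_structureMap_iff`). In a stable
derivator a square with two such zero corners is cartesian if and only if it is cocartesian
(`IsStable.cart`, `IsStable.cocart`). Hence X_0 determines X_n for n > 0 by suspension and for n < 0
by loops, and a spectrum carries no more information than X_0.

Precisely, evaluation in degree zero is fully faithful on spectra (`IsStable.bijective_at_zero`). A
spectrum X is a left Kan extension from `PW`, the part without the positive diagonal. On `PW` a
spectrum Y is a right Kan extension from the points of V^{≤ 0} that are off the diagonal or equal to
the origin. On that last part X is concentrated at the origin, which is maximal. So maps X ⟶ Y are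
the same as maps X_0 ⟶ Y_0.

To see that loc L X is a spectrum, note that L X has cocartesian squares in degrees n ≥ 0, and by
stability these are cartesian. Only the negative degrees are wrong, and a right Kan extension
corrects them: there is m : L X ⟶ T with T a spectrum and m invertible in nonnegative degrees
(`exists_spectrum`). At a point x, the stages k ≥ -x.1.1 of the sequence that defines loc depend
only on nonnegative degrees, so loc inverts m (`isIso_loc_map`). On a spectrum that sequence is
constant (`IsSpectrum.rExt`), so loc L X ≅ loc T ≅ T. The same comparison with T shows that the
canonical map X ⟶ (L X)_0 ⟶ (loc L X)_0 is invertible.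

This map is an isomodification from the identity to `stab` followed by `evalZero`. As `evalZero` is
fully faithful, formal arguments give the adjunction (`exists_adj`), the equivalence
(`isEquivalence_of_unit`) and the invertibility of unit and counit of any adjunction
(`Adj.isIso_of_isEquivalence`).

All (co)cartesian squares that come from Kan extensions are recognised by `Cart.of_detect` and
`Cocart.of_detect`, which turn the question into inequalities in a poset. -/

namespace Prederivator

/-! ### Exact squares for right Kan extensions -/

section Exactness

variable (D : Prederivator.{w, v, u})
variable {I J K L : Type w} [SmallCategory I] [SmallCategory J] [SmallCategory K] [SmallCategory L]

theorem isIso_sq {f : I ⥤ J} {u : J ⥤ L} {g : I ⥤ K} {k : K ⥤ L} (α : f ⋙ u ⟶ g ⋙ k)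
    [IsIso α] : IsIso (D.sq α) := by
  have := D.isIso_map₂ α
  unfold sq
  infer_instance

/-- The right-handed counterpart of `isIso_final`. -/
theorem isIso_initial [D.HasKan] {P Q : Type w} [SmallCategory P] [SmallCategory Q] {l : P ⥤ Q}
    {r : Q ⥤ P} (adj : l ⊣ r) (β : bang P ⋙ 𝟭 _ ⟶ l ⋙ bang Q) : IsIso (D.mateR β) := by
  -- The right mate is conjugate to the mate of the same 2-cell for the adjunctions induced by `adj`
  -- and by the identity, and that mate can be written out explicitly.
  have e := iterated_mateEquiv_conjugateEquiv_symm (D.mapAdj Adjunction.id) (D.mapAdj adj)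
    (D.ranAdj (bang P)) (D.ranAdj (bang Q)) (TwoSquare.mk _ _ _ _ (D.mateR β))
  have e2 : (mateEquiv (D.ranAdj (bang Q)) (D.ranAdj (bang P))).symm
      (TwoSquare.mk _ _ _ _ (D.mateR β)) = TwoSquare.mk _ _ _ _ (D.sq β) :=
    (mateEquiv (D.ranAdj (bang Q)) (D.ranAdj (bang P))).symm_apply_apply _
  rw [e2] at e
  have e3 : IsIso ((mateEquiv (D.mapAdj Adjunction.id) (D.mapAdj adj)).symm
    (TwoSquare.mk _ _ _ _ (D.sq β))).natTrans := by
    rw [NatTrans.isIso_iff_isIso_app]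
    intro Y
    have := isIso_of_bang β
    have := D.isIso_sq β
    -- On diagrams pulled back from the point the counit comes from a transformation between
    -- functors to the point, and every such transformation is invertible.
    have h2 : ∀ Z, IsIso ((D.mapAdj adj).counit.app ((D.map (bang Q)).obj Z)) := by
      intro Z
      have e := D.map₂_whiskerRight_app adj.counit (bang Q) Z
      have := isIso_of_bang (Functor.whiskerRight adj.counit (bang Q))
      have : IsIso (D.map₂ (Functor.whiskerRight adj.counit (bang Q))) := D.isIso_map₂ _
      have : IsIso ((D.map₂ adj.counit).app ((D.map (bang Q)).obj Z)) := by
        have h := IsIso.comp_isIso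
          (f := (D.map₂ (Functor.whiskerRight adj.counit (bang Q))).app Z)
          (h := (D.mc (𝟭 Q) (bang Q)).hom.app Z)
        rw [e] at h
        exact IsIso.of_isIso_comp_left ((D.mc (r ⋙ l) (bang Q)).hom.app Z) _
      have e2 : (D.mapAdj adj).counit.app ((D.map (bang Q)).obj Z) = (D.mc r l).inv.app _ ≫
        (D.map₂ adj.counit).app _ ≫ (D.mi Q).hom.app _ := rfl
      rw [e2]
      infer_instance
    have h3 : IsIso ((D.mapAdj (Adjunction.id (C := Pt.{w}))).unit.app Y) := by
      have : IsIso (D.map₂ (Adjunction.id (C := Pt.{w})).unit) := D.isIso_map₂ _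
      have e2 : (D.mapAdj (Adjunction.id (C := Pt.{w}))).unit.app Y = (D.mi _).inv.app _ ≫
        (D.map₂ (Adjunction.id (C := Pt.{w})).unit).app _ ≫ (D.mc _ _).hom.app _ := rfl
      rw [e2]
      infer_instance
    have e4 : ((mateEquiv (D.mapAdj Adjunction.id) (D.mapAdj adj)).symm
        (TwoSquare.mk _ _ _ _ (D.sq β))).natTrans.app Y =
        (D.map r).map ((D.map (bang P)).map
          ((D.mapAdj (Adjunction.id (C := Pt.{w}))).unit.app Y) ≫ (D.sq β).app _) ≫
        (D.mapAdj adj).counit.app _ := by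
      simp [mateEquiv]
    rw [e4]
    have := h2 ((D.map (𝟭 _)).obj Y)
    exact IsIso.comp_isIso
  rw [e] at e3
  exact @conjugateEquiv_symm_of_iso _ _ _ _ _ _ _ _
    ((D.mapAdj Adjunction.id).comp (D.ranAdj (bang Q)))
    ((D.ranAdj (bang P)).comp (D.mapAdj adj)) (D.mateR β) e3

/-- The functor between coslice categories that is induced by a square. -/
def cmpR {f : I ⥤ J} {u : J ⥤ L} {g : I ⥤ K} {k : K ⥤ L} (α : g ⋙ k ⟶ f ⋙ u) (q : K) :
    StructuredArrow q g ⥤ StructuredArrow (k.obj q) u where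
  obj X := StructuredArrow.mk (Y := f.obj X.right) (k.map X.hom ≫ α.app X.right)
  map {X Y} φ := StructuredArrow.homMk (f.map φ.right) (by
    have := α.naturality φ.right
    simp only [Functor.comp_map] at this
    have h2 := StructuredArrow.w φ
    simp only [StructuredArrow.mk_hom_eq_self]
    rw [Category.assoc, ← this, ← k.map_comp_assoc, h2])

variable [D.IsDerivator]

/-- By Der2 invertibility is tested at each q. There Der4 and pasting with the comma squares turn
the mate into a comparison of limits over two coslices, and restriction along the left adjoint `cmpR
α q` does not change limits (`isIso_initial`). -/
theorem isIso_mateR_of_cmpR {f : I ⥤ J} {u : J ⥤ L} {g : I ⥤ K} {k : K ⥤ L}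
    (α : g ⋙ k ⟶ f ⋙ u) (h : ∀ q, (cmpR α q).IsLeftAdjoint) : IsIso (D.mateR α) := by
  rw [NatTrans.isIso_iff_isIso_app]
  intro X
  apply IsDerivator.der2
  intro q
  have hq := h q
  let r := cmpR α q
  let β : bang (StructuredArrow q g) ⋙ 𝟭 _ ⟶ r ⋙ bang (StructuredArrow (k.obj q) u) := 𝟙 _
  -- Both functors classify `k.obj q`, but they are written differently, so the two pastings are
  -- compared along θ.
  let θ : pt q ⋙ k ⟶ 𝟭 _ ⋙ pt (k.obj q) :=
    { app := fun _ => 𝟙 (k.obj q)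
      naturality := fun _ _ _ => by simp }
  have hθ : IsIso θ := by
    have : ∀ x, IsIso (θ.app x) := fun x => inferInstanceAs (IsIso (𝟙 (k.obj q)))
    exact NatIso.isIso_of_isIso_app _
  have e1 := D.mateR_paste α (commaR g q) X
  have e2 := D.mateR_paste (commaR u (k.obj q)) β X
  have e3 := D.mateR_whisker_k (f := r ⋙ StructuredArrow.proj (k.obj q) u) (u := u)
    (g := bang (StructuredArrow q g))
    (Functor.whiskerRight β (pt (k.obj q)) ≫ Functor.whiskerLeft r (commaR u (k.obj q))) θ X
  have e4 : Functor.whiskerLeft (bang (StructuredArrow q g)) θ ≫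
      (Functor.whiskerRight β (pt (k.obj q)) ≫ Functor.whiskerLeft r (commaR u (k.obj q))) =
      Functor.whiskerRight (commaR g q) k ≫ Functor.whiskerLeft (StructuredArrow.proj q g) α := by
    ext x
    exact (Category.id_comp _).trans (Category.id_comp _)
  have i1 : IsIso (D.mateR (commaR g q)) := IsDerivator.der4R g q
  have i2 : IsIso (D.mateR (commaR u (k.obj q))) := IsDerivator.der4R u (k.obj q)
  have i3 : IsIso (D.mateR β) := D.isIso_initial (Adjunction.ofIsLeftAdjoint r) β
  have i4 : IsIso (D.map₂ θ) := D.isIso_map₂ θ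
  have h1 : IsIso ((D.mateR (f := StructuredArrow.proj q g ⋙ f) (u := u)
      (g := bang (StructuredArrow q g)) (k := pt q ⋙ k)
      (Functor.whiskerRight (commaR g q) k ≫
        Functor.whiskerLeft (StructuredArrow.proj q g) α)).app X) := by
    have e5 := e3.symm.trans (congrArg (fun t => (D.mateR (f := StructuredArrow.proj q g ⋙ f)
      (u := u) (g := bang (StructuredArrow q g)) (k := pt q ⋙ k) t).app X) e4)
    have : IsIso ((D.mateR (f := r ⋙ StructuredArrow.proj (k.obj q) u) (u := u)
      (g := bang (StructuredArrow q g)) (k := 𝟭 _ ⋙ pt (k.obj q))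
      (Functor.whiskerRight β (pt (k.obj q)) ≫
        Functor.whiskerLeft r (commaR u (k.obj q)))).app X) := by
      rw [e2]
      infer_instance
    have h6 := IsIso.comp_isIso (h := (D.mateR (f := r ⋙ StructuredArrow.proj (k.obj q) u)
      (u := u) (g := bang (StructuredArrow q g)) (k := 𝟭 _ ⋙ pt (k.obj q))
      (Functor.whiskerRight β (pt (k.obj q)) ≫
        Functor.whiskerLeft r (commaR u (k.obj q)))).app X) (f := (D.map₂ θ).app ((D.ran u).obj X))
    exact Eq.mp (congrArg (fun t => IsIso t) e5) h6
  rw [e1] at h1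
  exact (isIso_comp_right_iff _ _).1 ((isIso_comp_left_iff _ _).1 h1)

end Exactness

/-! ### Objects that are Kan extensions of their restriction -/

section Extensions

variable (D : Prederivator.{w, v, u}) [D.IsDerivator]
variable {I J K L : Type w} [SmallCategory I] [SmallCategory J] [SmallCategory K] [SmallCategory L]

/-- The object `X` is the left Kan extension along `f` of its restriction. -/
def LExt (f : J ⥤ L) (X : D.obj L) : Prop := IsIso ((D.lanAdj f).counit.app X)

/-- The object `X` is the right Kan extension along `f` of its restriction. -/
def RExt (f : J ⥤ L) (X : D.obj L) : Prop := IsIso ((D.ranAdj f).unit.app X)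

variable {D}

theorem LExt.of_iso {f : J ⥤ L} {X Y : D.obj L} (e : X ≅ Y) (h : D.LExt f X) : D.LExt f Y :=
  (NatTrans.isIso_app_iff_of_iso (D.lanAdj f).counit e).1 h

theorem RExt.of_iso {f : J ⥤ L} {X Y : D.obj L} (e : X ≅ Y) (h : D.RExt f X) : D.RExt f Y :=
  (NatTrans.isIso_app_iff_of_iso (D.ranAdj f).unit e).1 h

/-- In the naturality square of the counit at m, the counit at X and the image of m under f_! f^*
are invertible, so the other two sides are invertible together. This trades the extension property
for invertibility of a map. -/
theorem LExt.iff_isIso {f : J ⥤ L} {X Y : D.obj L} (m : X ⟶ Y) (hm : IsIso ((D.map f).map m))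
    (h : D.LExt f X) : D.LExt f Y ↔ IsIso m := by
  have n := (D.lanAdj f).counit.naturality m
  have h' : IsIso ((D.lanAdj f).counit.app X) := h
  simp only [Functor.comp_map, Functor.id_map] at n
  constructor
  · intro h2
    have h2' : IsIso ((D.lanAdj f).counit.app Y) := h2
    have h3 : IsIso ((D.lanAdj f).counit.app X ≫ m) := by rw [← n]; infer_instance
    exact (isIso_comp_left_iff _ _).1 h3
  · intro h2
    have h3 : IsIso ((D.lan f).map ((D.map f).map m) ≫ (D.lanAdj f).counit.app Y) := by
      rw [n]; infer_instance
    exact (isIso_comp_left_iff _ _).1 h3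

theorem RExt.iff_isIso {f : J ⥤ L} {X Y : D.obj L} (m : X ⟶ Y) (hm : IsIso ((D.map f).map m))
    (h : D.RExt f Y) : D.RExt f X ↔ IsIso m := by
  have n := (D.ranAdj f).unit.naturality m
  have h' : IsIso ((D.ranAdj f).unit.app Y) := h
  simp only [Functor.comp_map, Functor.id_map] at n
  constructor
  · intro h2
    have h2' : IsIso ((D.ranAdj f).unit.app X) := h2
    have h3 : IsIso (m ≫ (D.ranAdj f).unit.app Y) := by rw [n]; infer_instance
    exact (isIso_comp_right_iff _ _).1 h3
  · intro h2
    have h3 : IsIso ((D.ranAdj f).unit.app X ≫ (D.ran f).map ((D.map f).map m)) := by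
      rw [← n]; infer_instance
    exact (isIso_comp_right_iff _ _).1 h3

/-- The adjunction identifies maps f^* X ⟶ f^* Y with maps f_! f^* X ⟶ Y, and the source of the
latter is X by hypothesis. -/
theorem LExt.bijective_map {f : J ⥤ L} {X : D.obj L} (h : D.LExt f X) (Y : D.obj L) :
    Function.Bijective (fun m : X ⟶ Y => (D.map f).map m) := by
  have h' : IsIso ((D.lanAdj f).counit.app X) := h
  have e : (fun m : X ⟶ Y => (D.map f).map m) =
      (((D.lanAdj f).homEquiv _ Y) : _ → _) ∘ fun m => (D.lanAdj f).counit.app X ≫ m := by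
    ext m
    rw [Function.comp_apply, Adjunction.homEquiv_unit]
    simp
  rw [e]
  refine ((D.lanAdj f).homEquiv _ Y).bijective.comp ⟨fun a b hab => ?_, fun b => ?_⟩
  · exact (cancel_epi _).1 hab
  · exact ⟨inv ((D.lanAdj f).counit.app X) ≫ b, by simp⟩

theorem RExt.bijective_map {f : J ⥤ L} {Y : D.obj L} (h : D.RExt f Y) (X : D.obj L) :
    Function.Bijective (fun m : X ⟶ Y => (D.map f).map m) := by
  have h' : IsIso ((D.ranAdj f).unit.app Y) := h
  have e : (fun m : X ⟶ Y => (D.map f).map m) =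
      (((D.ranAdj f).homEquiv X _).symm : _ → _) ∘ fun m => m ≫ (D.ranAdj f).unit.app Y := by
    ext m
    rw [Function.comp_apply, Adjunction.homEquiv_counit]
    simp
  rw [e]
  refine ((D.ranAdj f).homEquiv X _).symm.bijective.comp ⟨fun a b hab => ?_, fun b => ?_⟩
  · exact (cancel_mono _).1 hab
  · exact ⟨b ≫ inv ((D.ranAdj f).unit.app Y), by simp⟩

/-- Base change along an exact square, for left Kan extensions. -/
theorem LExt.map_iff {f : I ⥤ J} {u : J ⥤ L} {g : I ⥤ K} {k : K ⥤ L} (α : f ⋙ u ⟶ g ⋙ k)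
    [IsIso α] (hα : IsIso (D.mateL α)) (X : D.obj L) :
    IsIso ((D.map k).map ((D.lanAdj u).counit.app X)) ↔ D.LExt g ((D.map k).obj X) := by
  have := D.isIso_sq α
  -- The mate is compatible with the counits. As the mate and the 2-cell are invertible, only the
  -- two counits remain.
  have e : (D.mateL α).app ((D.map u).obj X) ≫ (D.map k).map ((D.lanAdj u).counit.app X) =
      (D.lan g).map ((D.sq α).app X) ≫ (D.lanAdj g).counit.app ((D.map k).obj X) := by
    apply ((D.lanAdj g).homEquiv _ _).injective
    rw [Adjunction.homEquiv_unit, Adjunction.homEquiv_unit, Functor.map_comp,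
      reassoc_of% (D.unit_mateL α ((D.map u).obj X)), Functor.map_comp]
    have n := (D.sq α).naturality ((D.lanAdj u).counit.app X)
    have n2 := (D.lanAdj g).unit.naturality ((D.sq α).app X)
    simp only [Functor.comp_map, Functor.id_map, Functor.comp_obj, Functor.id_obj] at n n2 ⊢
    rw [← n, ← Functor.map_comp_assoc, Adjunction.right_triangle_components, ← reassoc_of% n2,
      Adjunction.right_triangle_components]
    simp
  unfold LExt
  rw [← isIso_comp_left_iff ((D.mateL α).app ((D.map u).obj X)), e, isIso_comp_left_iff]

/-- Base change along an exact square, for right Kan extensions. -/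
theorem RExt.map_iff {f : I ⥤ J} {u : J ⥤ L} {g : I ⥤ K} {k : K ⥤ L} (α : g ⋙ k ⟶ f ⋙ u)
    [IsIso α] (hα : IsIso (D.mateR α)) (X : D.obj L) :
    IsIso ((D.map k).map ((D.ranAdj u).unit.app X)) ↔ D.RExt g ((D.map k).obj X) := by
  have := D.isIso_sq α
  have e : (D.map k).map ((D.ranAdj u).unit.app X) ≫ (D.mateR α).app ((D.map u).obj X) =
      (D.ranAdj g).unit.app ((D.map k).obj X) ≫ (D.ran g).map ((D.sq α).app X) := by
    apply ((D.ranAdj g).homEquiv _ _).symm.injective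
    rw [Adjunction.homEquiv_counit, Adjunction.homEquiv_counit, Functor.map_comp, Category.assoc,
      D.mateR_counit α ((D.map u).obj X), Functor.map_comp, Category.assoc]
    have n := (D.sq α).naturality ((D.ranAdj u).unit.app X)
    have n2 := (D.ranAdj g).counit.naturality ((D.sq α).app X)
    simp only [Functor.comp_map, Functor.id_map, Functor.comp_obj, Functor.id_obj] at n n2 ⊢
    rw [reassoc_of% n, ← Functor.map_comp, Adjunction.left_triangle_components, n2,
      Adjunction.left_triangle_components_assoc]
    simp
  unfold RExt
  rw [← isIso_comp_right_iff _ ((D.mateR α).app ((D.map u).obj X)), e, isIso_comp_right_iff]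

end Extensions

/-! ### Kan extensions along fully faithful functors -/

section FullyFaithful

variable {J K L : Type w} [SmallCategory J] [SmallCategory K] [SmallCategory L]

theorem isEquivalence_cmp_of_fullyFaithful (f : J ⥤ L) [f.Full] [f.Faithful] (q : J) :
    (cmp (f := 𝟭 J) (u := f) (g := 𝟭 J) (k := f) (𝟙 f) q).IsEquivalence where
  faithful := ⟨fun {X Y} a b h => by
    apply CostructuredArrow.hom_ext
    exact congrArg (fun t => t.left) h⟩
  full := ⟨fun {X Y} a => by
    refine ⟨CostructuredArrow.homMk a.left ?_, ?_⟩
    · apply f.map_injective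
      have h := CostructuredArrow.w a
      simpa [cmp] using h
    · apply CostructuredArrow.hom_ext
      rfl⟩
  essSurj := ⟨fun Y => by
    refine ⟨CostructuredArrow.mk (Y := Y.left) (S := 𝟭 J) (T := q) (f.preimage Y.hom), ⟨?_⟩⟩
    refine CostructuredArrow.isoMk (Iso.refl _) ?_
    simp [cmp]⟩

theorem isEquivalence_cmpR_of_fullyFaithful (f : J ⥤ L) [f.Full] [f.Faithful] (q : J) :
    (cmpR (f := 𝟭 J) (u := f) (g := 𝟭 J) (k := f) (𝟙 f) q).IsEquivalence where
  faithful := ⟨fun {X Y} a b h => by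
    apply StructuredArrow.hom_ext
    exact congrArg (fun t => t.right) h⟩
  full := ⟨fun {X Y} a => by
    refine ⟨StructuredArrow.homMk a.right ?_, ?_⟩
    · apply f.map_injective
      have h := StructuredArrow.w a
      simpa [cmpR] using h
    · apply StructuredArrow.hom_ext
      rfl⟩
  essSurj := ⟨fun Y => by
    refine ⟨StructuredArrow.mk (Y := Y.right) (S := q) (T := 𝟭 J) (f.preimage Y.hom), ⟨?_⟩⟩
    refine StructuredArrow.isoMk (Iso.refl _) ?_
    simp [cmpR]⟩

variable (D : Prederivator.{w, v, u})

theorem isEquivalence_map_id (K : Type w) [SmallCategory K] : (D.map (𝟭 K)).IsEquivalence := by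
  rw [D.map_id]; infer_instance

variable [D.IsDerivator]

/-- The square with sides 𝟭, 𝟭, f, f is exact, because full faithfulness makes the slices over q and
over f q equivalent. It compares the unit for f with the unit for 𝟭, which is invertible since 𝟭^*
is an equivalence. -/
theorem isIso_lanAdj_unit (f : J ⥤ L) [f.Full] [f.Faithful] : IsIso (D.lanAdj f).unit := by
  rw [NatTrans.isIso_iff_isIso_app]
  intro X
  have := D.isEquivalence_map_id J
  have : IsIso (D.sq (f := 𝟭 J) (u := f) (g := 𝟭 J) (k := f) (𝟙 f)) :=
    @isIso_sq D _ _ _ _ _ _ _ _ (𝟭 J) f (𝟭 J) f (𝟙 f) (inferInstanceAs (IsIso (𝟙 f)))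
  have := D.isIso_mateL (f := 𝟭 J) (u := f) (g := 𝟭 J) (k := f) (𝟙 f) fun q => by
    have := isEquivalence_cmp_of_fullyFaithful f q
    infer_instance
  have e := D.unit_mateL (f := 𝟭 J) (u := f) (g := 𝟭 J) (k := f) (𝟙 f) X
  have h1 : IsIso ((D.lanAdj (𝟭 J)).unit.app ((D.map (𝟭 J)).obj X)) := by
    have := (D.lanAdj (𝟭 J)).isEquivalence_left_of_isEquivalence_right
    infer_instance
  have h2 : IsIso ((D.map (𝟭 J)).map ((D.lanAdj f).unit.app X) ≫
      (D.sq (f := 𝟭 J) (u := f) (g := 𝟭 J) (k := f) (𝟙 f)).app ((D.lan f).obj X)) := by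
    rw [← e]; exact IsIso.comp_isIso
  have h3 := (isIso_comp_right_iff _ _).1 h2
  exact isIso_of_reflects_iso _ (D.map (𝟭 J))

theorem isIso_ranAdj_counit (f : J ⥤ L) [f.Full] [f.Faithful] : IsIso (D.ranAdj f).counit := by
  rw [NatTrans.isIso_iff_isIso_app]
  intro X
  have := D.isEquivalence_map_id J
  have : IsIso (D.sq (f := 𝟭 J) (u := f) (g := 𝟭 J) (k := f) (𝟙 f)) :=
    @isIso_sq D _ _ _ _ _ _ _ _ (𝟭 J) f (𝟭 J) f (𝟙 f) (inferInstanceAs (IsIso (𝟙 f)))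
  have := D.isIso_mateR_of_cmpR (f := 𝟭 J) (u := f) (g := 𝟭 J) (k := f) (𝟙 f) fun q => by
    have := isEquivalence_cmpR_of_fullyFaithful f q
    infer_instance
  have e := D.mateR_counit (f := 𝟭 J) (u := f) (g := 𝟭 J) (k := f) (𝟙 f) X
  have h1 : IsIso ((D.ranAdj (𝟭 J)).counit.app ((D.map (𝟭 J)).obj X)) := by
    have := (D.ranAdj (𝟭 J)).isEquivalence_right_of_isEquivalence_left
    infer_instance
  have h2 : IsIso ((D.sq (f := 𝟭 J) (u := f) (g := 𝟭 J) (k := f) (𝟙 f)).app ((D.ran f).obj X) ≫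
      (D.map (𝟭 J)).map ((D.ranAdj f).counit.app X)) := by
    rw [← e]; exact IsIso.comp_isIso
  have h3 := (isIso_comp_left_iff _ _).1 h2
  exact isIso_of_reflects_iso _ (D.map (𝟭 J))

theorem lExt_lan (f : J ⥤ L) [f.Full] [f.Faithful] (X : D.obj J) :
    D.LExt f ((D.lan f).obj X) := by
  have := D.isIso_lanAdj_unit f
  have e := (D.lanAdj f).left_triangle_components X
  have h : IsIso ((D.lan f).map ((D.lanAdj f).unit.app X) ≫
    (D.lanAdj f).counit.app ((D.lan f).obj X)) := by rw [e]; exact inferInstanceAs (IsIso (𝟙 _))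
  exact (isIso_comp_left_iff _ _).1 h

theorem rExt_ran (f : J ⥤ L) [f.Full] [f.Faithful] (X : D.obj J) :
    D.RExt f ((D.ran f).obj X) := by
  have := D.isIso_ranAdj_counit f
  have e := (D.ranAdj f).right_triangle_components X
  have h : IsIso ((D.ranAdj f).unit.app ((D.ran f).obj X) ≫
    (D.ran f).map ((D.ranAdj f).counit.app X)) := by rw [e]; exact inferInstanceAs (IsIso (𝟙 _))
  exact (isIso_comp_right_iff _ _).1 h

variable {D}

/-- X is isomorphic to g_! f_! of its restriction, and every object g_! Z is a left extension along
the fully faithful g. This lets a diagram be viewed as extended from any larger subposet, as the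
detection lemmas need. -/
theorem LExt.of_comp {f : J ⥤ K} {g : K ⥤ L} [g.Full] [g.Faithful] {X : D.obj L}
    (h : D.LExt (f ⋙ g) X) : D.LExt g X := by
  have h' : IsIso ((D.lanAdj (f ⋙ g)).counit.app X) := h
  let e1 := (Adjunction.leftAdjointUniq (D.lanAdj (f ⋙ g))
    (((D.lanAdj f).comp (D.lanAdj g)).ofNatIsoRight (D.mc f g).symm)).app
      ((D.map (f ⋙ g)).obj X)
  exact (D.lExt_lan g _).of_iso (e1.symm ≪≫ asIso ((D.lanAdj (f ⋙ g)).counit.app X))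

theorem RExt.of_comp {f : J ⥤ K} {g : K ⥤ L} [g.Full] [g.Faithful] {X : D.obj L}
    (h : D.RExt (f ⋙ g) X) : D.RExt g X := by
  have h' : IsIso ((D.ranAdj (f ⋙ g)).unit.app X) := h
  let e1 := (Adjunction.rightAdjointUniq (D.ranAdj (f ⋙ g))
    (((D.ranAdj g).comp (D.ranAdj f)).ofNatIsoLeft (D.mc f g).symm)).app
      ((D.map (f ⋙ g)).obj X)
  exact (D.rExt_ran g _).of_iso (e1.symm ≪≫ (asIso ((D.ranAdj (f ⋙ g)).unit.app X)).symm)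

end FullyFaithful

/-! ### Zero objects and pointwise dependence of Kan extensions -/

section Pointwise

theorem isIso_of_isZero {C : Type u₁} [Category.{v₁} C] {X Y : C} (hX : Limits.IsZero X)
    (hY : Limits.IsZero Y) (m : X ⟶ Y) : IsIso m := by
  rw [hX.eq_of_src m (hX.iso hY).hom]
  infer_instance

variable (D : Prederivator.{w, v, u})
variable {J K : Type w} [SmallCategory J] [SmallCategory K]

theorem isIso_map_pt_iff (f : J ⥤ K) {X Y : D.obj K} (m : X ⟶ Y) (j : J) :
    IsIso ((D.map (pt j)).map ((D.map f).map m)) ↔ IsIso ((D.map (pt (f.obj j))).map m) := by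
  have e : pt j ⋙ f ≅ pt (f.obj j) := NatIso.ofComponents (fun _ => Iso.refl _)
    (fun _ => by simp)
  have h : IsIso (D.map₂ e.hom) := D.isIso_map₂ e.hom
  rw [← NatIso.isIso_map_iff (asIso (D.map₂ e.hom)) m, NatIso.isIso_map_iff (D.mc (pt j) f) m]
  rfl

variable [D.IsDerivator]

theorem hasZeroObject (h : Limits.HasZeroObject (D.obj Pt)) (K : Type w) [SmallCategory K] :
    Limits.HasZeroObject (D.obj K) :=
  ⟨⟨_, D.isZero_map (bang K) (Limits.isZero_zero (D.obj Pt))⟩⟩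

theorem isZero_lan (f : J ⥤ K) {X : D.obj J} (h : Limits.IsZero X)
    [Limits.HasZeroObject (D.obj K)] : Limits.IsZero ((D.lan f).obj X) := by
  have := (D.lanAdj f).leftAdjoint_preservesColimits
  have h1 := Limits.IsInitial.isInitialObj (D.lan f) X h.isInitial
  exact (Limits.isZero_zero _).of_iso (h1.uniqueUpToIso (Limits.isZero_zero (D.obj K)).isInitial)

theorem isZero_ran (f : J ⥤ K) {X : D.obj J} (h : Limits.IsZero X)
    [Limits.HasZeroObject (D.obj K)] : Limits.IsZero ((D.ran f).obj X) := by
  have := (D.ranAdj f).rightAdjoint_preservesLimits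
  have h1 := Limits.IsTerminal.isTerminalObj (D.ran f) X h.isTerminal
  exact (Limits.isZero_zero _).of_iso (h1.uniqueUpToIso (Limits.isZero_zero (D.obj K)).isTerminal)

/-- A right Kan extension at `k` depends only on the values over `k`. -/
theorem isIso_ran_pt (f : J ⥤ K) {X Y : D.obj J} (m : X ⟶ Y) (k : K)
    (h : ∀ j, (k ⟶ f.obj j) → IsIso ((D.map (pt j)).map m)) :
    IsIso ((D.map (pt k)).map ((D.ran f).map m)) := by
  have := IsDerivator.der4R (D := D) f k
  refine (NatIso.isIso_map_iff (asIso (D.mateR (commaR f k))) m).2 ?_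
  have h1 : IsIso ((D.map (StructuredArrow.proj k f)).map m) :=
    IsDerivator.der2 _ _ fun j => (D.isIso_map_pt_iff _ m j).2 (h j.right j.hom)
  exact Functor.map_isIso (D.ran (bang _)) _

/-- A left Kan extension at `k` depends only on the values over `k`. -/
theorem isIso_lan_pt (f : J ⥤ K) {X Y : D.obj J} (m : X ⟶ Y) (k : K)
    (h : ∀ j, (f.obj j ⟶ k) → IsIso ((D.map (pt j)).map m)) :
    IsIso ((D.map (pt k)).map ((D.lan f).map m)) := by
  have := IsDerivator.der4L (D := D) f k
  refine (NatIso.isIso_map_iff (asIso (D.mateL (commaL f k))) m).1 ?_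
  have h1 : IsIso ((D.map (CostructuredArrow.proj f k)).map m) :=
    IsDerivator.der2 _ _ fun j => (D.isIso_map_pt_iff _ m j).2 (h j.left j.hom)
  exact Functor.map_isIso (D.lan (bang _)) _

end Pointwise

/-! ### Exact squares of posets with a parameter category -/

section Posets

variable {I J P Q : Type} [PartialOrder I] [PartialOrder J] [PartialOrder P] [PartialOrder Q]
variable (K : Type w) [SmallCategory K]

theorem downLe {x y : ULift.{w} P} (m : x ⟶ y) : x.down ≤ y.down :=
  (leOfHom m : x ≤ y)

/-- The functor `1 × f` for a monotone map `f`. -/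
abbrev mono (f : P →o Q) : K × ULift.{w} P ⥤ K × ULift.{w} Q := prodSnd K (ofMono f f.monotone)

/-- The inclusion of a subset of a poset. -/
abbrev sub (U : P → Prop) : {p // U p} →o P := ⟨Subtype.val, fun _ _ h => h⟩

variable {K}

theorem mono_full_faithful (f : P ↪o Q) :
    (mono.{w} K f.toOrderHom).Full ∧ (mono.{w} K f.toOrderHom).Faithful := by
  constructor
  · refine ⟨fun {x y} m => ⟨Prod.mkHom m.1 (homOfLE (f.le_iff_le.1 (downLe m.2))), ?_⟩⟩
    exact Prod.ext rfl (Subsingleton.elim _ _)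
  · refine ⟨fun {x y} a b h => ?_⟩
    exact Prod.ext (congrArg (fun t => t.1) h) (Subsingleton.elim _ _)

instance (U : P → Prop) : (mono.{w} K (sub U)).Full :=
  (mono_full_faithful ⟨⟨Subtype.val, Subtype.val_injective⟩, Iff.rfl⟩).1

instance (U : P → Prop) : (mono.{w} K (sub U)).Faithful :=
  (mono_full_faithful ⟨⟨Subtype.val, Subtype.val_injective⟩, Iff.rfl⟩).2

/-- The transformation between monotone maps that fill a square up to an inequality. -/
def cell {f : I →o J} {u : J →o Q} {g : I →o P} {k : P →o Q} (h : ∀ i, u (f i) ≤ k (g i)) :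
    mono.{w} K f ⋙ mono K u ⟶ mono K g ⋙ mono K k where
  app x := Prod.mkHom (𝟙 x.1) (homOfLE (h x.2.down))
  naturality _ _ _ := Prod.ext ((Category.comp_id _).trans (Category.id_comp _).symm)
    (Subsingleton.elim _ _)

theorem isIso_cell {f : I →o J} {u : J →o Q} {g : I →o P} {k : P →o Q}
    (h : ∀ i, u (f i) = k (g i)) : IsIso (cell.{w} (K := K) fun i => (h i).le) := by
  refine ⟨cell fun i => (h i).ge, ?_, ?_⟩
  · ext x
    · exact Category.id_comp _
    · exact Subsingleton.elim _ _
  · ext x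
    · exact Category.id_comp _
    · exact Subsingleton.elim _ _

/-- The factor K is carried along unchanged. On the posets, `hρ` says that the elements i with g i ≤
p and y ≤ f i have a least one, and y ↦ ρ is then left adjoint to the comparison of slices. -/
theorem cmp_cell {f : I →o J} {u : J →o Q} {g : I →o P} {k : P →o Q}
    (h : ∀ i, u (f i) ≤ k (g i))
    (hρ : ∀ p y, u y ≤ k p → ∃ ρ, g ρ ≤ p ∧ y ≤ f ρ ∧ ∀ i, g i ≤ p → y ≤ f i → ρ ≤ i)
    (q : K × ULift.{w} P) : (cmp (cell.{w} (K := K) h) q).IsRightAdjoint := by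
  choose ρ h1 h2 h3 using hρ q.2.down
  have hle (Y : CostructuredArrow (mono.{w} K u) ((mono K k).obj q)) :
    u Y.left.2.down ≤ k q.2.down := downLe Y.hom.2
  let r := cmp (cell.{w} (K := K) h) q
  have hr (X : CostructuredArrow (mono.{w} K g) q) : (r.obj X).hom.1 = X.hom.1 :=
    Category.id_comp _
  let F (Y : CostructuredArrow (mono.{w} K u) ((mono K k).obj q)) :
      CostructuredArrow (mono.{w} K g) q :=
    CostructuredArrow.mk (Y := ((Y.left.1, ULift.up (ρ Y.left.2.down (hle Y))) : K × ULift.{w} I))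
      (S := mono K g) (T := q) (Prod.mkHom Y.hom.1 (homOfLE (h1 _ (hle Y))))
  refine (Adjunction.adjunctionOfEquivLeft (F_obj := F) (G := r)
    (fun Y X =>
      { toFun := fun φ => CostructuredArrow.homMk (Prod.mkHom φ.left.1
          (homOfLE ((h2 _ (hle Y)).trans (f.monotone (downLe φ.left.2))))) (by
            refine Prod.ext ?_ (Subsingleton.elim _ _)
            have h := congrArg (fun t => t.1) (CostructuredArrow.w φ)
            exact (congrArg (fun t => φ.left.1 ≫ t) (hr X)).trans h)
        invFun := fun ψ => CostructuredArrow.homMk (Prod.mkHom ψ.left.1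
          (homOfLE (h3 _ (hle Y) _ (downLe X.hom.2) (downLe ψ.left.2)))) (by
            refine Prod.ext ?_ (Subsingleton.elim _ _)
            have h := congrArg (fun t => t.1) (CostructuredArrow.w ψ)
            exact (congrArg (fun t => ψ.left.1 ≫ t) (hr X)).symm.trans h)
        left_inv := fun φ => ?_
        right_inv := fun ψ => ?_ }) ?_).isRightAdjoint
  · apply CostructuredArrow.hom_ext
    exact Prod.ext rfl (Subsingleton.elim _ _)
  · apply CostructuredArrow.hom_ext
    exact Prod.ext rfl (Subsingleton.elim _ _)
  · intro Y X X₂ ψ φ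
    apply CostructuredArrow.hom_ext
    exact Prod.ext rfl (Subsingleton.elim _ _)

theorem cmpR_cell {f : I →o J} {u : J →o Q} {g : I →o P} {k : P →o Q}
    (h : ∀ i, k (g i) ≤ u (f i))
    (hρ : ∀ p y, k p ≤ u y → ∃ ρ, p ≤ g ρ ∧ f ρ ≤ y ∧ ∀ i, p ≤ g i → f i ≤ y → i ≤ ρ)
    (q : K × ULift.{w} P) : (cmpR (cell.{w} (K := K) h) q).IsLeftAdjoint := by
  choose ρ h1 h2 h3 using hρ q.2.down
  have hle (Y : StructuredArrow ((mono K k).obj q) (mono.{w} K u)) :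
    k q.2.down ≤ u Y.right.2.down := downLe Y.hom.2
  let r := cmpR (cell.{w} (K := K) h) q
  have hr (X : StructuredArrow q (mono.{w} K g)) : (r.obj X).hom.1 = X.hom.1 :=
    Category.comp_id _
  let F (Y : StructuredArrow ((mono K k).obj q) (mono.{w} K u)) :
      StructuredArrow q (mono.{w} K g) :=
    StructuredArrow.mk (Y := ((Y.right.1, ULift.up (ρ Y.right.2.down (hle Y))) : K × ULift.{w} I))
      (S := q) (T := mono K g) (Prod.mkHom Y.hom.1 (homOfLE (h1 _ (hle Y))))
  refine (Adjunction.adjunctionOfEquivRight (G_obj := F) (F := r)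
    (fun X Y =>
      { toFun := fun ψ => StructuredArrow.homMk (Prod.mkHom ψ.right.1
          (homOfLE (h3 _ (hle Y) _ (downLe X.hom.2) (downLe ψ.right.2)))) (by
            refine Prod.ext ?_ (Subsingleton.elim _ _)
            have h := congrArg (fun t => t.1) (StructuredArrow.w ψ)
            exact (congrArg (fun t => t ≫ ψ.right.1) (hr X)).symm.trans h)
        invFun := fun φ => StructuredArrow.homMk (Prod.mkHom φ.right.1
          (homOfLE ((f.monotone (downLe φ.right.2)).trans (h2 _ (hle Y))))) (by
            refine Prod.ext ?_ (Subsingleton.elim _ _)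
            have h := congrArg (fun t => t.1) (StructuredArrow.w φ)
            exact (congrArg (fun t => t ≫ φ.right.1) (hr X)).trans h)
        left_inv := fun φ => ?_
        right_inv := fun ψ => ?_ }) ?_).isLeftAdjoint
  · apply StructuredArrow.hom_ext
    exact Prod.ext rfl (Subsingleton.elim _ _)
  · apply StructuredArrow.hom_ext
    exact Prod.ext rfl (Subsingleton.elim _ _)
  · intro Y X X₂ ψ φ
    apply StructuredArrow.hom_ext
    exact Prod.ext rfl (Subsingleton.elim _ _)

variable (D : Prederivator.{w, v, u})

variable (K) in
/-- Restriction along `1 × f` for a monotone map `f`. -/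
abbrev res (f : P →o Q) : D.obj (K × ULift.{w} Q) ⥤ D.obj (K × ULift.{w} P) := D.map (mono K f)

variable (K) in
/-- Evaluation at an element of a poset. -/
abbrev at_ (p : P) : D.obj (K × ULift.{w} P) ⥤ D.obj K :=
  D.map (CategoryTheory.Prod.sectL K (ULift.up p))

variable (K) in
/-- The equality `(g f)^* = f^* g^*`, as an isomorphism. -/
def resComp (f : I →o J) (g : J →o P) : D.res K (g.comp f) ≅ D.res K g ⋙ D.res K f :=
  D.mc (mono K f) (mono K g)

variable (K) in
/-- The equality `(f^* X)_p = X_{f p}`, as an isomorphism. -/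
def resAt (f : P →o Q) (p : P) : D.at_ K (f p) ≅ D.res K f ⋙ D.at_ K p :=
  D.mc (CategoryTheory.Prod.sectL K (ULift.up p)) (mono K f)

theorem isIso_res_at {f : P →o Q} {X Y : D.obj (K × ULift.{w} Q)} (m : X ⟶ Y) (p : P) :
    IsIso ((D.at_ K p).map ((D.res K f).map m)) ↔ IsIso ((D.at_ K (f p)).map m) :=
  (NatIso.isIso_map_iff (D.resAt K f p) m).symm

theorem isZero_res_at {f : P →o Q} (X : D.obj (K × ULift.{w} Q)) (p : P) :
    Limits.IsZero ((D.at_ K p).obj ((D.res K f).obj X)) ↔ Limits.IsZero ((D.at_ K (f p)).obj X) :=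
  ((D.resAt K f p).app X).isZero_iff.symm

variable [D.IsDerivator]

theorem isIso_iff_at {X Y : D.obj (K × ULift.{w} P)} (m : X ⟶ Y) :
    IsIso m ↔ ∀ p : P, IsIso ((D.at_ K p).map m) := by
  refine ⟨fun _ _ => inferInstance, fun h => IsDerivator.der2 _ _ fun x => ?_⟩
  have := h x.2.down
  exact (D.isIso_map_pt_iff (CategoryTheory.Prod.sectL K (ULift.up x.2.down)) m x.1).1
    inferInstance

theorem isZero_iff_at (hz : Limits.HasZeroObject (D.obj Pt)) (X : D.obj (K × ULift.{w} P)) :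
    Limits.IsZero X ↔ ∀ p : P, Limits.IsZero ((D.at_ K p).obj X) := by
  have := D.hasZeroObject hz (K × ULift.{w} P)
  refine ⟨fun h p => D.isZero_map _ h, fun h => ?_⟩
  have hz := Limits.isZero_zero (D.obj (K × ULift.{w} P))
  have : IsIso (hz.to_ X) := (D.isIso_iff_at _).2 fun k =>
    isIso_of_isZero (D.isZero_map _ hz) (h k) _
  exact hz.of_iso (asIso (hz.to_ X)).symm

theorem isIso_ran_at (f : P →o Q) {X Y : D.obj (K × ULift.{w} P)} (m : X ⟶ Y) (q : Q)
    (h : ∀ p, q ≤ f p → IsIso ((D.at_ K p).map m)) :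
    IsIso ((D.at_ K q).map ((D.ran (mono K f)).map m)) := by
  refine IsDerivator.der2 _ _ fun k => (D.isIso_map_pt_iff _ _ k).2 ?_
  refine D.isIso_ran_pt _ m _ fun j hj => ?_
  have := h j.2.down (downLe hj.2)
  exact (D.isIso_map_pt_iff (CategoryTheory.Prod.sectL K (ULift.up j.2.down)) m j.1).1
    inferInstance

theorem isZero_ran_at (hz : Limits.HasZeroObject (D.obj Pt)) (f : P →o Q)
    (X : D.obj (K × ULift.{w} P)) (q : Q)
    (h : ∀ p, q ≤ f p → Limits.IsZero ((D.at_ K p).obj X)) :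
    Limits.IsZero ((D.at_ K q).obj ((D.ran (mono K f)).obj X)) := by
  have := D.hasZeroObject hz (K × ULift.{w} P)
  have := D.hasZeroObject hz (K × ULift.{w} Q)
  have hz := Limits.isZero_zero (D.obj (K × ULift.{w} P))
  have := D.isIso_ran_at f (hz.to_ X) q fun p hp =>
    isIso_of_isZero (D.isZero_map _ hz) (h p hp) _
  exact (D.isZero_map _ (D.isZero_ran _ hz)).of_iso
    (asIso ((D.at_ K q).map ((D.ran (mono K f)).map (hz.to_ X)))).symm

variable {D}

/-- The condition `hρ` makes the commutative square exact. The object X is arbitrary, so the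
equivalence can be read in both directions: the restriction inherits the extension property, and
fibrewise extension properties can be assembled. -/
theorem lExt_res_iff {f : I →o J} {u : J →o Q} {g : I →o P} {k : P →o Q}
    (h : ∀ i, u (f i) = k (g i))
    (hρ : ∀ p y, u y ≤ k p → ∃ ρ, g ρ ≤ p ∧ y ≤ f ρ ∧ ∀ i, g i ≤ p → y ≤ f i → ρ ≤ i)
    (X : D.obj (K × ULift.{w} Q)) :
    IsIso ((D.res K k).map ((D.lanAdj (mono K u)).counit.app X)) ↔
      D.LExt (mono K g) ((D.res K k).obj X) :=
  have := isIso_cell.{w} (K := K) h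
  LExt.map_iff (cell fun i => (h i).le) (D.isIso_mateL _ (cmp_cell _ hρ)) X

theorem rExt_res_iff {f : I →o J} {u : J →o Q} {g : I →o P} {k : P →o Q}
    (h : ∀ i, k (g i) = u (f i))
    (hρ : ∀ p y, k p ≤ u y → ∃ ρ, p ≤ g ρ ∧ f ρ ≤ y ∧ ∀ i, p ≤ g i → f i ≤ y → i ≤ ρ)
    (X : D.obj (K × ULift.{w} Q)) :
    IsIso ((D.res K k).map ((D.ranAdj (mono K u)).unit.app X)) ↔
      D.RExt (mono K g) ((D.res K k).obj X) :=
  have := isIso_cell.{w} (K := K) h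
  RExt.map_iff (cell fun i => (h i).le) (D.isIso_mateR_of_cmpR _ (cmpR_cell _ hρ)) X

theorem RExt.isIso_at_unit {f : P →o Q} [(mono.{w} K f).Full] [(mono.{w} K f).Faithful]
    (X : D.obj (K × ULift.{w} Q)) (p : P) :
    IsIso ((D.at_ K (f p)).map ((D.ranAdj (mono K f)).unit.app X)) := by
  rw [← isIso_res_at]
  have := D.isIso_ranAdj_counit (mono.{w} K f)
  have e := (D.ranAdj (mono K f)).left_triangle_components X
  have h : IsIso ((D.res K f).map ((D.ranAdj (mono K f)).unit.app X) ≫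
    (D.ranAdj (mono K f)).counit.app ((D.res K f).obj X)) := by
      rw [e]; exact inferInstanceAs (IsIso (𝟙 _))
  have := (isIso_comp_right_iff _ _).1 h
  infer_instance

theorem LExt.isIso_at_counit {f : P →o Q} [(mono.{w} K f).Full] [(mono.{w} K f).Faithful]
    (X : D.obj (K × ULift.{w} Q)) (p : P) :
    IsIso ((D.at_ K (f p)).map ((D.lanAdj (mono K f)).counit.app X)) := by
  rw [← isIso_res_at]
  have := D.isIso_lanAdj_unit (mono.{w} K f)
  have e := (D.lanAdj (mono K f)).right_triangle_components X
  have h : IsIso ((D.lanAdj (mono K f)).unit.app ((D.res K f).obj X) ≫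
    (D.res K f).map ((D.lanAdj (mono K f)).counit.app X)) := by
      rw [e]; exact inferInstanceAs (IsIso (𝟙 _))
  have := (isIso_comp_left_iff _ _).1 h
  infer_instance

end Posets

/-! ### Cartesian and cocartesian squares, and their detection -/

section Squares

variable {J P : Type} [PartialOrder J] [PartialOrder P]
variable {K : Type w} [SmallCategory K]
variable {D : Prederivator.{w, v, u}} [D.IsDerivator]

/-- A square is cartesian. -/
abbrev Cart (X : D.obj (K × ULift.{w} Sq)) : Prop := D.RExt (mono K (sub fun p : Sq => p ≠ (0, 0))) X

/-- A square is cocartesian. -/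
abbrev Cocart (X : D.obj (K × ULift.{w} Sq)) : Prop :=
  D.LExt (mono K (sub fun p : Sq => p ≠ (1, 1))) X

theorem Sq.cases (p : Sq) : p = (0, 0) ∨ p = (1, 0) ∨ p = (0, 1) ∨ p = (1, 1) := by
  revert p; decide

/-- X is also extended from U, by `RExt.of_comp`, and (0, 0) is the only corner that may lie outside
U. For base change along c, the corners other than (0, 0) that lie below a given y in U must have a
greatest element: `hU` ensures that there is such a corner, and `hU1` that (1, 0) and (0, 1) are
never the only ones. -/
theorem Cart.of_detect {f : J →o P} {c : Sq →o P} (U : P → Prop) {X : D.obj (K × ULift.{w} P)}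
    (h : D.RExt (mono K f) X) (hf : ∀ j, U (f j)) (h0 : ∀ p, p ≠ (0, 0) → U (c p))
    (hU : ∀ y, U y → c (0, 0) ≤ y → c (1, 0) ≤ y ∨ c (0, 1) ≤ y)
    (hU1 : ∀ y, U y → c (1, 0) ≤ y → c (0, 1) ≤ y → c (1, 1) ≤ y) :
    Cart ((D.res K c).obj X) := by
  let f' : J →o {p // U p} := ⟨fun j => ⟨f j, hf j⟩, fun _ _ h => f.monotone h⟩
  have h1 : D.RExt (mono K (sub U)) X := RExt.of_comp (f := mono K f') (g := mono K (sub U)) h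
  have h1' : IsIso ((D.ranAdj (mono K (sub U))).unit.app X) := h1
  let c' : {p : Sq // p ≠ (0, 0)} →o {p // U p} :=
    ⟨fun p => ⟨c p.1, h0 p.1 p.2⟩, fun _ _ h => c.monotone h⟩
  refine (rExt_res_iff (f := c') (u := sub U) (g := sub _) (k := c) (fun i => rfl) ?_ X).1
    inferInstance
  rintro p ⟨y, hy⟩ hle
  replace hle : c p ≤ y := hle
  -- The greatest corner below y is (1, 1) if y is above both middle corners; otherwise it is the
  -- one middle corner below y.
  have key : ∃ ρ : {p : Sq // p ≠ (0, 0)}, c ρ.1 ≤ y ∧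
      ∀ i : {p : Sq // p ≠ (0, 0)}, c i.1 ≤ y → i ≤ ρ := by
    by_cases h10 : c (1, 0) ≤ y <;> by_cases h01 : c (0, 1) ≤ y
    · refine ⟨⟨(1, 1), by decide⟩, hU1 y hy h10 h01, fun i _ => ?_⟩
      exact ⟨Fin.le_last _, Fin.le_last _⟩
    · refine ⟨⟨(1, 0), by decide⟩, h10, ?_⟩
      rintro ⟨i, hi⟩ hiy
      rcases Sq.cases i with rfl | rfl | rfl | rfl
      · exact absurd rfl hi
      · exact le_rfl
      · exact absurd hiy h01
      · exact absurd ((c.monotone ⟨Fin.le_last _, Fin.le_last _⟩).trans hiy) h01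
    · refine ⟨⟨(0, 1), by decide⟩, h01, ?_⟩
      rintro ⟨i, hi⟩ hiy
      rcases Sq.cases i with rfl | rfl | rfl | rfl
      · exact absurd rfl hi
      · exact absurd hiy h10
      · exact le_rfl
      · exact absurd ((c.monotone ⟨Fin.le_last _, Fin.le_last _⟩).trans hiy) h10
    · have := hU y hy ((c.monotone ⟨Fin.zero_le _, Fin.zero_le _⟩).trans hle)
      tauto
  obtain ⟨ρ, h2, h3⟩ := key
  refine ⟨ρ, ?_, h2, fun i _ hi => h3 i hi⟩
  by_cases hp : p = (0, 0)
  · subst hp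
    exact ⟨Fin.zero_le _, Fin.zero_le _⟩
  · exact h3 ⟨p, hp⟩ hle

/-- Dual to `Cart.of_detect`: among the corners other than (1, 1) above a given y in U there is a
least one. -/
theorem Cocart.of_detect {f : J →o P} {c : Sq →o P} (U : P → Prop) {X : D.obj (K × ULift.{w} P)}
    (h : D.LExt (mono K f) X) (hf : ∀ j, U (f j)) (h0 : ∀ p, p ≠ (1, 1) → U (c p))
    (hU : ∀ y, U y → y ≤ c (1, 1) → y ≤ c (1, 0) ∨ y ≤ c (0, 1))
    (hU1 : ∀ y, U y → y ≤ c (1, 0) → y ≤ c (0, 1) → y ≤ c (0, 0)) :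
    Cocart ((D.res K c).obj X) := by
  let f' : J →o {p // U p} := ⟨fun j => ⟨f j, hf j⟩, fun _ _ h => f.monotone h⟩
  have h1 : D.LExt (mono K (sub U)) X := LExt.of_comp (f := mono K f') (g := mono K (sub U)) h
  have h1' : IsIso ((D.lanAdj (mono K (sub U))).counit.app X) := h1
  let c' : {p : Sq // p ≠ (1, 1)} →o {p // U p} :=
    ⟨fun p => ⟨c p.1, h0 p.1 p.2⟩, fun _ _ h => c.monotone h⟩
  refine (lExt_res_iff (f := c') (u := sub U) (g := sub _) (k := c) (fun i => rfl) ?_ X).1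
    inferInstance
  rintro p ⟨y, hy⟩ hle
  replace hle : y ≤ c p := hle
  have key : ∃ ρ : {p : Sq // p ≠ (1, 1)}, y ≤ c ρ.1 ∧
      ∀ i : {p : Sq // p ≠ (1, 1)}, y ≤ c i.1 → ρ ≤ i := by
    by_cases h10 : y ≤ c (1, 0) <;> by_cases h01 : y ≤ c (0, 1)
    · refine ⟨⟨(0, 0), by decide⟩, hU1 y hy h10 h01, fun i _ => ?_⟩
      exact ⟨Fin.zero_le _, Fin.zero_le _⟩
    · refine ⟨⟨(1, 0), by decide⟩, h10, ?_⟩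
      rintro ⟨i, hi⟩ hiy
      rcases Sq.cases i with rfl | rfl | rfl | rfl
      · exact absurd (hiy.trans (c.monotone ⟨Fin.zero_le _, Fin.zero_le _⟩)) h01
      · exact le_rfl
      · exact absurd hiy h01
      · exact absurd rfl hi
    · refine ⟨⟨(0, 1), by decide⟩, h01, ?_⟩
      rintro ⟨i, hi⟩ hiy
      rcases Sq.cases i with rfl | rfl | rfl | rfl
      · exact absurd (hiy.trans (c.monotone ⟨Fin.zero_le _, Fin.zero_le _⟩)) h10
      · exact absurd hiy h10
      · exact le_rfl
      · exact absurd rfl hi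
    · have := hU y hy (hle.trans (c.monotone ⟨Fin.le_last _, Fin.le_last _⟩))
      tauto
  obtain ⟨ρ, h2, h3⟩ := key
  refine ⟨ρ, ?_, h2, fun i _ hi => h3 i hi⟩
  by_cases hp : p = (1, 1)
  · subst hp
    exact ⟨Fin.le_last _, Fin.le_last _⟩
  · exact h3 ⟨p, hp⟩ hle

theorem Cart.isIso_iff {X Y : D.obj (K × ULift.{w} Sq)} (m : X ⟶ Y)
    (h : ∀ p, p ≠ (0, 0) → IsIso ((D.at_ K p).map m)) (hY : Cart Y) : Cart X ↔ IsIso m :=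
  hY.iff_isIso m ((D.isIso_iff_at _).2 fun p => (D.isIso_res_at _ _).2 (h p.1 p.2))

theorem Cocart.isIso_iff {X Y : D.obj (K × ULift.{w} Sq)} (m : X ⟶ Y)
    (h : ∀ p, p ≠ (1, 1) → IsIso ((D.at_ K p).map m)) (hX : Cocart X) : Cocart Y ↔ IsIso m :=
  hX.iff_isIso m ((D.isIso_iff_at _).2 fun p => (D.isIso_res_at _ _).2 (h p.1 p.2))

/-- A morphism of diagrams is invertible at the initial corner of a square that is cartesian in
both diagrams if it is invertible at the other corners. -/
theorem Cart.isIso_corner {c : Sq →o P} {X Y : D.obj (K × ULift.{w} P)} (m : X ⟶ Y)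
    (hX : Cart ((D.res K c).obj X)) (hY : Cart ((D.res K c).obj Y))
    (h10 : IsIso ((D.at_ K (c (1, 0))).map m)) (h01 : IsIso ((D.at_ K (c (0, 1))).map m))
    (h11 : IsIso ((D.at_ K (c (1, 1))).map m)) : IsIso ((D.at_ K (c (0, 0))).map m) := by
  rw [← isIso_res_at]
  have : IsIso ((D.res K c).map m) := by
    refine (Cart.isIso_iff _ (fun p hp => (D.isIso_res_at _ _).2 ?_) hY).1 hX
    rcases Sq.cases p with rfl | rfl | rfl | rfl
    · exact absurd rfl hp
    all_goals assumption
  infer_instance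

theorem Cocart.isIso_corner {c : Sq →o P} {X Y : D.obj (K × ULift.{w} P)} (m : X ⟶ Y)
    (hX : Cocart ((D.res K c).obj X)) (hY : Cocart ((D.res K c).obj Y))
    (h10 : IsIso ((D.at_ K (c (1, 0))).map m)) (h01 : IsIso ((D.at_ K (c (0, 1))).map m))
    (h00 : IsIso ((D.at_ K (c (0, 0))).map m)) : IsIso ((D.at_ K (c (1, 1))).map m) := by
  rw [← isIso_res_at]
  have : IsIso ((D.res K c).map m) := by
    refine (Cocart.isIso_iff _ (fun p hp => (D.isIso_res_at _ _).2 ?_) hX).1 hY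
    rcases Sq.cases p with rfl | rfl | rfl | rfl
    · assumption
    · assumption
    · assumption
    · exact absurd rfl hp
  infer_instance

theorem Cart.of_isZero (hz : Limits.HasZeroObject (D.obj Pt)) {X : D.obj (K × ULift.{w} Sq)}
    (h : ∀ p : Sq, Limits.IsZero ((D.at_ K p).obj X)) : Cart X := by
  have hX := (D.isZero_iff_at hz X).2 h
  have := D.hasZeroObject hz (K × ULift.{w} Sq)
  exact isIso_of_isZero hX (D.isZero_ran _ (D.isZero_map _ hX)) _

end Squares

/-! ### The structure map is invertible exactly when the squares are cartesian -/

section StructureMap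

variable {I J P Q : Type} [PartialOrder I] [PartialOrder J] [PartialOrder P] [PartialOrder Q]
variable (K : Type w) [SmallCategory K]

/-- The transformation that an inequality of monotone maps induces. -/
def monoLE {f g : P →o Q} (h : ∀ p, f p ≤ g p) : mono.{w} K f ⟶ mono K g where
  app x := Prod.mkHom (𝟙 x.1) (homOfLE (h x.2.down))
  naturality _ _ _ := Prod.ext ((Category.comp_id _).trans (Category.id_comp _).symm)
    (Subsingleton.elim _ _)

/-- The arrow `p ⟶ q` in a poset, as a transformation between inclusions of fibres. -/
def sectLE {p q : P} (h : p ≤ q) : CategoryTheory.Prod.sectL K (ULift.up.{w} p) ⟶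
    CategoryTheory.Prod.sectL K (ULift.up.{w} q) where
  app x := Prod.mkHom (𝟙 x) (homOfLE h)
  naturality _ _ _ := Prod.ext ((Category.comp_id _).trans (Category.id_comp _).symm)
    (Subsingleton.elim _ _)

variable {K}
variable (D : Prederivator.{w, v, u})

theorem isIso_map_map₂ {A B C : Type w} [SmallCategory A] [SmallCategory B] [SmallCategory C]
    {F G : A ⥤ B} (η : F ⟶ G) (i : C ⥤ A) (X : D.obj B) :
    IsIso ((D.map i).map ((D.map₂ η).app X)) ↔
      IsIso ((D.map₂ (Functor.whiskerLeft i η)).app X) := by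
  rw [← isIso_comp_left_iff ((D.mc i F).hom.app X), ← D.map₂_whiskerLeft_app,
    isIso_comp_right_iff]

theorem isIso_map₂_map {A B C : Type w} [SmallCategory A] [SmallCategory B] [SmallCategory C]
    {F G : A ⥤ B} (η : F ⟶ G) (i : B ⥤ C) (X : D.obj C) :
    IsIso ((D.map₂ η).app ((D.map i).obj X)) ↔
      IsIso ((D.map₂ (Functor.whiskerRight η i)).app X) := by
  rw [← isIso_comp_left_iff ((D.mc F i).hom.app X), ← D.map₂_whiskerRight_app,
    isIso_comp_right_iff]

theorem isIso_monoLE_at {f g : P →o Q} (h : ∀ p, f p ≤ g p) (X : D.obj (K × ULift.{w} Q)) (p : P) :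
    IsIso ((D.at_ K p).map ((D.map₂ (monoLE K h)).app X)) ↔
      IsIso ((D.map₂ (sectLE K (h p))).app X) :=
  D.isIso_map_map₂ _ _ X

theorem isIso_sectLE {p q : P} (h : p ≤ q) (e : p = q) (X : D.obj (K × ULift.{w} P)) :
    IsIso ((D.map₂ (sectLE K h)).app X) := by
  subst e
  have : D.map₂ (sectLE K h) = 𝟙 _ := D.map₂_id _
  rw [this]
  exact inferInstanceAs (IsIso (𝟙 _))

variable [D.IsDerivator]

/-- The square in `V` with initial corner `v` that `w` picks out. -/
def wAt (v : PV) : Sq →o PV := ⟨fun p => wFun (p, v), fun _ _ h => wFun_mono ⟨h, le_rfl⟩⟩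

/-- The map `s × 1`, as a monotone map. -/
abbrev coneS : Sq × PV →o Cone × PV := ⟨Prod.map sSq id, sSq_mono.prodMap monotone_id⟩

/-- The product with `V` of the inclusion of the square into the cone on it. -/
abbrev coneT : Sq × PV →o Cone × PV :=
  ⟨fun x => ((x.1 : WithBot Sq), x.2), fun _ _ h => ⟨WithBot.coe_le_coe.2 h.1, h.2⟩⟩

/-- The product with `V` of the inclusion of the square without its initial object. -/
abbrev urV : SqUR × PV →o Sq × PV := ⟨fun x => (x.1.1, x.2), fun _ _ h => h⟩

theorem sSq_eq {p : Sq} (h : p ≠ (0, 0)) : sSq p = (p : WithBot Sq) := if_neg h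

theorem sSq_le (p : Sq) : sSq p ≤ (p : WithBot Sq) := by
  unfold sSq
  split_ifs
  · exact bot_le
  · exact le_rfl

theorem le_of_sSq_le {p q : Sq} (h : sSq p ≤ sSq q) : p ≤ q := by
  by_cases hp : p = (0, 0)
  · subst hp; exact ⟨Fin.zero_le _, Fin.zero_le _⟩
  · rw [sSq_eq hp] at h
    exact WithBot.coe_le_coe.1 (h.trans (sSq_le q))

theorem coneS_full_faithful : (mono.{w} K coneS).Full ∧ (mono.{w} K coneS).Faithful :=
  mono_full_faithful ⟨⟨coneS, fun a b h => by
    have h1 := Prod.ext_iff.1 h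
    exact Prod.ext (le_antisymm (le_of_sSq_le h1.1.le) (le_of_sSq_le h1.1.ge)) h1.2⟩,
    fun {a b} => ⟨fun h => Prod.le_def.2
      ⟨le_of_sSq_le (Prod.le_def.1 h).1, (Prod.le_def.1 h).2⟩, fun h => coneS.monotone h⟩⟩

/-- The map s and the inclusion of the square into the cone differ only at (0, 0). There the
inequality between them is the arrow from the cone point to (0, 0), which is the arrow that φ
restricts to. -/
theorem isIso_underlying_iff (R : D.obj (K × ULift.{w} (Cone × PV))) :
    IsIso ((D.underlying K).app ((D.map (prodSnd K coneArrowV)).obj R)) ↔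
      IsIso ((D.map₂ (monoLE K (f := coneS) (g := coneT) fun x => ⟨sSq_le x.1, le_rfl⟩)).app R) := by
  rw [isIso_iff_at, isIso_iff_at]
  have key (v : PV) : IsIso ((D.at_ K v).map ((D.underlying K).app
      ((D.map (prodSnd K coneArrowV)).obj R))) ↔
      IsIso ((D.map₂ (sectLE K (p := ((⊥, v) : Cone × PV)) (q := (((0, 0) : Sq), v))
        ⟨bot_le, le_rfl⟩)).app R) := by
    refine (D.isIso_map_map₂ _ _ _).trans ((D.isIso_map₂_map _ _ _).trans ?_)
    exact Iff.rfl
  constructor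
  · intro h x
    refine (D.isIso_monoLE_at _ _ _).2 ?_
    by_cases hx : x.1 = (0, 0)
    · obtain ⟨p, v⟩ := x
      subst hx
      exact (key v).1 (h v)
    · refine D.isIso_sectLE _ ?_ _
      exact Prod.ext (sSq_eq hx) rfl
  · intro h v
    exact (key v).2 ((D.isIso_monoLE_at _ _ _).1 (h ((0, 0), v)))

/-- The poset V is only a parameter: each fibre inclusion gives an exact square, and isomorphisms
are detected on fibres. -/
theorem rExt_urV_iff (X : D.obj (K × ULift.{w} (Sq × PV))) :
    D.RExt (mono K urV) X ↔ ∀ v : PV,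
      Cart ((D.res K (⟨fun p => (p, v), fun _ _ h => ⟨h, le_rfl⟩⟩ : Sq →o Sq × PV)).obj X) := by
  have key (v : PV) := rExt_res_iff (D := D) (K := K)
    (f := (⟨fun p => (p, v), fun _ _ h => ⟨h, le_rfl⟩⟩ : SqUR →o SqUR × PV)) (u := urV)
    (g := sub fun p : Sq => p ≠ (0, 0))
    (k := (⟨fun p => (p, v), fun _ _ h => ⟨h, le_rfl⟩⟩ : Sq →o Sq × PV))
    (fun i => rfl) (by
      rintro p ⟨y, v'⟩ ⟨h1, h2⟩
      exact ⟨y, h1, ⟨le_rfl, h2⟩, fun i _ h => h.1⟩) X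
  simp only [Cart, ← key]
  constructor
  · intro (h : IsIso _) v
    infer_instance
  · intro h
    refine (D.isIso_iff_at _).2 fun x => ?_
    exact (D.isIso_res_at (f := (⟨fun p => (p, x.2), fun _ _ h => ⟨h, le_rfl⟩⟩ : Sq →o Sq × PV))
      _ x.1).1 ((D.isIso_iff_at _).1 (h x.2) x.1)

/-- Let R be the right Kan extension of w^* X along s × 1. Its restriction to the square inside the
cone is always cartesian, and its restriction along s is w^* X. The comparison between the two is
invertible away from (0, 0) and is φ at (0, 0), so φ is invertible if and only if w^* X is cartesian
too. -/
theorem isIso_structureMap_iff (X : D.obj (K × ULift.{w} PV)) :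
    IsIso ((D.underlying K).app ((D.structureMap.app K).obj X)) ↔
      ∀ v : PV, Cart ((D.res K (wAt v)).obj X) := by
  let W : Sq × PV →o PV := ⟨wFun, wFun_mono⟩
  let Q := (D.res K W).obj X
  let R := (D.ran (mono K coneS)).obj Q
  have hs := coneS_full_faithful.{w} (K := K)
  have := hs.1
  have := hs.2
  refine (D.isIso_underlying_iff R).trans ?_
  have hR : D.RExt (mono K coneS) R := D.rExt_ran _ _
  have hR' : IsIso ((D.ranAdj (mono K coneS)).unit.app R) := hR
  -- An element y of the square with p ≤ s y in the cone cannot be (0, 0), since s sends (0, 0) to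
  -- the bottom; hence the pairs over which the limit is taken already lie in the punctured square.
  have hT : D.RExt (mono K urV) ((D.res K coneT).obj R) := by
    refine (rExt_res_iff (f := urV) (u := coneS) (g := urV) (k := coneT) (fun i => ?_) ?_ R).1
      inferInstance
    · exact Prod.ext (sSq_eq i.1.2).symm rfl
    · rintro ⟨p, v⟩ ⟨y, v'⟩ ⟨h1, h2⟩
      have hy : y ≠ (0, 0) := by
        rintro rfl
        exact (not_le_of_gt (WithBot.bot_lt_coe p)) h1
      exact ⟨(⟨y, hy⟩, v'), ⟨WithBot.coe_le_coe.1 (h1.trans (sSq_le y)), h2⟩, le_rfl, fun i _ h => h⟩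
  refine (hT.iff_isIso _ ?_).symm.trans ?_
  · refine (D.isIso_iff_at _).2 fun x => (D.isIso_res_at _ _).2 ((D.isIso_monoLE_at _ _ _).2 ?_)
    refine D.isIso_sectLE _ ?_ _
    exact Prod.ext (sSq_eq x.1.2) rfl
  -- Since s × 1 is fully faithful, restricting R along it gives back w^* X.
  · have := D.isIso_ranAdj_counit (mono.{w} K coneS)
    have e : (D.res K coneS).obj R ≅ Q := asIso ((D.ranAdj (mono.{w} K coneS)).counit.app Q)
    refine (⟨fun h => h.of_iso e, fun h => h.of_iso e.symm⟩ : _ ↔ D.RExt (mono K urV) Q).trans ?_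
    refine (D.rExt_urV_iff Q).trans (forall_congr' fun v => ?_)
    have e2 := (D.resComp K (⟨fun p => (p, v), fun _ _ h => ⟨h, le_rfl⟩⟩ : Sq →o Sq × PV) W).app X
    exact ⟨fun h => h.of_iso e2.symm, fun h => h.of_iso e2⟩

end StructureMap

theorem bijective_map_of_iso {C : Type u₁} [Category.{v₁} C] {E : Type u₂} [Category.{v₂} E]
    {F G : C ⥤ E} (e : F ≅ G) (X Y : C) :
    Function.Bijective (fun m : X ⟶ Y => F.map m) ↔
      Function.Bijective (fun m : X ⟶ Y => G.map m) := by
  have h : (fun m : X ⟶ Y => G.map m) =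
      ((e.app X).homCongr (e.app Y)) ∘ (fun m : X ⟶ Y => F.map m) := by
    ext m; simp
  rw [h, Equiv.comp_bijective]

theorem bijective_map_congr {C : Type u₁} [Category.{v₁} C] {E : Type u₂} [Category.{v₂} E]
    (F : C ⥤ E) {X Y X' Y' : C} (a : X ≅ X') (b : Y ≅ Y')
    (h : Function.Bijective (fun m : X ⟶ Y => F.map m)) :
    Function.Bijective (fun m : X' ⟶ Y' => F.map m) := by
  have e : (fun m : X' ⟶ Y' => F.map m) =
      ((F.mapIso a).homCongr (F.mapIso b)) ∘ (fun m : X ⟶ Y => F.map m) ∘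
        (a.homCongr b).symm := by
    ext m; simp
  rw [e, Equiv.comp_bijective, Equiv.bijective_comp]
  exact h

/-! ### Diagrams concentrated at one point -/

section Points

variable {P : Type} [PartialOrder P]
variable {K : Type w} [SmallCategory K]

variable (K) in
/-- The inclusion of the fibre over a point of a poset. -/
abbrev fib (p : P) : K × Pt.{w} ⥤ K × ULift.{w} P := prodSnd K (pt (ULift.up p))

instance (p : P) : (fib K p).Full where
  map_surjective m := ⟨Prod.mkHom m.1 (Discrete.eqToHom (Subsingleton.elim _ _)),
    Prod.ext rfl (Subsingleton.elim _ _)⟩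

instance (p : P) : (fib K p).Faithful where
  map_injective h := Prod.ext (congrArg (fun t => t.1) h) (Subsingleton.elim _ _)

variable (D : Prederivator.{w, v, u})

variable (K) in
theorem isEquivalence_map_fst : (D.map (CategoryTheory.Prod.fst K Pt.{w})).IsEquivalence := by
  let s : K ⥤ K × Pt.{w} := CategoryTheory.Prod.sectL K ⟨PUnit.unit⟩
  let e : CategoryTheory.Prod.fst K Pt.{w} ⋙ s ≅ 𝟭 _ :=
    NatIso.ofComponents (fun x => Iso.prod (Iso.refl x.1) (Discrete.eqToIso (Subsingleton.elim _ _)))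
      fun _ => Prod.ext ((Category.comp_id _).trans (Category.id_comp _).symm)
        (Subsingleton.elim _ _)
  have h : IsIso (D.map₂ e.hom) := D.isIso_map₂ e.hom
  exact Functor.IsEquivalence.mk' (D.map s)
    ((D.mi K).symm ≪≫ D.mc s (CategoryTheory.Prod.fst K Pt.{w}))
    ((D.mc (CategoryTheory.Prod.fst K Pt.{w}) s).symm ≪≫ asIso (D.map₂ e.hom) ≪≫ D.mi _)

variable (K) in
theorem isEquivalence_map_sectL :
    (D.map (CategoryTheory.Prod.sectL K (⟨PUnit.unit⟩ : Pt.{w}))).IsEquivalence := by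
  have := D.isEquivalence_map_fst K
  have e : D.map (CategoryTheory.Prod.fst K Pt.{w}) ⋙
      D.map (CategoryTheory.Prod.sectL K (⟨PUnit.unit⟩ : Pt.{w})) ≅ 𝟭 _ :=
    (D.mc _ _).symm ≪≫ D.mi K
  have := Functor.isEquivalence_of_iso e.symm
  exact Functor.isEquivalence_of_comp_left (D.map (CategoryTheory.Prod.fst K Pt.{w})) _

/-- Evaluation at a point, in terms of the fibre over it. -/
def fibAt (p : P) : D.at_ K p ≅
    D.map (fib K p) ⋙ D.map (CategoryTheory.Prod.sectL K (⟨PUnit.unit⟩ : Pt.{w})) :=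
  D.mc (CategoryTheory.Prod.sectL K (⟨PUnit.unit⟩ : Pt.{w})) (fib K p)

theorem bijective_at_iff (p : P) (X Y : D.obj (K × ULift.{w} P)) :
    Function.Bijective (fun m : X ⟶ Y => (D.at_ K p).map m) ↔
      Function.Bijective (fun m : X ⟶ Y => (D.map (fib K p)).map m) := by
  have := D.isEquivalence_map_sectL K
  rw [bijective_map_of_iso (D.fibAt p)]
  exact (Functor.FullyFaithful.ofFullyFaithful (D.map (CategoryTheory.Prod.sectL K
    (⟨PUnit.unit⟩ : Pt.{w})))).homEquiv.comp_bijective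
      (fun m : X ⟶ Y => (D.map (fib K p)).map m)

theorem isIso_at_iff_fib (p : P) {X Y : D.obj (K × ULift.{w} P)} (m : X ⟶ Y) :
    IsIso ((D.at_ K p).map m) ↔ IsIso ((D.map (fib K p)).map m) := by
  have := D.isEquivalence_map_sectL K
  rw [NatIso.isIso_map_iff (D.fibAt p) m]
  exact isIso_iff_of_reflects_iso _ (D.map (CategoryTheory.Prod.sectL K (⟨PUnit.unit⟩ : Pt.{w})))

variable [D.IsDerivator]

theorem isIso_ranAdj_unit_fib (p : P) (X : D.obj (K × ULift.{w} P)) :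
    IsIso ((D.at_ K p).map ((D.ranAdj (fib K p)).unit.app X)) := by
  rw [isIso_at_iff_fib]
  have := D.isIso_ranAdj_counit (fib K p)
  have e := (D.ranAdj (fib K p)).left_triangle_components X
  have h : IsIso ((D.map (fib K p)).map ((D.ranAdj (fib K p)).unit.app X) ≫
    (D.ranAdj (fib K p)).counit.app ((D.map (fib K p)).obj X)) := by
      rw [e]; exact inferInstanceAs (IsIso (𝟙 _))
  exact (isIso_comp_right_iff _ _).1 h

theorem isIso_lanAdj_counit_fib (p : P) (X : D.obj (K × ULift.{w} P)) :
    IsIso ((D.at_ K p).map ((D.lanAdj (fib K p)).counit.app X)) := by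
  rw [isIso_at_iff_fib]
  have := D.isIso_lanAdj_unit (fib K p)
  have e := (D.lanAdj (fib K p)).right_triangle_components X
  have h : IsIso ((D.lanAdj (fib K p)).unit.app ((D.map (fib K p)).obj X) ≫
    (D.map (fib K p)).map ((D.lanAdj (fib K p)).counit.app X)) := by
      rw [e]; exact inferInstanceAs (IsIso (𝟙 _))
  exact (isIso_comp_left_iff _ _).1 h

theorem isZero_ran_fib (hz : Limits.HasZeroObject (D.obj Pt)) {p q : P} (h : ¬ q ≤ p)
    (T : D.obj (K × Pt.{w})) : Limits.IsZero ((D.at_ K q).obj ((D.ran (fib K p)).obj T)) := by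
  have := D.hasZeroObject hz (K × Pt.{w})
  have := D.hasZeroObject hz (K × ULift.{w} P)
  have hz := Limits.isZero_zero (D.obj (K × Pt.{w}))
  have : IsIso ((D.at_ K q).map ((D.ran (fib K p)).map (hz.to_ T))) :=
    IsDerivator.der2 _ _ fun k => (D.isIso_map_pt_iff _ _ k).2
      (D.isIso_ran_pt _ _ _ fun j hj => absurd (downLe hj.2) h)
  exact (D.isZero_map _ (D.isZero_ran _ hz)).of_iso
    (asIso ((D.at_ K q).map ((D.ran (fib K p)).map (hz.to_ T)))).symm

theorem isZero_lan_fib (hz : Limits.HasZeroObject (D.obj Pt)) {p q : P} (h : ¬ p ≤ q)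
    (T : D.obj (K × Pt.{w})) : Limits.IsZero ((D.at_ K q).obj ((D.lan (fib K p)).obj T)) := by
  have := D.hasZeroObject hz (K × Pt.{w})
  have := D.hasZeroObject hz (K × ULift.{w} P)
  have hz := Limits.isZero_zero (D.obj (K × Pt.{w}))
  have : IsIso ((D.at_ K q).map ((D.lan (fib K p)).map (hz.to_ T))) :=
    IsDerivator.der2 _ _ fun k => (D.isIso_map_pt_iff _ _ k).2
      (D.isIso_lan_pt _ _ _ fun j hj => absurd (downLe hj.2) h)
  exact (D.isZero_map _ (D.isZero_lan _ hz)).of_iso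
    (asIso ((D.at_ K q).map ((D.lan (fib K p)).map (hz.to_ T)))).symm

variable {D}

/-- The unit is invertible at p because the inclusion of a point is fully faithful. Away from p both
sides vanish: X by hypothesis, the extension because it is an empty limit at every q that is not
below p. -/
theorem RExt.of_isZero_of_minimal (hz : Limits.HasZeroObject (D.obj Pt)) {p : P}
    (hp : ∀ q, q ≤ p → q = p) {X : D.obj (K × ULift.{w} P)}
    (hX : ∀ q, q ≠ p → Limits.IsZero ((D.at_ K q).obj X)) : D.RExt (fib K p) X := by
  refine (D.isIso_iff_at _).2 fun q => ?_
  by_cases hq : q = p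
  · subst hq
    exact D.isIso_ranAdj_unit_fib q X
  · exact isIso_of_isZero (hX q hq) (D.isZero_ran_fib hz (fun h => hq (hp q h)) _) _

theorem LExt.of_isZero_of_maximal (hz : Limits.HasZeroObject (D.obj Pt)) {p : P}
    (hp : ∀ q, p ≤ q → q = p) {X : D.obj (K × ULift.{w} P)}
    (hX : ∀ q, q ≠ p → Limits.IsZero ((D.at_ K q).obj X)) : D.LExt (fib K p) X := by
  refine (D.isIso_iff_at _).2 fun q => ?_
  by_cases hq : q = p
  · subst hq
    exact D.isIso_lanAdj_counit_fib q X
  · exact isIso_of_isZero (D.isZero_lan_fib hz (fun h => hq (hp q h)) _) (hX q hq) _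

theorem bijective_at_of_maximal (hz : Limits.HasZeroObject (D.obj Pt)) {p : P}
    (hp : ∀ q, p ≤ q → q = p) {X : D.obj (K × ULift.{w} P)}
    (hX : ∀ q, q ≠ p → Limits.IsZero ((D.at_ K q).obj X)) (Y : D.obj (K × ULift.{w} P)) :
    Function.Bijective (fun m : X ⟶ Y => (D.at_ K p).map m) :=
  (D.bijective_at_iff p X Y).2 ((LExt.of_isZero_of_maximal hz hp hX).bijective_map Y)

end Points

/-! ### In a stable derivator, cartesian and cocartesian agree for squares with zero corners -/

section Stable

variable {K : Type w} [SmallCategory K]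
variable {D : Prederivator.{w, v, u}} [D.IsDerivator]

variable (K) in
theorem IsStable.isEquivalence (hS : D.IsStable) : (D.suspension.app K).IsEquivalence := by
  obtain ⟨-, adj, h1, h2⟩ := hS
  exact Functor.IsEquivalence.mk' (D.loops.app K)
    (@asIso _ _ (𝟭 _) (D.suspension.app K ⋙ D.loops.app K) (adj.unit.app K) (h1 K))
    (@asIso _ _ (D.loops.app K ⋙ D.suspension.app K) (𝟭 _) (adj.counit.app K) (h2 K))

/-- The cocartesian square with vanishing corners whose initial corner is a given object. -/
noncomputable def suspSq (D : Prederivator.{w, v, u}) [D.IsDerivator] (K : Type w)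
    [SmallCategory K] : D.obj K ⥤ D.obj (K × ULift.{w} Sq) :=
  D.map (CategoryTheory.Prod.fst K Pt.{w}) ⋙
    D.ran (fib K (⟨(0, 0), by decide⟩ : SqLL)) ⋙
      D.lan (mono K (sub fun p : Sq => p ≠ (1, 1)))

/-- The other corners of the square vanish. -/
def ZeroCorners (X : D.obj (K × ULift.{w} Sq)) : Prop :=
  Limits.IsZero ((D.at_ K ((1, 0) : Sq)).obj X) ∧ Limits.IsZero ((D.at_ K ((0, 1) : Sq)).obj X)

theorem cocart_suspSq (X : D.obj K) : Cocart ((D.suspSq K).obj X) := D.lExt_lan _ _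

theorem zeroCorners_suspSq (hz : Limits.HasZeroObject (D.obj Pt)) (X : D.obj K) :
    ZeroCorners ((D.suspSq K).obj X) := by
  have := D.isIso_lanAdj_unit (mono.{w} K (sub fun p : Sq => p ≠ (1, 1)))
  have key (q : SqLL) (hq : ¬ q ≤ ⟨(0, 0), by decide⟩) :
      Limits.IsZero ((D.at_ K q.1).obj ((D.suspSq K).obj X)) :=
    (D.isZero_res_at (f := sub fun p : Sq => p ≠ (1, 1)) _ q).1
      ((D.isZero_ran_fib hz hq _).of_iso ((D.at_ K q).mapIso
        (asIso ((D.lanAdj (mono.{w} K (sub fun p : Sq => p ≠ (1, 1)))).unit.app _)).symm))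
  exact ⟨key ⟨(1, 0), by decide⟩ (by decide), key ⟨(0, 1), by decide⟩ (by decide)⟩

/-- Without its terminal corner, Q is concentrated at the minimal element (0, 0), so it is right
extended from there; and Q is left extended from this part. -/
theorem exists_iso_suspSq (hz : Limits.HasZeroObject (D.obj Pt)) {Q : D.obj (K × ULift.{w} Sq)}
    (hQ : Cocart Q) (h0 : ZeroCorners Q) : ∃ X, Nonempty ((D.suspSq K).obj X ≅ Q) := by
  let T := (D.res K (sub fun p : Sq => p ≠ (1, 1))).obj Q
  have h1 : D.RExt (fib K (⟨(0, 0), by decide⟩ : SqLL)) T := by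
    refine RExt.of_isZero_of_minimal hz ?_ ?_
    · rintro ⟨q, hq⟩ h
      exact Subtype.ext (le_antisymm h ⟨Fin.zero_le _, Fin.zero_le _⟩)
    · rintro ⟨q, hq⟩ h
      refine (D.isZero_res_at _ _).2 ?_
      rcases Sq.cases q with rfl | rfl | rfl | rfl
      · exact absurd rfl h
      · exact h0.1
      · exact h0.2
      · exact absurd rfl hq
  have h1' : IsIso ((D.ranAdj _).unit.app T) := h1
  have hQ' : IsIso ((D.lanAdj _).counit.app Q) := hQ
  have := D.isEquivalence_map_fst K
  let F := D.map (CategoryTheory.Prod.fst K Pt.{w})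
  let U := (D.map (fib K (⟨(0, 0), by decide⟩ : SqLL))).obj T
  refine ⟨F.objPreimage U, ⟨?_⟩⟩
  exact (D.lan _).mapIso ((D.ran _).mapIso (F.objObjPreimageIso U) ≪≫
    (asIso ((D.ranAdj _).unit.app T)).symm) ≪≫ asIso ((D.lanAdj _).counit.app Q)

/-- The suspension is the terminal corner of the suspension square. -/
noncomputable def suspSqAt (D : Prederivator.{w, v, u}) [D.IsDerivator] (K : Type w)
    [SmallCategory K] : D.suspension.app K ≅ D.suspSq K ⋙ D.at_ K ((1, 1) : Sq) :=
  Functor.isoWhiskerLeft (D.suspSq K)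
    (D.resAt K (sub fun p : Sq => p ≠ (0, 0)) ⟨(1, 1), by decide⟩).symm

theorem bijective_map_suspSq (X Y : D.obj K) :
    Function.Bijective (fun m : X ⟶ Y => (D.suspSq K).map m) := by
  have := D.isEquivalence_map_fst K
  let p : SqLL := ⟨(0, 0), by decide⟩
  let i : SqLL →o Sq := sub fun p : Sq => p ≠ (1, 1)
  have := D.isIso_ranAdj_counit (fib K p)
  have := D.isIso_lanAdj_unit (mono.{w} K i)
  exact ((D.lanAdj (mono.{w} K i)).fullyFaithfulLOfIsIsoUnit.homEquiv.bijective.comp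
    (D.ranAdj (fib K p)).fullyFaithfulROfIsIsoCounit.homEquiv.bijective).comp
    (Functor.FullyFaithful.ofFullyFaithful
      (D.map (CategoryTheory.Prod.fst K Pt.{w}))).homEquiv.bijective

/-- Both squares are suspension squares. The suspension is fully faithful by stability, and it is
the fully faithful `suspSq` followed by evaluation at (1, 1), so that evaluation is bijective on
these maps. -/
theorem IsStable.bijective_at (hS : D.IsStable) {A B : D.obj (K × ULift.{w} Sq)} (hA : Cocart A)
    (hA0 : ZeroCorners A) (hB : Cocart B) (hB0 : ZeroCorners B) :
    Function.Bijective (fun m : A ⟶ B => (D.at_ K ((1, 1) : Sq)).map m) := by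
  obtain ⟨X, ⟨a⟩⟩ := exists_iso_suspSq hS.1 hA hA0
  obtain ⟨Y, ⟨b⟩⟩ := exists_iso_suspSq hS.1 hB hB0
  refine bijective_map_congr _ a b ?_
  have := hS.isEquivalence K
  have h1 : Function.Bijective (fun m : X ⟶ Y => (D.suspension.app K).map m) :=
    (Functor.FullyFaithful.ofFullyFaithful (D.suspension.app K)).homEquiv.bijective
  rw [bijective_map_of_iso (D.suspSqAt K)] at h1
  exact (Function.Bijective.of_comp_iff _ (bijective_map_suspSq X Y)).1 h1

/-- Maps into a cartesian square are determined away from (0, 0), and there A is concentrated at the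
maximal corner (1, 1). -/
theorem bijective_at_of_cart (hz : Limits.HasZeroObject (D.obj Pt))
    {A B : D.obj (K × ULift.{w} Sq)} (hA0 : ZeroCorners A) (hB : Cart B) :
    Function.Bijective (fun m : A ⟶ B => (D.at_ K ((1, 1) : Sq)).map m) := by
  refine (bijective_map_of_iso (D.resAt K (sub fun p : Sq => p ≠ (0, 0))
    ⟨(1, 1), by decide⟩) A B).2 ?_
  refine (bijective_at_of_maximal hz (p := (⟨(1, 1), by decide⟩ : SqUR)) ?_ ?_ _).comp
    (hB.bijective_map A)
  · rintro ⟨q, hq⟩ h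
    exact Subtype.ext (le_antisymm (Prod.le_def.2 ⟨Fin.le_last _, Fin.le_last _⟩) h)
  · rintro ⟨q, hq⟩ h
    refine (D.isZero_res_at _ _).2 ?_
    rcases Sq.cases q with rfl | rfl | rfl | rfl
    · exact absurd rfl hq
    · exact hA0.1
    · exact hA0.2
    · exact absurd rfl h

/-- Let η : Q ⟶ R be the cartesian replacement, which changes only the corner (0, 0), and ε : C ⟶ R
the cocartesian replacement of R, which changes only (1, 1). Maps ψ : Q ⟶ C and χ : C ⟶ Q over R are
built and shown to be mutually inverse. Then η = ψ ≫ ε is invertible at (0, 0) as well, because ε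
is, so Q is cartesian. Of stability only the full faithfulness of Σ and the zero object are used. -/
theorem IsStable.cart (hS : D.IsStable) {Q : D.obj (K × ULift.{w} Sq)} (hQ : Cocart Q)
    (h0 : ZeroCorners Q) : Cart Q := by
  let j : SqUR →o Sq := sub fun p : Sq => p ≠ (0, 0)
  let i : SqLL →o Sq := sub fun p : Sq => p ≠ (1, 1)
  let R := (D.ran (mono K j)).obj ((D.res K j).obj Q)
  let η : Q ⟶ R := (D.ranAdj (mono K j)).unit.app Q
  let C := (D.lan (mono K i)).obj ((D.res K i).obj R)
  let ε : C ⟶ R := (D.lanAdj (mono K i)).counit.app R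
  have hR : Cart R := D.rExt_ran _ _
  have hC : Cocart C := D.lExt_lan _ _
  have hη (q : SqUR) : IsIso ((D.at_ K q.1).map η) := RExt.isIso_at_unit (f := j) Q q
  have hε (q : SqLL) : IsIso ((D.at_ K q.1).map ε) := LExt.isIso_at_counit (f := i) R q
  have hε' : IsIso ((D.res K i).map ε) :=
    (D.isIso_iff_at _).2 fun q => (D.isIso_res_at _ _).2 (hε q)
  have hC0 : ZeroCorners C := by
    have t (q : Sq) (h1 : q ≠ (0, 0)) (h2 : q ≠ (1, 1))
        (hq : Limits.IsZero ((D.at_ K q).obj Q)) : Limits.IsZero ((D.at_ K q).obj C) := by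
      have := hη ⟨q, h1⟩
      have := hε ⟨q, h2⟩
      exact hq.of_iso (asIso ((D.at_ K q).map ε) ≪≫ (asIso ((D.at_ K q).map η)).symm)
    exact ⟨t _ (by decide) (by decide) h0.1, t _ (by decide) (by decide) h0.2⟩
  have := hη ⟨(1, 1), by decide⟩
  -- Maps out of the cocartesian Q are determined away from (1, 1), where ε can be inverted.
  obtain ⟨ψ, hψ⟩ := (hQ.bijective_map C).2 ((D.res K i).map η ≫ inv ((D.res K i).map ε))
  have hψε : ψ ≫ ε = η := by
    apply (hQ.bijective_map R).1
    change (D.res K i).map (ψ ≫ ε) = (D.res K i).map η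
    rw [Functor.map_comp]
    exact (congrArg (fun t => t ≫ (D.res K i).map ε) hψ).trans (by simp)
  -- Fullness of Σ provides a map with a prescribed value at (1, 1), where η can be inverted.
  obtain ⟨χ, hχ⟩ := (hS.bijective_at hC hC0 hQ h0).2
    ((D.at_ K ((1, 1) : Sq)).map ε ≫ inv ((D.at_ K ((1, 1) : Sq)).map η))
  have hχη : χ ≫ η = ε := by
    apply (bijective_at_of_cart hS.1 hC0 hR).1
    change (D.at_ K ((1, 1) : Sq)).map (χ ≫ η) = (D.at_ K ((1, 1) : Sq)).map ε
    rw [Functor.map_comp]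
    exact (congrArg (fun t => t ≫ (D.at_ K ((1, 1) : Sq)).map η) hχ).trans (by simp)
  have e1 : χ ≫ ψ = 𝟙 C := by
    apply (hC.bijective_map C).1
    change (D.res K i).map (χ ≫ ψ) = (D.res K i).map (𝟙 C)
    rw [← cancel_mono ((D.res K i).map ε), ← Functor.map_comp, ← Functor.map_comp,
      Category.assoc, hψε, hχη, Category.id_comp]
  have e2 : ψ ≫ χ = 𝟙 Q := by
    apply (hS.bijective_at hQ h0 hQ h0).1
    change (D.at_ K ((1, 1) : Sq)).map (ψ ≫ χ) = (D.at_ K ((1, 1) : Sq)).map (𝟙 Q)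
    rw [← cancel_mono ((D.at_ K ((1, 1) : Sq)).map η), ← Functor.map_comp, ← Functor.map_comp,
      Category.assoc, hχη, hψε, Category.id_comp]
  have hψi : IsIso ψ := ⟨χ, e2, e1⟩
  refine (D.isIso_iff_at _).2 fun q => ?_
  by_cases hq : q = (0, 0)
  · subst hq
    change IsIso ((D.at_ K ((0, 0) : Sq)).map η)
    rw [← hψε, Functor.map_comp]
    have := hε ⟨(0, 0), by decide⟩
    infer_instance
  · exact hη ⟨q, hq⟩

/-- Essential surjectivity of Σ gives a suspension square A whose terminal corner is that of Q. As Q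
is cartesian, this isomorphism of corners extends to A ⟶ Q; as A is cartesian by `IsStable.cart`,
the extension is invertible. -/
theorem IsStable.cocart (hS : D.IsStable) {Q : D.obj (K × ULift.{w} Sq)} (hQ : Cart Q)
    (h0 : ZeroCorners Q) : Cocart Q := by
  have := hS.isEquivalence K
  let X := (D.suspension.app K).objPreimage ((D.at_ K ((1, 1) : Sq)).obj Q)
  let A := (D.suspSq K).obj X
  have hA := cocart_suspSq X
  have hA0 := zeroCorners_suspSq hS.1 X
  let e : (D.at_ K ((1, 1) : Sq)).obj A ≅ (D.at_ K ((1, 1) : Sq)).obj Q :=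
    ((D.suspSqAt K).app X).symm ≪≫ (D.suspension.app K).objObjPreimageIso _
  obtain ⟨m, hm⟩ := (bijective_at_of_cart hS.1 hA0 hQ).2 e.hom
  have hm' : IsIso ((D.at_ K ((1, 1) : Sq)).map m) := by
    have : (D.at_ K ((1, 1) : Sq)).map m = e.hom := hm
    rw [this]; infer_instance
  have : IsIso m := by
    refine (Cart.isIso_iff m (fun p hp => ?_) hQ).1 (hS.cart hA hA0)
    rcases Sq.cases p with rfl | rfl | rfl | rfl
    · exact absurd rfl hp
    · exact isIso_of_isZero hA0.1 h0.1 _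
    · exact isIso_of_isZero hA0.2 h0.2 _
    · exact hm'
  exact hA.of_iso (asIso m)

end Stable

/-! ### Spectra as diagrams on the strip V -/

section Strip

theorem PV.le_iff {x y : PV} : x ≤ y ↔ x.1.1 ≤ y.1.1 ∧ x.1.2 ≤ y.1.2 := Iff.rfl

theorem PV.eq_iff {x y : PV} : x = y ↔ x.1.1 = y.1.1 ∧ x.1.2 = y.1.2 := by
  rw [Subtype.ext_iff, Prod.ext_iff]

theorem PV.bounds (x : PV) : x.1.1 ≤ x.1.2 + 1 ∧ x.1.2 ≤ x.1.1 + 1 := by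
  have := x.2
  rw [abs_le] at this
  omega

/-- The diagonal elements of `V`. -/
abbrev PV.diag (n : ℤ) : PV := ⟨(n, n), by simp⟩

theorem wAt_fst (x : PV) (p : Sq) : (wAt x p).1.1 = if p.1 = 0 then x.1.1 else x.1.2 + 1 := rfl

theorem wAt_snd (x : PV) (p : Sq) : (wAt x p).1.2 = if p.2 = 0 then x.1.2 else x.1.1 + 1 := rfl

/-- The subset of those elements of `V` that are either off the diagonal or nonnegative. -/
def PV.Nonneg (x : PV) : Prop := x.1.1 = x.1.2 → 0 ≤ x.1.1

variable {K : Type w} [SmallCategory K]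
variable {D : Prederivator.{w, v, u}}

/-- The diagram vanishes off the diagonal. -/
def Vanishes (X : D.obj (K × ULift.{w} PV)) : Prop :=
  ∀ x : PV, x.1.1 ≠ x.1.2 → Limits.IsZero ((D.at_ K x).obj X)

theorem Vanishes.of_iso {X Y : D.obj (K × ULift.{w} PV)} (e : X ≅ Y) (h : Vanishes X) :
    Vanishes Y := fun x hx => (h x hx).of_iso ((D.at_ K x).mapIso e.symm)

theorem Vanishes.zeroCorners {X : D.obj (K × ULift.{w} PV)} (h : Vanishes X) (x : PV) :
    ZeroCorners ((D.res K (wAt x)).obj X) := by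
  constructor
  · refine (D.isZero_res_at _ _).2 (h _ ?_)
    rw [wAt_fst, wAt_snd]; simp
  · refine (D.isZero_res_at _ _).2 (h _ ?_)
    rw [wAt_fst, wAt_snd]; simp

variable [D.IsDerivator]

theorem vanishing_iff (hz : Limits.HasZeroObject (D.obj Pt)) (X : D.obj (K × ULift.{w} PV)) :
    D.vanishing.prop K X ↔ Vanishes X := by
  refine (D.isZero_iff_at (P := PdV) hz ((D.res K (sub fun x : PV => x.1.1 ≠ x.1.2)).obj X)).trans ?_
  exact ⟨fun h x hx => (D.isZero_res_at _ _).1 (h ⟨x, hx⟩),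
    fun h x => (D.isZero_res_at _ _).2 (h x.1 x.2)⟩

/-- If x is off the diagonal, so are all four corners of its square. -/
theorem Vanishes.cart (hz : Limits.HasZeroObject (D.obj Pt)) {X : D.obj (K × ULift.{w} PV)}
    (h : Vanishes X) {x : PV} (hx : x.1.1 ≠ x.1.2) : Cart ((D.res K (wAt x)).obj X) := by
  refine Cart.of_isZero hz fun p => (D.isZero_res_at _ _).2 (h _ ?_)
  have := x.bounds
  rw [wAt_fst, wAt_snd]
  split_ifs <;> omega

/-- The diagram is an Ω-spectrum: it vanishes off the diagonal, and its squares are cartesian. -/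
structure IsSpectrum (X : D.obj (K × ULift.{w} PV)) : Prop where
  vanishes : Vanishes X
  cart (x : PV) : Cart ((D.res K (wAt x)).obj X)

theorem IsSpectrum.of_iso {X Y : D.obj (K × ULift.{w} PV)} (e : X ≅ Y) (h : IsSpectrum X) :
    IsSpectrum Y :=
  ⟨h.vanishes.of_iso e, fun x => (h.cart x).of_iso ((D.res K _).mapIso e)⟩

theorem eq_diag {x : PV} (h : x.1.1 = x.1.2) : x = PV.diag x.1.1 := PV.eq_iff.2 ⟨rfl, h.symm⟩

/-- For n ≥ 0 the terminal corner (n + 1, n + 1) lies outside the subposet from which X is extended.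
Detection is applied to V with just this point removed, which keeps the inequalities simple. -/
theorem cocart_of_lExt {X : D.obj (K × ULift.{w} PV)}
    (h : D.LExt (mono K (sub fun x : PV => x.1.1 = x.1.2 → x.1.1 ≤ 0)) X) {n : ℤ} (hn : 0 ≤ n) :
    Cocart ((D.res K (wAt (PV.diag n))).obj X) := by
  refine Cocart.of_detect (fun x => x ≠ PV.diag (n + 1)) h ?_ ?_ ?_ ?_
  · rintro ⟨x, hx⟩ (rfl : x = _)
    simp at hx
    omega
  · intro p hp h
    rw [PV.eq_iff, wAt_fst, wAt_snd] at h
    rcases Sq.cases p with rfl | rfl | rfl | rfl <;> simp at h hp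
  all_goals
    intro y hy
    rw [ne_eq, PV.eq_iff] at hy
    simp only [PV.le_iff, wAt_fst, wAt_snd]
    simp at hy ⊢
    omega

theorem cart_of_rExt {X : D.obj (K × ULift.{w} PV)}
    (h : D.RExt (mono K (sub PV.Nonneg)) X) {n : ℤ} (hn : n < 0) :
    Cart ((D.res K (wAt (PV.diag n))).obj X) := by
  refine Cart.of_detect (fun x => x ≠ PV.diag n) h ?_ ?_ ?_ ?_
  · rintro ⟨x, hx⟩ (rfl : x = _)
    have := hx rfl
    simp at this
    omega
  · intro p hp h
    rw [PV.eq_iff, wAt_fst, wAt_snd] at h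
    rcases Sq.cases p with rfl | rfl | rfl | rfl <;> simp at h hp
  all_goals
    intro y hy
    rw [ne_eq, PV.eq_iff] at hy
    simp only [PV.le_iff, wAt_fst, wAt_snd]
    simp at hy ⊢
    omega

/-- A diagram whose squares in nonnegative degrees are cartesian can be replaced by a spectrum
without changing it in nonnegative degrees. -/
theorem exists_spectrum (hz : Limits.HasZeroObject (D.obj Pt)) {Y : D.obj (K × ULift.{w} PV)}
    (hY : Vanishes Y)
    (hc : ∀ n : ℤ, 0 ≤ n → Cart ((D.res K (wAt (PV.diag n))).obj Y)) :
    ∃ (T : D.obj (K × ULift.{w} PV)) (m : Y ⟶ T), IsSpectrum T ∧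
      ∀ x : PV, x.Nonneg → IsIso ((D.at_ K x).map m) := by
  let j : {x : PV // x.Nonneg} →o PV := sub PV.Nonneg
  -- The negative diagonal entries of Y are discarded and refilled by limits, which makes the
  -- squares in negative degrees cartesian.
  let T := (D.ran (mono K j)).obj ((D.res K j).obj Y)
  let m : Y ⟶ T := (D.ranAdj (mono K j)).unit.app Y
  have hm (x : PV) (hx : x.Nonneg) : IsIso ((D.at_ K x).map m) :=
    RExt.isIso_at_unit (f := j) Y ⟨x, hx⟩
  have hT : Vanishes T := fun x hx => by
    have := hm x fun h => absurd h hx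
    exact (hY x hx).of_iso (asIso ((D.at_ K x).map m)).symm
  refine ⟨T, m, ⟨hT, fun x => ?_⟩, hm⟩
  by_cases hx : x.1.1 = x.1.2
  · obtain ⟨n, rfl⟩ : ∃ n, x = PV.diag n := ⟨_, eq_diag hx⟩
    by_cases hn : n < 0
    · exact cart_of_rExt (D.rExt_ran _ _) hn
    · have : IsIso ((D.res K (wAt (PV.diag n))).map m) := by
        refine (D.isIso_iff_at _).2 fun p => (D.isIso_res_at _ _).2 (hm _ ?_)
        intro h
        rw [wAt_fst]
        split_ifs <;> simp <;> omega
      exact (hc n (by omega)).of_iso (asIso ((D.res K (wAt (PV.diag n))).map m))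
  · exact hT.cart hz hx

end Strip

/-! ### The connective suspension prespectrum -/

section Connective

variable {K : Type w} [SmallCategory K]
variable {D : Prederivator.{w, v, u}} [D.IsDerivator]

/-- The inclusion of `V^{≤ 0}` into `W`, as an order embedding. -/
noncomputable def leEmb : PVle ↪o PW where
  toFun p := ⟨p.1, fun _ => p.2.1⟩
  inj' _ _ h := Subtype.ext (congrArg (fun t : PW => t.1) h)
  map_rel_iff' := Iff.rfl

/-- The inclusion of `W` into `V`, as a monotone map. -/
noncomputable abbrev subW : PW →o PV := sub fun x : PV => x.1.1 = x.1.2 → x.1.1 ≤ 0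

variable (K) in
theorem prodSnd_incVle : (prodSnd K incVle.{w}).Full ∧ (prodSnd K incVle.{w}).Faithful :=
  mono_full_faithful leEmb

instance : (prodSnd K incVle.{w}).Full := (prodSnd_incVle K).1

instance : (prodSnd K incVle.{w}).Faithful := (prodSnd_incVle K).2

instance : (prodSnd K incW.{w}).Full := inferInstanceAs (mono.{w} K subW).Full

instance : (prodSnd K incW.{w}).Faithful := inferInstanceAs (mono.{w} K subW).Faithful

/-- The origin is the greatest element of V^{≤ 0}, so the first left Kan extension is zero there
away from the origin. No element of `PW` outside V^{≤ 0} lies below an element of V^{≤ 0}, so the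
right Kan extension adds zeros. The last left Kan extension changes nothing on `PW`. -/
theorem isZero_connective_at (hz : Limits.HasZeroObject (D.obj Pt)) (X : D.obj K) {x : PV}
    (hx : x.1.1 = x.1.2 → x.1.1 < 0) :
    Limits.IsZero ((D.at_ K x).obj ((D.connective.app K).obj X)) := by
  let T1 := (D.lan (fib K PVle.zero)).obj ((D.map (CategoryTheory.Prod.fst K Pt.{w})).obj X)
  let T2 := (D.ran (prodSnd K incVle.{w})).obj T1
  have := D.isIso_lanAdj_unit (mono.{w} K subW)
  have hc : IsIso ((D.ranAdj (prodSnd K incVle.{w})).counit.app T1) :=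
    (NatTrans.isIso_iff_isIso_app _).1 (D.isIso_ranAdj_counit (prodSnd K incVle.{w})) T1
  let y : PW := ⟨x, fun h => (hx h).le⟩
  refine (D.isZero_res_at (f := subW) _ y).1 (Limits.IsZero.of_iso ?_ ((D.at_ K y).mapIso
        (asIso ((D.lanAdj (mono.{w} K subW)).unit.app T2)).symm))
  by_cases h : x.1.1 ≤ 0 ∧ x.1.2 ≤ 0
  · refine (D.isZero_res_at (f := leEmb.toOrderHom) T2 ⟨x, h⟩).1 (Limits.IsZero.of_iso ?_
      ((D.at_ K (⟨x, h⟩ : PVle)).mapIso (@asIso _ _ _ _ _ hc)))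
    refine D.isZero_lan_fib hz ?_ _
    intro h2
    have h3 : (0 : ℤ) ≤ x.1.1 ∧ 0 ≤ x.1.2 := h2
    omega
  · refine D.isZero_ran_at hz leEmb.toOrderHom T1 y fun p hp => absurd ?_ h
    have h1 : x.1.1 ≤ p.1.1.1 ∧ x.1.2 ≤ p.1.1.2 := hp
    have := p.2
    omega

theorem vanishes_connective (hz : Limits.HasZeroObject (D.obj Pt)) (X : D.obj K) :
    Vanishes ((D.connective.app K).obj X) :=
  fun _ hx => isZero_connective_at hz X fun h => absurd h hx

theorem lExt_connective (X : D.obj K) : D.LExt (mono K subW) ((D.connective.app K).obj X) :=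
  D.lExt_lan (mono K subW) _

/-- The final left Kan extension makes these squares cocartesian; stability makes them cartesian. -/
theorem IsStable.cart_connective (hS : D.IsStable) (X : D.obj K) {n : ℤ} (hn : 0 ≤ n) :
    Cart ((D.res K (wAt (PV.diag n))).obj ((D.connective.app K).obj X)) :=
  hS.cart (cocart_of_lExt (lExt_connective X) hn) ((vanishes_connective hS.1 X).zeroCorners _)

end Connective

/-! ### The localization on maps that are invertible in nonnegative degrees, and on spectra -/

section Localization

/-- The map `ω`, as a monotone map. -/
abbrev omegaM : PVge × PV →o PV := ⟨omegaFun, omegaFun_mono⟩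

/-- The map `ζ × 1`, as a monotone map. -/
noncomputable abbrev zetaM : PZ × PV →o PVge × PV := ⟨fun x => (x.1.1.1, x.2), fun _ _ h => ⟨h.1.1, h.2⟩⟩

/-- The inclusion `f × 1`, as an order embedding. -/
noncomputable def incZEmb : PZ × PV ↪o (PVge × ℕ) × PV where
  toFun x := (x.1.1, x.2)
  inj' _ _ h := Prod.ext (Subtype.ext (congrArg (fun t => t.1) h)) (congrArg (fun t => t.2) h)
  map_rel_iff' := Iff.rfl

/-- The inclusion of the column over the origin, as a monotone map. -/
noncomputable abbrev columnM : ℕ × PV →o (PVge × ℕ) × PV :=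
  ⟨fun x => ((PVge.zero, x.1), x.2), fun _ _ h => ⟨⟨le_rfl, h.1⟩, h.2⟩⟩

/-- The projection `π × 1`, as a monotone map. -/
noncomputable abbrev projM : ℕ × PV →o PV := ⟨Prod.snd, fun _ _ h => h.2⟩

/-- The projection that forgets the natural number. -/
noncomputable abbrev forgetM : (PVge × ℕ) × PV →o PVge × PV :=
  ⟨fun x => (x.1.1, x.2), fun _ _ h => ⟨h.1.1, h.2⟩⟩

theorem omega_fst (x : PVge × PV) : (omegaFun x).1.1 =
    x.1.1.1.1 + if Even x.1.1.1.1 then x.2.1.1 else x.2.1.2 := rfl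

theorem omega_snd (x : PVge × PV) : (omegaFun x).1.2 =
    x.1.1.1.2 + if Even x.1.1.1.2 then x.2.1.2 else x.2.1.1 := rfl

/-- If (a, b) is off the diagonal, then a and b have opposite parity, so ω adds the same number to
both and the value is off the diagonal. If a = b, then a value on the diagonal is (a + i, a + i)
with a ≥ k and i ≥ x.1.1 ≥ -k. -/
theorem omega_nonneg {z : PVge × PV} {k : ℕ} (hk : z.1.1.1.1 = z.1.1.1.2 → (k : ℤ) ≤ z.1.1.1.1)
    {x : PV} (h1 : -x.1.1 ≤ k) (hx : x ≤ z.2) : (omegaFun z).Nonneg := by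
  intro h
  rw [omega_fst, omega_snd] at h
  rw [omega_fst]
  have hx' : x.1.1 ≤ z.2.1.1 ∧ x.1.2 ≤ z.2.1.2 := hx
  have b1 := z.1.1.bounds
  have b2 := z.2.bounds
  simp only [Int.even_iff] at h ⊢
  split_ifs at h ⊢ <;> omega

variable {K : Type w} [SmallCategory K]

variable (K) in
theorem prodSnd_incZV : (prodSnd K incZV.{w}).Full ∧ (prodSnd K incZV.{w}).Faithful :=
  mono_full_faithful incZEmb

instance : (prodSnd K incZV.{w}).Full := (prodSnd_incZV K).1

instance : (prodSnd K incZV.{w}).Faithful := (prodSnd_incZV K).2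

variable (D : Prederivator.{w, v, u}) [D.IsDerivator]

/-- The sequence of which `loc` is the colimit. -/
noncomputable def locSeq (K : Type w) [SmallCategory K] :
    D.obj (K × ULift.{w} PV) ⥤ D.obj (K × ULift.{w} (ℕ × PV)) :=
  D.res K omegaM ⋙ D.res K zetaM ⋙ D.ran (mono K incZEmb.toOrderHom) ⋙ D.res K columnM

variable {D}

/-- The value at (k, x) is a right Kan extension, so it depends only on the values of X at ω(z) for
those z of Z × V above (((0, 0), k), x). By `omega_nonneg` these lie in the nonnegative part. -/
theorem isIso_locSeq_at {X Y : D.obj (K × ULift.{w} PV)} (m : X ⟶ Y)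
    (hm : ∀ x : PV, x.Nonneg → IsIso ((D.at_ K x).map m)) (k : ℕ) (x : PV) (h1 : -x.1.1 ≤ k) : IsIso ((D.at_ K (k, x)).map ((D.locSeq K).map m)) := by
  refine (D.isIso_res_at (f := columnM) _ _).2 (D.isIso_ran_at _ _ _ fun z hz => ?_)
  refine (D.isIso_res_at (f := zetaM) _ _).2 ((D.isIso_res_at (f := omegaM) _ _).2 (hm _ ?_))
  have hz' : (PVge.zero ≤ z.1.1.1 ∧ k ≤ z.1.1.2) ∧ x ≤ z.2 := hz
  refine omega_nonneg (k := k) (x := x) (fun h => ?_) h1 hz'.2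
  have := z.1.2 h
  exact le_trans (by exact_mod_cast hz'.1.2) this

/-- A morphism of sequences that is invertible from some stage on induces an isomorphism of
colimits. -/
theorem isIso_lan_projM_at {X Y : D.obj (K × ULift.{w} (ℕ × PV))} (m : X ⟶ Y) (n : ℕ) (x : PV)
    (hm : ∀ k, n ≤ k → IsIso ((D.at_ K (k, x)).map m)) :
    IsIso ((D.at_ K x).map ((D.lan (mono K projM)).map m)) := by
  let f : ℕ →o ℕ × PV := ⟨fun k => (k + n, x), fun _ _ h => ⟨Nat.add_le_add_right h n, le_rfl⟩⟩
  let g : ℕ →o Unit := ⟨fun _ => (), fun _ _ _ => le_rfl⟩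
  let k : Unit →o PV := ⟨fun _ => x, fun _ _ _ => le_rfl⟩
  -- One exact square combines evaluation at x with the cofinality of the tail k ↦ k + n in ℕ.
  have h := D.isIso_mateL (cell.{w} (K := K) (f := f) (u := projM) (g := g) (k := k) fun _ => le_rfl)
    (cmp_cell _ (by
      rintro _ ⟨i, y⟩ hy
      -- The truncated difference is the least j with i ≤ j + n, also when i < n.
      exact ⟨i - n, trivial, ⟨show i ≤ i - n + n by omega, hy⟩, fun j _ hj => by
        have : i ≤ j + n := hj.1
        omega⟩))
  refine (D.isIso_res_at (f := k) _ ()).1 ?_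
  have h2 : IsIso ((D.res K f).map m) :=
    (D.isIso_iff_at _).2 fun k => (D.isIso_res_at _ _).2 (hm _ (Nat.le_add_left n k))
  have h3 : IsIso ((D.res K k).map ((D.lan (mono K projM)).map m)) := by
    refine (NatIso.isIso_map_iff (asIso (D.mateL (cell.{w} (K := K) (f := f) (u := projM) (g := g)
      (k := k) fun _ => le_rfl))) m).1 ?_
    exact Functor.map_isIso (D.lan (mono K g)) _
  infer_instance

theorem isIso_loc_map {X Y : D.obj (K × ULift.{w} PV)} (m : X ⟶ Y)
    (hm : ∀ x : PV, x.Nonneg → IsIso ((D.at_ K x).map m)) : IsIso ((D.loc.app K).map m) := by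
  refine (D.isIso_iff_at _).2 fun x =>
    D.isIso_lan_projM_at ((D.locSeq K).map m) (-x.1.1).toNat x fun k hk => ?_
  exact isIso_locSeq_at m hm k x (by omega)

/-- The square in `V^{≥ 0}` with initial corner `(n, n)`. -/
def geSq (n : ℕ) : Sq →o PVge where
  toFun p := ⟨⟨(n + p.1.val, n + p.2.val), by rw [abs_le]; omega⟩, by simp only; omega⟩
  monotone' p q h := by
    have h1 : p.1.val ≤ q.1.val ∧ p.2.val ≤ q.2.val := h
    have : (n + p.1.val : ℤ) ≤ n + q.1.val ∧ (n + p.2.val : ℤ) ≤ n + q.2.val := by omega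
    exact this

theorem geSq_fst (n : ℕ) (p : Sq) : (geSq n p).1.1.1 = n + p.1.val := rfl

theorem geSq_snd (n : ℕ) (p : Sq) : (geSq n p).1.1.2 = n + p.2.val := rfl

/-- Passing from (n, n) to a neighbour adds 1 to a coordinate and flips its parity, hence exchanges
i and j there; this is exactly what w does. Therefore the squares of ω^* X over V^{≥ 0} are squares
of X. -/
theorem omega_geSq (n : ℕ) (x : PV) (p : Sq) :
    omegaFun (geSq n p, x) = wAt (omegaFun (geSq n (0, 0), x)) p := by
  rw [PV.eq_iff, wAt_fst, wAt_snd]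
  simp only [omega_fst, omega_snd, geSq_fst, geSq_snd, Int.even_iff]
  rcases Sq.cases p with rfl | rfl | rfl | rfl <;>
    simp only [Fin.val_zero, Fin.val_one, Nat.cast_zero, Nat.cast_one, if_true, one_ne_zero,
      if_false] <;> (try split_ifs) <;>
    refine ⟨?_, ?_⟩ <;> first | trivial | omega

/-- Outside Z the only points are ((n, n), k) with k > n. The square from (n, n) to (n + 1, n + 1)
at fixed k is cartesian in the given diagram because T is a spectrum, and in its extension from Z by
detection. Its middle corners lie in Z, so invertibility of the unit passes down from (n + 1, n + 1)
to (n, n). -/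
theorem IsSpectrum.rExt {T : D.obj (K × ULift.{w} PV)}
    (hT : IsSpectrum T) :
    D.RExt (mono K incZEmb.toOrderHom) ((D.res K forgetM).obj ((D.res K omegaM).obj T)) := by
  let H := (D.res K forgetM).obj ((D.res K omegaM).obj T)
  have hH : D.RExt (mono K incZEmb.toOrderHom) ((D.ran (mono K incZEmb.toOrderHom)).obj
    ((D.res K incZEmb.toOrderHom).obj H)) := D.rExt_ran (prodSnd K incZV.{w}) _
  let m := (D.ranAdj (mono K incZEmb.toOrderHom)).unit.app H
  have hm (z : (PVge × ℕ) × PV) (h : z.1.1.1.1.1 = z.1.1.1.1.2 → (z.1.2 : ℤ) ≤ z.1.1.1.1.1) :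
      IsIso ((D.at_ K z).map m) := by
    exact @RExt.isIso_at_unit _ _ _ _ K _ D _ incZEmb.toOrderHom (prodSnd_incZV K).1
      (prodSnd_incZV K).2 H (⟨z.1, h⟩, z.2)
  -- The number d bounds the steps up the diagonal from (n, n) to (k, k), where Z is reached.
  have key (d : ℕ) : ∀ (n k : ℕ) (x : PV), k ≤ n + d →
      IsIso ((D.at_ K (((geSq n (0, 0)), k), x)).map m) := by
    induction d with
    | zero =>
      intro n k x h
      refine hm _ fun _ => ?_
      simp only [geSq_fst]
      simp
      omega
    | succ d ih =>
      intro n k x h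
      by_cases hk : k ≤ n
      · refine hm _ fun _ => ?_
        simp only [geSq_fst]
        simp
        omega
      · let c : Sq →o (PVge × ℕ) × PV := ⟨fun p => ((geSq n p, k), x),
          fun _ _ h => ⟨⟨(geSq n).monotone h, le_rfl⟩, le_rfl⟩⟩
        have e : omegaM.comp (forgetM.comp c) = wAt (omegaFun (geSq n (0, 0), x)) :=
          OrderHom.ext _ _ (funext fun p => omega_geSq n x p)
        have h1 : Cart ((D.res K c).obj H) := by
          have h2 := hT.cart (omegaFun (geSq n (0, 0), x))
          rw [← e] at h2
          exact h2.of_iso ((D.resComp K (forgetM.comp c) omegaM).app T ≪≫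
            (D.resComp K c forgetM).app _)
        have h2 : Cart ((D.res K c).obj ((D.ran (mono K incZEmb.toOrderHom)).obj
            ((D.res K incZEmb.toOrderHom).obj H))) := by
          -- Everything over (n, n) outside Z is removed at all levels l > n and at all points of V,
          -- not just the corner itself, because any such point above the corner would violate the
          -- first order condition.
          refine Cart.of_detect (fun z => ¬ (z.1.1 = geSq n (0, 0) ∧ n < z.1.2)) hH ?_ ?_ ?_ ?_
          · rintro ⟨⟨z, hz⟩, y⟩ ⟨h3, h4⟩
            replace h3 : z.1 = geSq n (0, 0) := h3
            replace h4 : n < z.2 := h4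
            have := hz (by rw [h3]; rfl)
            rw [h3, geSq_fst] at this
            simp at this
            omega
          · rintro p hp ⟨h3, -⟩
            have h4 : (n + p.1.val : ℤ) = n + 0 ∧ (n + p.2.val : ℤ) = n + 0 :=
              PV.eq_iff.1 (congrArg Subtype.val h3)
            exact hp (Prod.ext (Fin.ext (show p.1.val = 0 by omega))
              (Fin.ext (show p.2.val = 0 by omega)))
          · rintro ⟨⟨y, l⟩, x'⟩ hy hle
            have h3 : (((n + 0 : ℤ) ≤ y.1.1.1 ∧ (n + 0 : ℤ) ≤ y.1.1.2) ∧ k ≤ l) ∧ x ≤ x' := hle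
            have h4 : ¬ (y.1.1.1 = n ∧ y.1.1.2 = n) := fun h4 => hy
              ⟨Subtype.ext (PV.eq_iff.2 (by simpa [geSq_fst, geSq_snd] using h4)),
                by simp only; omega⟩
            have h5 : ((n + 1 : ℤ) ≤ y.1.1.1 ∧ (n + 0 : ℤ) ≤ y.1.1.2) ∨
              ((n + 0 : ℤ) ≤ y.1.1.1 ∧ (n + 1 : ℤ) ≤ y.1.1.2) := by omega
            exact h5.imp (fun h => ⟨⟨h, h3.1.2⟩, h3.2⟩) (fun h => ⟨⟨h, h3.1.2⟩, h3.2⟩)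
          · rintro ⟨⟨y, l⟩, x'⟩ _ h10 h01
            have h3 : (((n + 1 : ℤ) ≤ y.1.1.1 ∧ (n + 0 : ℤ) ≤ y.1.1.2) ∧ k ≤ l) ∧ x ≤ x' := h10
            have h4 : (((n + 0 : ℤ) ≤ y.1.1.1 ∧ (n + 1 : ℤ) ≤ y.1.1.2) ∧ k ≤ l) ∧ x ≤ x' := h01
            exact ⟨⟨⟨h3.1.1.1, h4.1.1.2⟩, h3.1.2⟩, h3.2⟩
        refine Cart.isIso_corner (c := c) m h1 h2 (hm _ fun h => ?_) (hm _ fun h => ?_) ?_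
        · exfalso
          have h' : (n + 1 : ℤ) = n + 0 := h
          omega
        · exfalso
          have h' : (n + 0 : ℤ) = n + 1 := h
          omega
        · have h3 := ih (n + 1) k x (by omega)
          have e2 : geSq n (1, 1) = geSq (n + 1) (0, 0) := by
            refine Subtype.ext (PV.eq_iff.2 ?_)
            rw [geSq_fst, geSq_snd, geSq_fst, geSq_snd]
            simp
          rw [← e2] at h3
          exact h3
  refine (D.isIso_iff_at _).2 fun z => ?_
  by_cases hz : z.1.1.1.1.1 = z.1.1.1.1.2
  · obtain ⟨n, hn⟩ : ∃ n : ℕ, z.1.1 = geSq n (0, 0) := by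
      obtain ⟨n, hn⟩ := Int.eq_ofNat_of_zero_le z.1.1.2.1
      refine ⟨n, Subtype.ext (PV.eq_iff.2 ?_)⟩
      rw [geSq_fst, geSq_snd]
      simp
      omega
    have := key z.1.2 n z.1.2 z.2 (by omega)
    rw [← hn] at this
    exact this
  · exact hm z fun h => absurd h hz

/-- On a spectrum, the sequence that defines `loc` is constant. -/
theorem IsSpectrum.locSeq_iso {T : D.obj (K × ULift.{w} PV)} (hT : IsSpectrum T) :
    Nonempty ((D.locSeq K).obj T ≅ (D.res K projM).obj T) := by
  let H := (D.res K forgetM).obj ((D.res K omegaM).obj T)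
  have h : IsIso ((D.ranAdj (mono K incZEmb.toOrderHom)).unit.app H) := hT.rExt
  -- This is ω((0, 0), x) = x.
  have e : omegaM.comp (forgetM.comp columnM) = projM :=
    OrderHom.ext _ _ (funext fun z => PV.eq_iff.2 ⟨by
      change (0 : ℤ) + (if Even (0 : ℤ) then z.2.1.1 else z.2.1.2) = z.2.1.1
      simp, by
      change (0 : ℤ) + (if Even (0 : ℤ) then z.2.1.2 else z.2.1.1) = z.2.1.2
      simp⟩)
  have e1 : (D.locSeq K).obj T ≅ (D.res K columnM).obj H :=
    (D.res K columnM).mapIso ((D.ran _).mapIso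
      ((D.resComp K incZEmb.toOrderHom forgetM).app ((D.res K omegaM).obj T)) ≪≫
        (@asIso _ _ _ _ _ h).symm)
  have e2 : (D.res K columnM).obj H ≅ (D.res K (omegaM.comp (forgetM.comp columnM))).obj T :=
    ((D.resComp K (forgetM.comp columnM) omegaM).app T ≪≫ (D.resComp K columnM forgetM).app _).symm
  exact ⟨e1 ≪≫ e2 ≪≫ eqToIso (by rw [e])⟩

/-- The projection `ℕ × V ⥤ V` is right adjoint to the section at `0`. -/
noncomputable def zeroAdj (K : Type w) [SmallCategory K] :
    mono.{w} K (⟨fun x => (0, x), fun _ _ h => ⟨le_rfl, h⟩⟩ : PV →o ℕ × PV) ⊣ mono K projM :=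
  Adjunction.mkOfUnitCounit
    { unit :=
        { app := fun _ => 𝟙 _
          naturality := fun _ _ _ => Prod.ext ((Category.comp_id _).trans (Category.id_comp _).symm)
            (Subsingleton.elim _ _) }
      counit :=
        { app := fun x => Prod.mkHom (𝟙 x.1) (homOfLE ⟨Nat.zero_le _, le_rfl⟩)
          naturality := fun _ _ _ => Prod.ext ((Category.comp_id _).trans (Category.id_comp _).symm)
            (Subsingleton.elim _ _) }
      left_triangle := by
        ext x
        · simp only [Functor.id_obj, NatTrans.comp_app, Functor.whiskerRight_app,
            Functor.associator_hom_app, Functor.whiskerLeft_app, Category.id_comp]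
          exact Category.id_comp _
        · exact Subsingleton.elim _ _
      right_triangle := by
        ext x
        · simp only [Functor.id_obj, NatTrans.comp_app, Functor.whiskerRight_app,
            Functor.associator_inv_app, Functor.whiskerLeft_app, Category.id_comp]
          exact Category.id_comp _
        · exact Subsingleton.elim _ _ }

/-- The colimit of a constant sequence is its value. The constant sequence functor has evaluation at
0 as a right adjoint with invertible unit, so it is fully faithful, and its left adjoint has an
invertible counit. -/
theorem isIso_projM_counit (T : D.obj (K × ULift.{w} PV)) :
    IsIso ((D.lanAdj (mono K projM)).counit.app T) := by
  have h1 : IsIso (zeroAdj.{w} K).unit := by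
    have : ∀ x, IsIso ((zeroAdj.{w} K).unit.app x) := fun x => inferInstanceAs (IsIso (𝟙 x))
    exact NatIso.isIso_of_isIso_app _
  have h2 : IsIso (D.mapAdj (zeroAdj K)).unit := by
    have := D.isIso_map₂ (zeroAdj.{w} K).unit
    exact inferInstanceAs (IsIso ((D.mi _).inv ≫ D.map₂ (zeroAdj K).unit ≫ (D.mc _ _).hom))
  have h3 := (D.mapAdj (zeroAdj K)).fullyFaithfulLOfIsIsoUnit
  have := h3.full
  have := h3.faithful
  infer_instance

/-- The sequence of T is isomorphic to a constant one, where a triangle identity reduces the unit to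
the counit above. -/
theorem isIso_locSeq_unit {T : D.obj (K × ULift.{w} PV)} (hT : IsSpectrum T) :
    IsIso ((D.lanAdj (mono K projM)).unit.app ((D.locSeq K).obj T)) := by
  obtain ⟨e⟩ := hT.locSeq_iso
  refine (NatTrans.isIso_app_iff_of_iso (D.lanAdj (mono K projM)).unit e).2 ?_
  have := isIso_projM_counit T
  have e := (D.lanAdj (mono K projM)).right_triangle_components T
  have h : IsIso ((D.lanAdj (mono K projM)).unit.app ((D.res K projM).obj T) ≫
    (D.res K projM).map ((D.lanAdj (mono K projM)).counit.app T)) := by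
      rw [e]; exact inferInstanceAs (IsIso (𝟙 _))
  exact (isIso_comp_right_iff _ _).1 h

theorem IsSpectrum.loc_iso {T : D.obj (K × ULift.{w} PV)} (hT : IsSpectrum T) :
    Nonempty ((D.loc.app K).obj T ≅ T) := by
  obtain ⟨e⟩ := hT.locSeq_iso
  exact ⟨(D.lan (mono K projM)).mapIso e ≪≫ @asIso _ _ _ _ _ (isIso_projM_counit T)⟩

end Localization

/-! ### Evaluation in degree zero is fully faithful on spectra -/

section EvaluationZero

/-- The elements of `V^{≤ 0}` that are either off the diagonal or equal to the origin. -/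
abbrev PV.Low (x : PV) : Prop := (x.1.1 ≤ 0 ∧ x.1.2 ≤ 0) ∧ (x.1.1 = x.1.2 → x.1.1 = 0)

/-- The inclusion of the lower part of `∂V ∪ {(0, 0)}` into `W`, as an order embedding. -/
noncomputable def lowEmb : {x : PV // x.Low} ↪o PW where
  toFun x := ⟨x.1, fun _ => x.2.1.1⟩
  inj' _ _ h := Subtype.ext (congrArg (fun t : PW => t.1) h)
  map_rel_iff' := Iff.rfl

theorem wAt_diag_last (n : ℤ) : wAt (PV.diag n) (1, 1) = PV.diag (n + 1) := by
  rw [PV.eq_iff, wAt_fst, wAt_snd]; simp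

theorem wAt_zero (x : PV) : wAt x (0, 0) = x := by
  rw [PV.eq_iff, wAt_fst, wAt_snd]; simp

variable {K : Type w} [SmallCategory K]
variable {D : Prederivator.{w, v, u}} [D.IsDerivator]

/-- The counit is invertible on `PW`. It propagates up the positive diagonal, because the squares in
degrees n ≥ 0 are cocartesian in the extension by detection and in X by stability. -/
theorem IsStable.lExt (hS : D.IsStable) {X : D.obj (K × ULift.{w} PV)} (hX : IsSpectrum X) :
    D.LExt (mono K subW) X := by
  let m := (D.lanAdj (mono K subW)).counit.app X
  have hm (x : PV) (hx : x.1.1 = x.1.2 → x.1.1 ≤ 0) : IsIso ((D.at_ K x).map m) :=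
    LExt.isIso_at_counit (f := subW) X ⟨x, hx⟩
  have key (n : ℕ) : IsIso ((D.at_ K (PV.diag n)).map m) := by
    induction n with
    | zero => exact hm _ fun _ => le_rfl
    | succ n ih =>
      have h := Cocart.isIso_corner (c := wAt (PV.diag n)) m
        (cocart_of_lExt (D.lExt_lan (mono K subW) _) (Int.natCast_nonneg n))
        (hS.cocart (hX.cart _) (hX.vanishes.zeroCorners _))
        (hm _ fun h => by rw [wAt_fst, wAt_snd] at h; simp at h)
        (hm _ fun h => by rw [wAt_fst, wAt_snd] at h; simp at h)
        (by rw [wAt_zero]; exact ih)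
      rw [wAt_diag_last] at h
      exact h
  refine (D.isIso_iff_at _).2 fun x => ?_
  by_cases hx : x.1.1 = x.1.2 → x.1.1 ≤ 0
  · exact hm x hx
  · push Not at hx
    obtain ⟨n, hn⟩ := Int.eq_ofNat_of_zero_le hx.2.le
    rw [eq_diag hx.1, hn]
    exact key n

/-- The unit is invertible on the low part. At an off-diagonal point outside it both sides vanish,
since no low element lies above. Along the negative diagonal it propagates down through squares that
are cartesian on both sides. Stability plays no role here. -/
theorem IsSpectrum.rExt_low (hz : Limits.HasZeroObject (D.obj Pt))
    {Y : D.obj (K × ULift.{w} PV)} (hY : IsSpectrum Y) :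
    D.RExt (mono K lowEmb.toOrderHom) ((D.res K subW).obj Y) := by
  have h1 := (mono_full_faithful.{w} (K := K) lowEmb).1
  have h2 := (mono_full_faithful.{w} (K := K) lowEmb).2
  let m := (D.ranAdj (mono K lowEmb.toOrderHom)).unit.app ((D.res K subW).obj Y)
  have hm (x : PW) (hx : x.1.Low) : IsIso ((D.at_ K x).map m) :=
    RExt.isIso_at_unit (f := lowEmb.toOrderHom) _ ⟨x.1, hx⟩
  have hm' (x : PW) (hx : x.1.1.1 ≠ x.1.1.2) : IsIso ((D.at_ K x).map m) := by
    by_cases hl : x.1.Low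
    · exact hm x hl
    · refine isIso_of_isZero ((D.isZero_res_at (f := subW) _ _).2 (hY.vanishes _ hx)) ?_ _
      refine D.isZero_ran_at hz _ _ _ fun p hp => absurd ?_ hl
      have h3 : x.1.1.1 ≤ p.1.1.1 ∧ x.1.1.2 ≤ p.1.1.2 := hp
      have h4 := p.2.1
      exact ⟨by omega, fun h => absurd h hx⟩
  have hd (n : ℕ) : -(n : ℤ) ≤ 0 := by omega
  have key (n : ℕ) : IsIso ((D.at_ K (⟨PV.diag (-n), fun _ => hd n⟩ : PW)).map m) := by
    induction n with
    | zero => exact hm _ ⟨⟨by simp, by simp⟩, by simp⟩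
    | succ n ih =>
      -- The square runs from degree -(n + 1) to degree -n ≤ 0, so it stays in `PW`.
      have hc (p : Sq) : (wAt (PV.diag (-(n + 1 : ℕ))) p).1.1 =
          (wAt (PV.diag (-(n + 1 : ℕ))) p).1.2 → (wAt (PV.diag (-(n + 1 : ℕ))) p).1.1 ≤ 0 := by
        intro _
        rw [wAt_fst]
        split_ifs <;> simp only <;> omega
      let c : Sq →o PW := ⟨fun p => ⟨wAt (PV.diag (-(n + 1 : ℕ))) p, hc p⟩,
        fun _ _ h => (wAt _).monotone h⟩
      have c00 : (c (0, 0)).1 = PV.diag (-(n + 1 : ℕ)) := wAt_zero _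
      have h1 : Cart ((D.res K c).obj ((D.res K subW).obj Y)) :=
        (hY.cart (PV.diag (-(n + 1 : ℕ)))).of_iso ((D.resComp K c subW).app Y)
      have h2 : Cart ((D.res K c).obj ((D.ran (mono K lowEmb.toOrderHom)).obj
          ((D.res K lowEmb.toOrderHom).obj ((D.res K subW).obj Y)))) := by
        refine Cart.of_detect (fun x => x.1 ≠ PV.diag (-(n + 1 : ℕ)))
          (D.rExt_ran (mono K lowEmb.toOrderHom) _) ?_ ?_ ?_ ?_
        · rintro ⟨x, hx⟩ (h : x = _)
          have h' := PV.eq_iff.1 h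
          have := hx.2
          simp only at h'
          omega
        · intro p hp h
          replace h := PV.eq_iff.1 h
          change (wAt _ _).1.1 = _ ∧ (wAt _ _).1.2 = _ at h
          rw [wAt_fst, wAt_snd] at h
          rcases Sq.cases p with rfl | rfl | rfl | rfl <;> simp at h hp
        · intro y hy
          rw [ne_eq, PV.eq_iff] at hy
          change wAt _ _ ≤ y.1 → wAt _ _ ≤ y.1 ∨ wAt _ _ ≤ y.1
          simp only [PV.le_iff, wAt_fst, wAt_snd]
          simp at hy ⊢
          omega
        · intro y hy
          change wAt _ _ ≤ y.1 → wAt _ _ ≤ y.1 → wAt _ _ ≤ y.1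
          simp only [PV.le_iff, wAt_fst, wAt_snd]
          simp
          omega
      have h := Cart.isIso_corner (c := c) m h1 h2
        (hm' _ fun h => by
          change (wAt _ _).1.1 = (wAt _ _).1.2 at h
          rw [wAt_fst, wAt_snd] at h; simp at h)
        (hm' _ fun h => by
          change (wAt _ _).1.1 = (wAt _ _).1.2 at h
          rw [wAt_fst, wAt_snd] at h; simp at h) (by
          have e : c (1, 1) = ⟨PV.diag (-n), fun _ => hd n⟩ := by
            refine Subtype.ext ((wAt_diag_last _).trans (PV.eq_iff.2 ?_))
            simp
          rw [e]
          exact ih)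
      have e : c (0, 0) = ⟨PV.diag (-(n + 1 : ℕ)), fun _ => hd (n + 1)⟩ := Subtype.ext (wAt_zero _)
      rw [e] at h
      exact h
  refine (D.isIso_iff_at _).2 fun x => ?_
  by_cases hx : x.1.1.1 = x.1.1.2
  · obtain ⟨n, hn⟩ := Int.eq_ofNat_of_zero_le (neg_nonneg.2 (x.2 hx))
    have e : x = ⟨PV.diag (-n), fun _ => hd n⟩ := by
      refine Subtype.ext (PV.eq_iff.2 ?_)
      simp only
      omega
    rw [e]
    exact key n
  · exact hm' x hx

/-- Evaluation in degree zero is fully faithful on spectra. -/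
theorem IsStable.bijective_at_zero (hS : D.IsStable) {X Y : D.obj (K × ULift.{w} PV)}
    (hX : IsSpectrum X) (hY : IsSpectrum Y) :
    Function.Bijective (fun m : X ⟶ Y => (D.at_ K PV.zero).map m) := by
  let z : {x : PV // x.Low} := ⟨PV.zero, ⟨le_rfl, le_rfl⟩, fun _ => rfl⟩
  let f : {x : PV // x.Low} →o PV := subW.comp lowEmb.toOrderHom
  refine (bijective_map_of_iso (D.resAt K f z) X Y).2 ?_
  -- On the low part the origin is maximal and X vanishes elsewhere.
  refine (bijective_at_of_maximal hS.1 (p := z) ?_ ?_ _).comp ?_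
  · intro q hq
    have h1 : (0 : ℤ) ≤ q.1.1.1 ∧ (0 : ℤ) ≤ q.1.1.2 := hq
    have h2 := q.2.1
    refine Subtype.ext (PV.eq_iff.2 ?_)
    simp only [z]
    omega
  · intro q hq
    refine (D.isZero_res_at _ _).2 (hX.vanishes _ fun h => hq ?_)
    have h1 := q.2.2 h
    replace h : q.1.1.1 = q.1.1.2 := h
    refine Subtype.ext (PV.eq_iff.2 ?_)
    simp only [z]
    omega
  · refine (bijective_map_of_iso (D.resComp K lowEmb.toOrderHom subW) X Y).2 ?_
    exact ((hY.rExt_low hS.1).bijective_map _).comp ((hS.lExt hX).bijective_map Y)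

end EvaluationZero

/-! ### Calculus of modifications and strict morphisms -/

section Modifications

variable {C : Prederivator.{w, v₃, u₃}} {D : Prederivator.{w, v₁, u₁}}
  {E : Prederivator.{w, v₂, u₂}}

theorem Morphism.comp_γ_app (Φ : Morphism C D) (Ψ : Morphism D E) {J K : Type w}
    [SmallCategory J] [SmallCategory K] (u : J ⥤ K) (X : C.obj K) :
    ((Φ.comp Ψ).γ u).hom.app X =
      (Ψ.γ u).hom.app ((Φ.app K).obj X) ≫ (Ψ.app J).map ((Φ.γ u).hom.app X) := by
  simp [Morphism.comp]

theorem Morphism.id_γ_app {J K : Type w} [SmallCategory J] [SmallCategory K] (u : J ⥤ K)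
    (X : D.obj K) : ((Morphism.id D).γ u).hom.app X = 𝟙 ((D.map u).obj X) := by
  simp [Morphism.id]

/-- The identity modification. -/
def Modification.id (Φ : Morphism D E) : Modification Φ Φ where
  app K _ := 𝟙 (Φ.app K)
  comm {J K} _ _ u X := by
    rw [NatTrans.id_app, NatTrans.id_app, CategoryTheory.Functor.map_id]
    exact (Category.comp_id _).trans (Category.id_comp _).symm

/-- Vertical composition of modifications. -/
def Modification.vcomp {Φ Ψ Θ : Morphism D E} (η : Modification Φ Ψ) (θ : Modification Ψ Θ) :
    Modification Φ Θ where
  app K _ := η.app K ≫ θ.app K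
  comm {J K} _ _ u X := by
    rw [NatTrans.comp_app, NatTrans.comp_app, reassoc_of% η.comm u X, θ.comm, Functor.map_comp,
      Category.assoc]

/-- The inverse of an isomodification. -/
noncomputable def Modification.inv {Φ Ψ : Morphism D E} (η : Modification Φ Ψ) (h : η.IsIso) :
    Modification Ψ Φ where
  app K _ := haveI := h K; CategoryTheory.inv (η.app K)
  comm {J K} _ _ u X := by
    have := h J
    have := h K
    rw [NatIso.isIso_inv_app, NatIso.isIso_inv_app, IsIso.comp_inv_eq, Category.assoc, η.comm,
      ← Functor.map_comp_assoc, IsIso.inv_hom_id, CategoryTheory.Functor.map_id, Category.id_comp]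

/-- Whiskering of a modification by a morphism that is applied first. -/
def Modification.whiskerLeft (Φ : Morphism C D) {Ψ Ψ' : Morphism D E} (η : Modification Ψ Ψ') :
    Modification (Φ.comp Ψ) (Φ.comp Ψ') where
  app K _ := Functor.whiskerLeft (Φ.app K) (η.app K)
  comm {J K} _ _ u X := by
    have n := (η.app J).naturality ((Φ.γ u).hom.app X)
    have c := η.comm u ((Φ.app K).obj X)
    simp only [Functor.comp_obj] at n c
    rw [Morphism.comp_γ_app, Morphism.comp_γ_app]
    refine (Category.assoc ((Ψ.γ u).hom.app ((Φ.app K).obj X)) _ _).trans ?_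
    exact (congrArg (fun t => (Ψ.γ u).hom.app _ ≫ t) n).trans ((Category.assoc _ _ _).symm.trans
      ((congrArg (fun t => t ≫ (Ψ'.app J).map _) c).trans (Category.assoc _ _ _)))

/-- Whiskering of a modification by a morphism that is applied last. -/
def Modification.whiskerRight {Φ Φ' : Morphism C D} (η : Modification Φ Φ') (Ψ : Morphism D E) :
    Modification (Φ.comp Ψ) (Φ'.comp Ψ) where
  app K _ := Functor.whiskerRight (η.app K) (Ψ.app K)
  comm {J K} _ _ u X := by
    have n := (Ψ.γ u).hom.naturality ((η.app K).app X)
    have c := congrArg (fun t => (Ψ.app J).map t) (η.comm u X)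
    simp only [Functor.comp_map, Functor.map_comp] at n c
    rw [Morphism.comp_γ_app, Morphism.comp_γ_app]
    refine (Category.assoc ((Ψ.γ u).hom.app ((Φ.app K).obj X)) _ _).trans ?_
    exact (congrArg (fun t => (Ψ.γ u).hom.app _ ≫ t) c).trans ((Category.assoc _ _ _).symm.trans
      ((congrArg (fun t => t ≫ (Ψ.app J).map _) n.symm).trans (Category.assoc _ _ _)))

/-- The morphism commutes with restriction up to equality. -/
def Morphism.IsStrict (Φ : Morphism D E) : Prop :=
  ∀ {J K : Type w} [SmallCategory J] [SmallCategory K] (u : J ⥤ K) (X : D.obj K),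
    ∃ h, (Φ.γ u).hom.app X = eqToHom h

theorem Morphism.IsStrict.comp {Φ : Morphism C D} {Ψ : Morphism D E} (h : Φ.IsStrict)
    (h' : Ψ.IsStrict) : (Φ.comp Ψ).IsStrict := by
  intro J K _ _ u X
  obtain ⟨e, he⟩ := h u X
  obtain ⟨e', he'⟩ := h' u ((Φ.app K).obj X)
  refine ⟨e'.trans (congrArg (Ψ.app J).obj e), ?_⟩
  rw [Morphism.comp_γ_app, he, he', eqToHom_map, eqToHom_trans]
  rfl

theorem Morphism.isStrict_id : (Morphism.id D).IsStrict := fun u X =>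
  ⟨rfl, Morphism.id_γ_app u X⟩

/-- Strict morphisms with equal components are isomorphic. -/
def Modification.ofStrict {Φ Ψ : Morphism D E} (hΦ : Φ.IsStrict) (hΨ : Ψ.IsStrict)
    (h : ∀ (K : Type w) [SmallCategory K], Φ.app K = Ψ.app K) : Modification Φ Ψ where
  app K _ := eqToHom (h K)
  comm {J K} _ _ u X := by
    obtain ⟨e, he⟩ := hΦ u X
    obtain ⟨e', he'⟩ := hΨ u X
    rw [he, he', eqToHom_app, eqToHom_app, eqToHom_map, eqToHom_trans, eqToHom_trans]

theorem Morphism.assoc_γ_app {B : Prederivator.{w, v, u}} (Φ : Morphism B C) (Ψ : Morphism C D)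
    (Θ : Morphism D E) {J K : Type w} [SmallCategory J] [SmallCategory K] (u : J ⥤ K)
    (X : B.obj K) :
    (((Φ.comp Ψ).comp Θ).γ u).hom.app X = ((Φ.comp (Ψ.comp Θ)).γ u).hom.app X := by
  rw [Morphism.comp_γ_app, Morphism.comp_γ_app, Morphism.comp_γ_app, Morphism.comp_γ_app]
  refine (congrArg (fun t => (Θ.γ u).hom.app _ ≫ t) ((Θ.app J).map_comp _ _)).trans ?_
  exact (Category.assoc _ _ _).symm

/-- The same modification, with values in the composite that is associated to the right. -/
def Modification.assocRight {B : Prederivator.{w, v, u}} {Φ : Morphism B C} {Ψ : Morphism C D}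
    {Θ : Morphism D E} {Ξ : Morphism B E} (η : Modification Ξ ((Φ.comp Ψ).comp Θ)) :
    Modification Ξ (Φ.comp (Ψ.comp Θ)) where
  app := η.app
  comm u X := (η.comm u X).trans
    (congrArg (fun t => _ ≫ t) (Morphism.assoc_γ_app Φ Ψ Θ u X))

/-- The same modification, with values in the composite that is associated to the left. -/
def Modification.assocLeft {B : Prederivator.{w, v, u}} {Φ : Morphism B C} {Ψ : Morphism C D}
    {Θ : Morphism D E} {Ξ : Morphism B E} (η : Modification Ξ (Φ.comp (Ψ.comp Θ))) :
    Modification Ξ ((Φ.comp Ψ).comp Θ) where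
  app := η.app
  comm u X := (η.comm u X).trans
    (congrArg (fun t => _ ≫ t) (Morphism.assoc_γ_app Φ Ψ Θ u X).symm)

end Modifications

/-! ### Units and counits of Kan extensions as modifications -/

section Kan

variable (D : Prederivator.{w, v, u})
variable {A B : Type w} [SmallCategory A] [SmallCategory B]

theorem Morphism.IsStrict.of_eq {D : Prederivator.{w, v₁, u₁}} {E : Prederivator.{w, v₂, u₂}}
    {Φ : Morphism D E} (h : ∀ {J K : Type w} [SmallCategory J] [SmallCategory K] (u : J ⥤ K),
      ∃ e, Φ.γ u = eqToIso e) : Φ.IsStrict := by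
  intro J K _ _ u X
  obtain ⟨e, he⟩ := h u
  exact ⟨congrArg (fun F => F.obj X) e, by rw [he, eqToIso.hom, eqToHom_app]⟩

theorem isStrict_restr (v : A ⥤ B) : (D.restr v).IsStrict :=
  Morphism.IsStrict.of_eq fun _ => ⟨_, rfl⟩

theorem isStrict_ev (a : A) : (D.ev a).IsStrict := Morphism.IsStrict.of_eq fun _ => ⟨_, rfl⟩

theorem isStrict_const (A : Type w) [SmallCategory A] : (D.const A).IsStrict :=
  Morphism.IsStrict.of_eq fun _ => ⟨_, rfl⟩

theorem restr_ev_app (v : A ⥤ B) {a : A} {b : B}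
    (h : ∀ (K : Type w) [SmallCategory K],
      CategoryTheory.Prod.sectL K a ⋙ prodSnd K v = CategoryTheory.Prod.sectL K b)
    (K : Type w) [SmallCategory K] : ((D.restr v).comp (D.ev a)).app K = (D.ev b).app K :=
  (D.map_comp _ _).symm.trans (congrArg D.map (h K))

/-- Evaluation of a restriction. -/
def restrEv (v : A ⥤ B) {a : A} {b : B} (h : ∀ (K : Type w) [SmallCategory K],
    CategoryTheory.Prod.sectL K a ⋙ prodSnd K v = CategoryTheory.Prod.sectL K b) :
    Modification ((D.restr v).comp (D.ev a)) (D.ev b) :=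
  Modification.ofStrict (Morphism.IsStrict.comp (D.isStrict_restr v) (D.isStrict_ev a)) (D.isStrict_ev b)
    (D.restr_ev_app v h)

theorem const_ev_app (a : A) (K : Type w) [SmallCategory K] :
    (Morphism.id D).app K = ((D.const A).comp (D.ev a)).app K :=
  (D.map_id K).symm.trans (D.map_comp (CategoryTheory.Prod.sectL K a) (CategoryTheory.Prod.fst K A))

/-- Evaluation of a constant diagram. -/
def constEv (a : A) : Modification (Morphism.id D) ((D.const A).comp (D.ev a)) :=
  Modification.ofStrict Morphism.isStrict_id
    (Morphism.IsStrict.comp (D.isStrict_const A) (D.isStrict_ev a)) (D.const_ev_app a)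

theorem sq_eqToHom {I J K L : Type w} [SmallCategory I] [SmallCategory J] [SmallCategory K]
    [SmallCategory L] {f : I ⥤ J} {p : J ⥤ L} {g : I ⥤ K} {k : K ⥤ L} (h : f ⋙ p = g ⋙ k)
    (X : D.obj L) : (D.sq (eqToHom h)).app X = eqToHom (congrArg (fun F => F.obj X)
      ((D.map_comp f p).symm.trans ((congrArg D.map h).trans (D.map_comp g k)))) := by
  have h1 : D.map₂ (eqToHom h) = eqToHom (congrArg D.map h) := by
    generalize f ⋙ p = a at h
    subst h
    exact D.map₂_id _
  simp [sq, h1, mc, eqToHom_app]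

/-- Both sides are morphisms that come from equalities of objects. In this form the coherence of a
restriction can be matched with the 2-cell in the equations for mates. -/
theorem restr_γ_app (v : A ⥤ B) {J K : Type w} [SmallCategory J] [SmallCategory K] (u : J ⥤ K)
    (X : D.obj (K × B)) :
    ((D.restr v).γ u).hom.app X = (D.sq (f := prodFst u A) (u := prodSnd K v) (g := prodSnd J v)
      (k := prodFst u B) (𝟙 (u.prod v))).app X := by
  obtain ⟨e, he⟩ := D.isStrict_restr v u X
  exact he.trans (D.sq_eqToHom (f := prodFst u A) (p := prodSnd K v) (g := prodSnd J v)
    (k := prodFst u B) rfl X).symm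

theorem restr_γ_inv_app (v : A ⥤ B) {J K : Type w} [SmallCategory J] [SmallCategory K] (u : J ⥤ K)
    (X : D.obj (K × B)) :
    ((D.restr v).γ u).inv.app X = (D.sq (f := prodSnd J v) (u := prodFst u B) (g := prodFst u A)
      (k := prodSnd K v) (𝟙 (u.prod v))).app X := by
  obtain ⟨e, he⟩ := D.isStrict_restr v u X
  have h1 : ((D.restr v).γ u).app X = eqToIso e := Iso.ext he
  exact (congrArg Iso.inv h1).trans (D.sq_eqToHom (f := prodSnd J v) (p := prodFst u B)
    (g := prodFst u A) (k := prodSnd K v) rfl X).symm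

variable {D} in
/-- The unit of an adjunction with a restriction as right adjoint gives comparisons of values. -/
def unitEv {Φ : Morphism (D.shift A) (D.shift B)} {v : A ⥤ B}
    (U : Modification (Morphism.id (D.shift A)) (Φ.comp (D.restr v))) {a : A} {b : B}
    (h : ∀ (K : Type w) [SmallCategory K],
      CategoryTheory.Prod.sectL K a ⋙ prodSnd K v = CategoryTheory.Prod.sectL K b)
    {Θ : Morphism (D.shift B) D} (η : Modification (D.ev b) Θ) :
    Modification (D.ev a) (Φ.comp Θ) :=
  ((Modification.ofStrict (D.isStrict_ev a)
    (Morphism.isStrict_id.comp (D.isStrict_ev a)) fun _ _ => rfl).vcomp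
      (U.whiskerRight (D.ev a))).assocRight.vcomp <|
    ((D.restrEv v h).vcomp η).whiskerLeft Φ

variable [D.IsDerivator]

/-- The unit of the adjunction `v_! ⊣ v^*`, as a modification. -/
noncomputable def lanUnit (v : A ⥤ B) :
    Modification (Morphism.id (D.shift A)) ((D.lanMor v).comp (D.restr v)) where
  app K _ := (D.lanAdj (prodSnd K v)).unit
  comm {J K} _ _ u X := by
    have e := D.unit_mateL (f := prodFst u A) (u := prodSnd K v) (g := prodSnd J v)
      (k := prodFst u B) (𝟙 (u.prod v)) X
    rw [← restr_γ_app] at e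
    rw [Morphism.comp_γ_app, Morphism.id_γ_app]
    -- The coherence of `lanMor` is the inverse of the mate, so the mate changes sides.
    have e2 := (Iso.eq_comp_inv ((D.map (prodSnd J v)).mapIso ((D.lanIso u v).app X))).2 e
    exact (Category.id_comp _).trans (e2.trans (Category.assoc _ _ _))

/-- The counit of the adjunction `v^* ⊣ v_*`, as a modification. -/
noncomputable def ranCounit (v : A ⥤ B) :
    Modification ((D.ranMor v).comp (D.restr v)) (Morphism.id (D.shift A)) where
  app K _ := (D.ranAdj (prodSnd K v)).counit
  comm {J K} _ _ u X := by
    have e := D.mateR_counit (f := prodFst u A) (u := prodSnd K v) (g := prodSnd J v)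
      (k := prodFst u B) (𝟙 (u.prod v)) X
    rw [← restr_γ_inv_app] at e
    have e1 := (Iso.eq_inv_comp (((D.restr v).γ u).app ((D.ran (prodSnd K v)).obj X))).1 e
    rw [Morphism.comp_γ_app, Morphism.id_γ_app]
    exact (Category.assoc _ _ _).trans (e1.trans (Category.comp_id _).symm)

end Kan

/-! ### Adjunctions and equivalences from an invertible unit -/

section Adjunctions

variable {D : Prederivator.{w, v₁, u₁}} {E : Prederivator.{w, v₂, u₂}}

/-- An isomodification `id ⟶ Φ Ψ` is the unit of an adjunction if `Ψ` is fully faithful. -/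
theorem exists_adj {Φ : Morphism D E} {Ψ : Morphism E D}
    (hΨ : ∀ (K : Type w) [SmallCategory K], (Ψ.app K).Full ∧ (Ψ.app K).Faithful)
    (η : Modification (Morphism.id D) (Φ.comp Ψ)) (hη : η.IsIso) : Nonempty (Adj Φ Ψ) := by
  have full (K : Type w) [SmallCategory K] : (Ψ.app K).Full := (hΨ K).1
  have faithful (K : Type w) [SmallCategory K] : (Ψ.app K).Faithful := (hΨ K).2
  have iso (K : Type w) [SmallCategory K] (X : D.obj K) : IsIso ((η.app K).app X) :=
    (NatTrans.isIso_iff_isIso_app _).1 (hη K) X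
  let i (K : Type w) [SmallCategory K] (X : D.obj K) :
      X ≅ (Ψ.app K).obj ((Φ.app K).obj X) := @asIso _ _ _ _ ((η.app K).app X) (iso K X)
  have nat (K : Type w) [SmallCategory K] {X Y : D.obj K} (m : X ⟶ Y) :
      m ≫ (i K Y).hom = (i K X).hom ≫ (Ψ.app K).map ((Φ.app K).map m) := (η.app K).naturality m
  -- The right triangle identity forces the image of the counit under Ψ to be the inverse of η. Full
  -- faithfulness of Ψ provides such a counit and reduces its remaining properties to their images
  -- under Ψ.
  let ε (K : Type w) [SmallCategory K] (Y : E.obj K) : (Φ.app K).obj ((Ψ.app K).obj Y) ⟶ Y :=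
    (Ψ.app K).preimage (i K ((Ψ.app K).obj Y)).inv
  have hε (K : Type w) [SmallCategory K] (Y : E.obj K) :
      (Ψ.app K).map (ε K Y) = (i K ((Ψ.app K).obj Y)).inv := (Ψ.app K).map_preimage _
  refine ⟨{ unit := η, counit := { app := fun K _ => { app := ε K, naturality := ?_ }, comm := ?_ },
            left_triangle := ?_, right_triangle := ?_ }⟩
  · intro Y Y' m
    apply (Ψ.app K).map_injective
    have h : (Ψ.app K).map ((Φ.app K).map ((Ψ.app K).map m)) ≫ (Ψ.app K).map (ε K Y') =
        (Ψ.app K).map (ε K Y) ≫ (Ψ.app K).map m := by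
      rw [hε, hε, Iso.comp_inv_eq, Category.assoc, Iso.eq_inv_comp]
      exact (nat K ((Ψ.app K).map m)).symm
    exact ((Ψ.app K).map_comp _ _).trans (h.trans ((Ψ.app K).map_comp _ _).symm)
  · intro J K _ _ u Y
    apply (Ψ.app J).map_injective
    have c : (i J ((D.map u).obj ((Ψ.app K).obj Y))).hom =
        (D.map u).map (i K ((Ψ.app K).obj Y)).hom ≫
          (Ψ.γ u).hom.app ((Φ.app K).obj ((Ψ.app K).obj Y)) ≫
            (Ψ.app J).map ((Φ.γ u).hom.app ((Ψ.app K).obj Y)) := by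
      have c := η.comm u ((Ψ.app K).obj Y)
      rw [Morphism.comp_γ_app, Morphism.id_γ_app] at c
      exact (Category.id_comp _).symm.trans c
    have n1 := (Ψ.γ u).hom.naturality (ε K Y)
    have n2 := nat J ((Ψ.γ u).hom.app Y)
    simp only [Functor.comp_map, Functor.comp_obj] at n1 n2
    have h : (Ψ.app J).map ((Φ.γ u).hom.app ((Ψ.app K).obj Y)) ≫
        (Ψ.app J).map ((Φ.app J).map ((Ψ.γ u).hom.app Y)) ≫
          (i J ((Ψ.app J).obj ((E.map u).obj Y))).inv = (Ψ.app J).map ((E.map u).map (ε K Y)) := by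
      rw [← cancel_epi ((Ψ.γ u).hom.app ((Φ.app K).obj ((Ψ.app K).obj Y))), ← n1, hε,
        ← cancel_epi ((D.map u).map (i K ((Ψ.app K).obj Y)).hom), ← Functor.map_comp_assoc (D.map u),
        Iso.hom_inv_id, CategoryTheory.Functor.map_id, Category.id_comp]
      have c' := congrArg (fun t => t ≫ (Ψ.app J).map ((Φ.app J).map ((Ψ.γ u).hom.app Y)) ≫
        (i J ((Ψ.app J).obj ((E.map u).obj Y))).inv) c
      simp only [Category.assoc] at c'
      rw [← c', ← Category.assoc, Iso.comp_inv_eq, n2]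
    rw [Morphism.comp_γ_app, Morphism.id_γ_app]
    rw [← hε] at h
    refine ((Ψ.app J).map_comp _ _).trans ?_
    refine (congrArg (fun t => t ≫ _) ((Ψ.app J).map_comp _ _)).trans ?_
    refine (Category.assoc _ _ _).trans (h.trans ?_)
    exact congrArg (fun t => (Ψ.app J).map t) (Category.comp_id _).symm
  · intro K _ X
    apply (Ψ.app K).map_injective
    -- Naturality of η at its own invertible component shows that Ψ Φ applied to η at X is η at Ψ Φ
    -- X.
    have h : (Ψ.app K).map ((Φ.app K).map (i K X).hom) ≫
        (Ψ.app K).map (ε K ((Φ.app K).obj X)) = 𝟙 _ := by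
      rw [hε, Iso.comp_inv_eq, Category.id_comp, ← cancel_epi (i K X).hom]
      exact (nat K (i K X).hom).symm
    exact ((Ψ.app K).map_comp _ _).trans (h.trans (CategoryTheory.Functor.map_id _ _).symm)
  · intro K _ Y
    exact (congrArg (fun t => _ ≫ t) (hε K Y)).trans (i K ((Ψ.app K).obj Y)).hom_inv_id

/-- The invertible unit makes the fully faithful Ψ essentially surjective at each level; two out of
three then gives Φ. -/
theorem isEquivalence_of_unit {Φ : Morphism D E} {Ψ : Morphism E D}
    (hΨ : ∀ (K : Type w) [SmallCategory K], (Ψ.app K).Full ∧ (Ψ.app K).Faithful)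
    (η : Modification (Morphism.id D) (Φ.comp Ψ)) (hη : η.IsIso) : Φ.IsEquivalence := by
  intro K _
  have := (hΨ K).1
  have := (hΨ K).2
  let e : 𝟭 (D.obj K) ≅ Φ.app K ⋙ Ψ.app K := @asIso _ _ _ _ (η.app K) (hη K)
  have : (Ψ.app K).EssSurj := ⟨fun X => ⟨(Φ.app K).obj X, ⟨(e.app X).symm⟩⟩⟩
  have : (Ψ.app K).IsEquivalence := { }
  have : (Φ.app K ⋙ Ψ.app K).IsEquivalence := Functor.isEquivalence_of_iso e
  exact Functor.isEquivalence_of_comp_right _ (Ψ.app K)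

/-- At each level this is an ordinary adjunction whose left adjoint is an equivalence. -/
theorem Adj.isIso_of_isEquivalence {Φ : Morphism D E} {Ψ : Morphism E D} (adj : Adj Φ Ψ)
    (h : Φ.IsEquivalence) : adj.unit.IsIso ∧ adj.counit.IsIso := by
  have key (K : Type w) [SmallCategory K] :
      IsIso (adj.unit.app K) ∧ IsIso (adj.counit.app K) := by
    have := h K
    let a : Φ.app K ⊣ Ψ.app K := Adjunction.mkOfUnitCounit
      { unit := adj.unit.app K
        counit := adj.counit.app K
        left_triangle := by
          ext X
          refine Eq.trans ?_ (adj.left_triangle K X)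
          exact congrArg (fun t => _ ≫ t) (Category.id_comp _)
        right_triangle := by
          ext X
          refine Eq.trans ?_ (adj.right_triangle K X)
          exact congrArg (fun t => _ ≫ t) (Category.id_comp _) }
    have : (Ψ.app K).IsEquivalence := a.isEquivalence_right_of_isEquivalence_left
    exact ⟨inferInstanceAs (IsIso a.unit), inferInstanceAs (IsIso a.counit)⟩
  exact ⟨fun K _ => (key K).1, fun K _ => (key K).2⟩

end Adjunctions

/-! ### Comparison of values along chains of restrictions and Kan extensions -/

section Comparison

variable {D : Prederivator.{w, v, u}} 
variable {A B : Type w} [SmallCategory A] [SmallCategory B]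

theorem isIso_eqToHom_app {C : Type u₁} [Category.{v₁} C] {E : Type u₂} [Category.{v₂} E]
    {F G : C ⥤ E} (h : F = G) (X : C) : IsIso ((eqToHom h).app X) := by
  subst h; exact inferInstanceAs (IsIso (𝟙 _))

theorem isIso_unitEv {Φ : Morphism (D.shift A) (D.shift B)} {v : A ⥤ B}
    (U : Modification (Morphism.id (D.shift A)) (Φ.comp (D.restr v))) {a : A} {b : B}
    (h : ∀ (K : Type w) [SmallCategory K],
      CategoryTheory.Prod.sectL K a ⋙ prodSnd K v = CategoryTheory.Prod.sectL K b)
    {Θ : Morphism (D.shift B) D} (η : Modification (D.ev b) Θ) (K : Type w) [SmallCategory K]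
    (X : D.obj (K × A))
    (h1 : IsIso ((D.map (CategoryTheory.Prod.sectL K a)).map ((U.app K).app X)))
    (h2 : IsIso ((η.app K).app ((Φ.app K).obj X))) :
    IsIso (((unitEv U h η).app K).app X) := by
  have h3 : IsIso (((D.restrEv v h).app K).app ((Φ.app K).obj X)) :=
    isIso_eqToHom_app (D.restr_ev_app v h K) _
  have h4 : IsIso (((D.restrEv v h).app K).app ((Φ.app K).obj X) ≫
    (η.app K).app ((Φ.app K).obj X)) := inferInstance
  have h5 : IsIso (𝟙 _ ≫ (D.map (CategoryTheory.Prod.sectL K a)).map ((U.app K).app X)) :=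
    inferInstance
  exact IsIso.comp_isIso' h5 h4

/-- Evaluation of a restriction, followed by a comparison. -/
def restrStep (v : A ⥤ B) {a : A} {b : B} (h : ∀ (K : Type w) [SmallCategory K],
      CategoryTheory.Prod.sectL K a ⋙ prodSnd K v = CategoryTheory.Prod.sectL K b)
    {Θ : Morphism (D.shift A) D} (η : Modification (D.ev a) Θ) :
    Modification (D.ev b) ((D.restr v).comp Θ) :=
  (Modification.ofStrict (D.isStrict_ev b)
    (Morphism.IsStrict.comp (D.isStrict_restr v) (D.isStrict_ev a))
      fun K _ => (D.restr_ev_app v h K).symm).vcomp (η.whiskerLeft (D.restr v))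

theorem isIso_restrStep (v : A ⥤ B) {a : A} {b : B} (h : ∀ (K : Type w) [SmallCategory K],
      CategoryTheory.Prod.sectL K a ⋙ prodSnd K v = CategoryTheory.Prod.sectL K b)
    {Θ : Morphism (D.shift A) D} (η : Modification (D.ev a) Θ) (K : Type w) [SmallCategory K]
    (X : D.obj (K × B)) (h2 : IsIso ((η.app K).app ((D.map (prodSnd K v)).obj X))) :
    IsIso (((restrStep v h η).app K).app X) :=
  IsIso.comp_isIso' (isIso_eqToHom_app (D.restr_ev_app v h K).symm X) h2

/-- Evaluation of a constant diagram, followed by a comparison. -/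
def constStep {a : A} {Θ : Morphism (D.shift A) D} (η : Modification (D.ev a) Θ) :
    Modification (Morphism.id D) ((D.const A).comp Θ) :=
  (D.constEv a).vcomp (η.whiskerLeft (D.const A))

theorem isIso_constStep {a : A} {Θ : Morphism (D.shift A) D} (η : Modification (D.ev a) Θ)
    (K : Type w) [SmallCategory K] (X : D.obj K)
    (h2 : IsIso ((η.app K).app (((D.const A).app K).obj X))) :
    IsIso (((constStep η).app K).app X) :=
  IsIso.comp_isIso' (isIso_eqToHom_app (D.const_ev_app a K) X) h2

theorem isStrict_incl (P : Sub D) : P.incl.IsStrict := Morphism.IsStrict.of_eq fun _ => ⟨_, rfl⟩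

theorem isIso_map_app {C : Type u₁} [Category.{v₁} C] {C' : Type u₂} [Category.{v₂} C']
    {C'' : Type u₃} [Category.{v₃} C''] {F G : C ⥤ C'} (α : F ⟶ G) (h : IsIso α) (H : C' ⥤ C'')
    (X : C) : IsIso (H.map (α.app X)) := inferInstance

variable [D.IsDerivator]

variable (D) in
/-- The inverse of the counit of the adjunction `v^* ⊣ v_*` for fully faithful `v`. -/
noncomputable def ranCounitInv (v : A ⥤ B)
    (hv : ∀ (K : Type w) [SmallCategory K], (prodSnd K v).Full ∧ (prodSnd K v).Faithful) :
    Modification (Morphism.id (D.shift A)) ((D.ranMor v).comp (D.restr v)) :=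
  (D.ranCounit v).inv fun K _ => by
    have := (hv K).1
    have := (hv K).2
    exact D.isIso_ranAdj_counit (prodSnd K v)

theorem isIso_ranCounitInv (v : A ⥤ B)
    (hv : ∀ (K : Type w) [SmallCategory K], (prodSnd K v).Full ∧ (prodSnd K v).Faithful)
    (K : Type w) [SmallCategory K] : IsIso ((D.ranCounitInv v hv).app K) := by
  have := (hv K).1
  have := (hv K).2
  have h : IsIso ((D.ranCounit v).app K) := D.isIso_ranAdj_counit (prodSnd K v)
  exact inferInstanceAs (IsIso (inv ((D.ranCounit v).app K)))

end Comparison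

/-! ### The unit of the stabilization -/

section Stabilization

variable (D : Prederivator.{w, v, u}) [D.IsDerivator]

/-- The comparison of the value at the origin of `X` and of `loc X`. -/
noncomputable def evLoc : Modification (D.ev (ULift.up.{w} PV.zero))
    (D.loc.comp (D.ev (ULift.up PV.zero))) :=
  -- Each link names the point that corresponds to the origin. At k = 0 the column over (0, 0) meets
  -- Z, so the right Kan extension keeps the value; the last link maps stage 0 to the colimit.
  .assocLeft <| restrStep omegaFunctor (a := ULift.up (PVge.zero, PV.zero)) (fun _ _ => rfl) <|
  .assocLeft <| restrStep zetaV (a := ULift.up (⟨(PVge.zero, 0), fun _ => le_rfl⟩, PV.zero))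
    (fun _ _ => rfl) <|
  .assocLeft <| unitEv (D.ranCounitInv incZV prodSnd_incZV)
    (b := ULift.up ((PVge.zero, 0), PV.zero)) (fun _ _ => rfl) <|
  .assocLeft <| restrStep columnV (a := ULift.up (0, PV.zero)) (fun _ _ => rfl) <|
  unitEv (D.lanUnit projV) (b := ULift.up PV.zero) (fun _ _ => rfl) <|
  .id (D.ev (ULift.up PV.zero))

/-- The comparison of `X` and of the value at the origin of the suspension prespectrum of `X`. -/
noncomputable def evConnective :
    Modification (Morphism.id D) (D.connective.comp (D.ev (ULift.up PV.zero))) :=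
  .assocLeft <| constStep (a := ⟨PUnit.unit⟩) <|
  .assocLeft <| unitEv (D.lanUnit (pt (ULift.up PVle.zero))) (b := ULift.up PVle.zero)
    (fun _ _ => rfl) <|
  .assocLeft <| unitEv (D.ranCounitInv incVle prodSnd_incVle)
    (b := ULift.up ⟨PV.zero, fun _ => le_rfl⟩) (fun _ _ => rfl) <|
  unitEv (D.lanUnit incW) (b := ULift.up PV.zero) (fun _ _ => rfl) <|
  .id (D.ev (ULift.up PV.zero))

variable {D}
variable {K : Type w} [SmallCategory K]

theorem isIso_evConnective : D.evConnective.IsIso := by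
  intro K _
  rw [NatTrans.isIso_iff_isIso_app]
  intro X
  refine isIso_constStep _ K X ?_
  refine isIso_unitEv _ _ _ K _ ?_ ?_
  · exact isIso_map_app _ (D.isIso_lanAdj_unit (fib K PVle.zero)) _ _
  refine isIso_unitEv _ _ _ K _ ?_ ?_
  · exact isIso_map_app _ (isIso_ranCounitInv incVle prodSnd_incVle K) _ _
  refine isIso_unitEv _ _ _ K _ ?_ (inferInstanceAs (IsIso (𝟙 _)))
  exact isIso_map_app _ (D.isIso_lanAdj_unit (prodSnd K incW.{w})) _ _

/-- Every link of the chain except the last, the passage to the colimit, is invertible for all X. -/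
theorem isIso_evLoc (X : D.obj (K × ULift.{w} PV))
    (h : IsIso ((D.at_ K ((0, PV.zero) : ℕ × PV)).map
      ((D.lanAdj (mono K projM)).unit.app ((D.locSeq K).obj X)))) :
    IsIso ((D.evLoc.app K).app X) := by
  exact isIso_restrStep _ (fun _ _ => rfl) _ K X <| isIso_restrStep _ (fun _ _ => rfl) _ K _ <|
    isIso_unitEv _ (fun _ _ => rfl) _ K _
      (isIso_map_app _ (isIso_ranCounitInv incZV prodSnd_incZV K) _ _) <|
    isIso_restrStep _ (fun _ _ => rfl) _ K _ <|
    isIso_unitEv _ (fun _ _ => rfl) _ K _ h (inferInstanceAs (IsIso (𝟙 _)))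

theorem IsStable.exists_spectrum_connective (hS : D.IsStable) (X : D.obj K) :
    ∃ (T : D.obj (K × ULift.{w} PV)) (m : (D.connective.app K).obj X ⟶ T), IsSpectrum T ∧
      ∀ x : PV, x.Nonneg → IsIso ((D.at_ K x).map m) :=
  exists_spectrum hS.1 (vanishes_connective hS.1 X) fun _ hn => hS.cart_connective X hn

/-- With m : L X ⟶ T as in `exists_spectrum`, the object in question is isomorphic to loc T, hence
to T. -/
theorem IsStable.isSpectrum_loc_connective (hS : D.IsStable) (X : D.obj K) :
    IsSpectrum ((D.loc.app K).obj ((D.connective.app K).obj X)) := by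
  obtain ⟨T, m, hT, hm⟩ := hS.exists_spectrum_connective X
  obtain ⟨e⟩ := hT.loc_iso
  exact hT.of_iso (@asIso _ _ _ _ _ (isIso_loc_map m hm) ≪≫ e).symm

/-- Naturality in m compares the passage from stage 0 to the colimit for L X with that for T, where
the sequence is constant. At the origin m already induces an isomorphism at stage 0, as the bound
-x.1.1 ≤ k holds there with equality. -/
theorem IsStable.isIso_evLoc_connective (hS : D.IsStable) (X : D.obj K) :
    IsIso ((D.evLoc.app K).app ((D.connective.app K).obj X)) := by
  obtain ⟨T, m, hT, hm⟩ := hS.exists_spectrum_connective X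
  refine isIso_evLoc _ ?_
  have n := congrArg (fun t => (D.at_ K ((0, PV.zero) : ℕ × PV)).map t)
    ((D.lanAdj (mono K projM)).unit.naturality ((D.locSeq K).map m))
  simp only [Functor.map_comp] at n
  have h1 : IsIso ((D.at_ K ((0, PV.zero) : ℕ × PV)).map ((D.locSeq K).map m)) :=
    isIso_locSeq_at m hm 0 PV.zero (by simp)
  have h2 := isIso_locSeq_unit hT
  have h3 : IsIso ((D.lan (mono K projM)).map ((D.locSeq K).map m)) := isIso_loc_map m hm
  have h4 : IsIso ((D.at_ K ((0, PV.zero) : ℕ × PV)).map ((D.locSeq K).map m) ≫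
      (D.at_ K ((0, PV.zero) : ℕ × PV)).map
        ((D.lanAdj (mono K projM)).unit.app ((D.locSeq K).obj T))) := inferInstance
  have h5 : IsIso ((D.at_ K ((0, PV.zero) : ℕ × PV)).map ((D.res K projM).map
    ((D.lan (mono K projM)).map ((D.locSeq K).map m)))) := inferInstance
  exact (@isIso_comp_right_iff _ _ _ _ _ _ _ h5).1 (n ▸ h4)

variable (D) in
theorem evalZero_γ_app {J : Type w} [SmallCategory J] (p : J ⥤ K) (Y : D.St.obj K) :
    (D.evalZero.γ p).hom.app Y = ((D.ev (ULift.up PV.zero)).γ p).hom.app Y.1.1 := by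
  have h1 : D.evalZero.IsStrict := Morphism.IsStrict.comp (isStrict_incl _)
    (Morphism.IsStrict.comp (isStrict_incl _) (D.isStrict_ev _))
  obtain ⟨e, he⟩ := h1 p Y
  obtain ⟨e', he'⟩ := D.isStrict_ev (ULift.up PV.zero) p Y.1.1
  exact he.trans he'.symm

variable (D) in
/-- The comparison of `X` and of the value at the origin of the stabilization of `X`. -/
noncomputable def stabUnit
    (h₁ : ∀ (K : Type w) [SmallCategory K] (X : D.obj K),
      D.vanishing.prop K (((D.connective.comp D.loc).app K).obj X))
    (h₂ : ∀ (K : Type w) [SmallCategory K] (X : D.obj K),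
      D.omegaSpectra.prop K (((D.vanishing.lift (D.connective.comp D.loc) h₁).app K).obj X)) :
    Modification (Morphism.id D) ((D.stab h₁ h₂).comp D.evalZero) where
  app := (D.evConnective.vcomp (D.evLoc.whiskerLeft D.connective)).assocLeft.app
  comm {J K} _ _ p X := by
    -- The components are those of a modification with values in D^V evaluated at the origin; only
    -- the coherence that passes through the full subprederivators has to be matched.
    refine ((D.evConnective.vcomp (D.evLoc.whiskerLeft D.connective)).assocLeft.comm p X).trans
      (congrArg (fun t => _ ≫ t) ?_)
    refine (Morphism.comp_γ_app _ _ p X).trans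
      (Eq.trans ?_ (Morphism.comp_γ_app (D.stab h₁ h₂) D.evalZero p X).symm)
    exact congrArg (fun t => t ≫ ((D.ev (ULift.up PV.zero)).app J).map
      (((D.connective.comp D.loc).γ p).hom.app X))
      (D.evalZero_γ_app p (((D.stab h₁ h₂).app K).obj X)).symm

theorem IsStable.isIso_stabUnit (hS : D.IsStable)
    (h₁ : ∀ (K : Type w) [SmallCategory K] (X : D.obj K),
      D.vanishing.prop K (((D.connective.comp D.loc).app K).obj X))
    (h₂ : ∀ (K : Type w) [SmallCategory K] (X : D.obj K),
      D.omegaSpectra.prop K (((D.vanishing.lift (D.connective.comp D.loc) h₁).app K).obj X)) :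
    (D.stabUnit h₁ h₂).IsIso := by
  intro K _
  rw [NatTrans.isIso_iff_isIso_app]
  intro X
  exact IsIso.comp_isIso' ((NatTrans.isIso_iff_isIso_app _).1 (isIso_evConnective K) X)
    (hS.isIso_evLoc_connective X)

theorem isSpectrum_of_mem_St (hz : Limits.HasZeroObject (D.obj Pt)) (X : D.St.obj K) :
    IsSpectrum (D := D) (K := K) X.1.1 :=
  ⟨(vanishing_iff hz _).1 X.1.2, (isIso_structureMap_iff _ _).1 X.2⟩

theorem IsStable.full_faithful_evalZero (hS : D.IsStable) (K : Type w) [SmallCategory K] :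
    (D.evalZero.app K).Full ∧ (D.evalZero.app K).Faithful := by
  have h (X Y : D.St.obj K) := hS.bijective_at_zero (isSpectrum_of_mem_St hS.1 X)
    (isSpectrum_of_mem_St hS.1 Y)
  constructor
  · refine ⟨fun {X Y} m => ?_⟩
    obtain ⟨f, hf⟩ := (h X Y).2 m
    exact ⟨ObjectProperty.homMk (ObjectProperty.homMk f), hf⟩
  · refine ⟨fun {X Y} f g hfg => ?_⟩
    exact ObjectProperty.hom_ext _ (ObjectProperty.hom_ext _ ((h X Y).1 hfg))

end Stabilization

end Prederivator

/-! ### The stabilization theorem -/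

theorem mainTheorem7 (S : Prederivator.{w, v, u}) [S.IsDerivator] (hS : S.IsStable) :
    ∃ (h₁ : ∀ (K : Type w) [SmallCategory K] (X : S.obj K),
        S.vanishing.prop K (((S.connective.comp S.loc).app K).obj X))
      (h₂ : ∀ (K : Type w) [SmallCategory K] (X : S.obj K),
        S.omegaSpectra.prop K
          (((S.vanishing.lift (S.connective.comp S.loc) h₁).app K).obj X)),
      (S.stab h₁ h₂).IsEquivalence ∧
      Nonempty (Prederivator.Adj (S.stab h₁ h₂) S.evalZero) ∧
      ∀ adj : Prederivator.Adj (S.stab h₁ h₂) S.evalZero,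
        adj.unit.IsIso ∧ adj.counit.IsIso := by
  have h₁ (K : Type w) [SmallCategory K] (X : S.obj K) :
      S.vanishing.prop K (((S.connective.comp S.loc).app K).obj X) :=
    (Prederivator.vanishing_iff hS.1 _).2 (hS.isSpectrum_loc_connective X).vanishes
  have h₂ (K : Type w) [SmallCategory K] (X : S.obj K) : S.omegaSpectra.prop K
      (((S.vanishing.lift (S.connective.comp S.loc) h₁).app K).obj X) :=
    (Prederivator.isIso_structureMap_iff _ _).2 (hS.isSpectrum_loc_connective X).cart
  have hη := hS.isIso_stabUnit h₁ h₂
  have he := Prederivator.isEquivalence_of_unit hS.full_faithful_evalZero (S.stabUnit h₁ h₂) hη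
  exact ⟨h₁, h₂, he, Prederivator.exists_adj hS.full_faithful_evalZero (S.stabUnit h₁ h₂) hη,
    fun adj => adj.isIso_of_isEquivalence he⟩
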